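/- Let $n\ge 0$ be an integer and $d=n+1$. All vector spaces are over $\mathbb R$. **Graphs.** $\mathsf{Gra}_d(N)$ is spanned by directed multigraphs (tadpoles and multiple edges allowed) with $N\ge1$ labelled vertices and $k\ge 0$ labelled edges, modulo: permuting the edges by $\tau$ multiplies by $\mathrm{sgn}(\tau)^{d+1}$, and reversing an edge multiplies by $(-1)^d$; each edge has degree $1-d$. $\mathbb S_N$ acts on the right by relabelling vertices, $i\mapsto\sigma^{-1}(i)$. The composition $\Gamma\circ_1\Gamma'$ inserts $\Gamma'$ at vertex $1$ of $\Gamma$ and sums over all ways of reconnecting the half-edges of $\Gamma$ at that vertex to vertices of $\Gamma'$; the vertices of $\Gamma'$ come first in the vertex labelling, the edges of $\Gamma$ come first in the edge ordering. The full graph complex $\mathsf{fGC}_d$ is the graded vector space $$\mathsf{fGC}_d=\prod_{N\ge1}\big(\mathsf{Gra}_d(N)\otimes\mathrm{sgn}_N^{\otimes d}[d(1-N)]\big)^{\mathbb S_N}$$ (a graph with $N$ vertices and $k$ edges has degree $d(N-1)+k(1-d)$; the product is taken degree by degree) with $$\gamma\circ\gamma'=\sum_{\sigma\in \mathrm{Sh}^{-1}(N',N-1)}\mathrm{sgn}(\sigma)^{d}\,(\gamma\circ_1\gamma')\cdot\sigma,\qquad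 [\gamma,\gamma']=\gamma\circ\gamma'-(-1)^{|\gamma||\gamma'|}\gamma'\circ\gamma,\qquad \delta=[\Gamma_{1\to2},\cdot],$$ where $\Gamma_{1\to 2}$ is the graph with two vertices and one edge $1\to2$, and $\mathrm{Sh}^{-1}(p,q)$ is the set of permutations $\sigma$ of $p+q$ letters for which $\sigma^{-1}$ is increasing on the first $p$ and on the last $q$ letters. **Functions.** Let $\mathcal V$ be a graded symplectic manifold (NP-manifold) of degree $n$ presented in Darboux coordinates: coordinates $x^\mu$ of degree $0$ and $p_\mu$ of degree $n$; $\psi^{\alpha_i}$ of degree $i$ and $\chi_{\alpha_i}$ of degree $n-i$ for the integers $1\le i<n/2$; and, if $n$ is even, $\xi^a$ of degree $n/2$; with symplectic form $dx^\mu\wedge dp_\mu+\sum_i d\psi^{\alpha_i}\wedge d\chi_{\alpha_i}+\frac12\kappa_{ab}d\xi^a\wedge d\xi^b$, where $\kappa$ is a constant nondegenerate matrix with $\kappa_{ab}=-(-1)^{n/2}\kappa_{ba}$. (Each family may be empty.) The functions $\mathscr O(\mathcal V)$ are the polynomials in the graded commuting coordinates of positive degree whose coefficients are smooth functions of the coordinates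 of degree $0$, which range over an open subset of a Euclidean space. Put $$\Delta_{ij}=\frac{\partial}{\partial x^\mu_{(i)}}\frac{\partial}{\partial p_\mu^{(j)}}-(-1)^n\frac{\partial}{\partial p_\mu^{(i)}}\frac{\partial}{\partial x^\mu_{(j)}}+\sum_k\Big(\frac{\partial}{\partial \psi^{\alpha_k}_{(i)}}\frac{\partial}{\partial \chi_{\alpha_k}^{(j)}}+\epsilon_k\frac{\partial}{\partial \chi_{\alpha_k}^{(i)}}\frac{\partial}{\partial \psi^{\alpha_k}_{(j)}}\Big)+\frac{\partial}{\partial \xi^a_{(i)}}\kappa^{ab}\frac{\partial}{\partial \xi^b_{(j)}},$$ with $(\kappa^{ab})=\kappa^{-1}$, with $\epsilon_k=1$ for $n$ odd and $\epsilon_k=-(-1)^k$ for $n$ even, and with the last term present only for $n$ even. Here left derivatives act on the $i$-th and $j$-th tensor factors with Koszul signs. For a graph $\Gamma$ with $N$ vertices let $$\mathsf{Rep}^{(d)}_N(\Gamma)(f_1\otimes\cdots\otimes f_N)=\mu_N\Big(\prod_{(i,j)\in E_\Gamma}\Delta_{ij}(f_1\otimes\cdots\otimes f_N)\Big),$$ where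 $\mu_N$ is multiplication and the product follows the order of the edges. The Poisson bracket is $\{f,g\}=\sum_{A,B}\omega^{AB}(-1)^{|f||B|}\,\partial_Af\,\partial_Bg$, where $A,B$ run over the coordinates and $\Delta_{ij}=\sum_{A,B}\omega^{AB}\partial_A^{(i)}\partial_B^{(j)}$. **Cochains.** Let $\mathcal T=\mathcal T_{\rm poly}^{(n)}=\mathscr O(\mathcal V)[n]$, with suspension $s:\mathcal T\to\mathscr O(\mathcal V)$ of degree $n$ and Schouten bracket $[\cdot,\cdot]_S=s^{-1}\circ\{\cdot,\cdot\}\circ(s\otimes s)$. Let $\mathsf{CE}(\mathcal T)$ be the graded vector space with $\mathsf{CE}^k(\mathcal T)=\prod_{j\ge0}\mathrm{Hom}^{k-j}(\mathcal T^{\wedge j+1},\mathcal T)$, with the product $$f\circ_{\mathsf{NR}}g=\sum_{\sigma\in\mathrm{Sh}^{-1}(q,p-1)}\mathrm{sgn}(\sigma)(-1)^{(p-1)|g|_{\mathrm{Hom}}}(f\circ_1 g)\cdot\sigma$$ ($f$ with $p$ and $g$ with $q$ arguments, $|g|_{\mathrm{Hom}}$ the degree of $g$ as a multilinear map, permutations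 acting with Koszul signs), with $[f,g]_{\mathsf{NR}}=f\circ_{\mathsf{NR}}g-(-1)^{|f||g|}g\circ_{\mathsf{NR}}f$ for the degrees in $\mathsf{CE}(\mathcal T)$, and with $\delta_S=[[\cdot,\cdot]_S,\cdot]_{\mathsf{NR}}$. **Proposition.** $(\mathsf{fGC}_d,\delta,[\cdot,\cdot])$ and, for every such $\mathcal V$, $(\mathsf{CE}(\mathcal T_{\rm poly}^{(n)}),\delta_S,[\cdot,\cdot]_{\mathsf{NR}})$ are dg Lie algebras. The formula for $\mathsf{Rep}^{(d)}_N(\Gamma)$ depends only on the class of $\Gamma$ and so defines linear maps $\mathsf{Rep}^{(d)}_N$ on $\mathsf{Gra}_d(N)$. These induce, by $\gamma\mapsto s^{-1}\circ\mathsf{Rep}^{(d)}_N(\gamma)\circ s^{\otimes N}$ in each arity $N\geq 1$, a morphism of dg Lie algebras $$s^*\mathsf{Rep}^{(d)}:(\mathsf{fGC}_d,\delta,[\cdot,\cdot])\longrightarrow(\mathsf{CE}(\mathcal T_{\rm poly}^{(n)}),\delta_S,[\cdot,\cdot]_{\mathsf{NR}})$$ for every such $\mathcal V$. This family of morphisms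 is jointly injective: a homogeneous element of $\mathsf{fGC}_d$ whose image vanishes for all $\mathcal V$ of degree $n$ is zero. -/

import Mathlib

open scoped TensorProduct ContDiff

noncomputable section

/-! ## dg Lie algebras -/

/-- The graded vector space `⨁ i, G i`, whose homogeneous pieces are submodules of an ambient
space `L`, is a dg Lie algebra over `ℝ`. Here `br i j x y` is the bracket of `x` of degree `i` with
`y` of degree `j`, and `δ i x` is the differential of `x` of degree `i`. -/
structure IsDGLieAlgebra {L : Type} [AddCommGroup L] [Module ℝ L] (G : ℤ → Submodule ℝ L)
    (br : ℤ → ℤ → L → L → L) (δ : ℤ → L → L) : Prop where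
  br_mem : ∀ i j, ∀ x ∈ G i, ∀ y ∈ G j, br i j x y ∈ G (i + j)
  br_add_left : ∀ i j, ∀ x ∈ G i, ∀ x' ∈ G i, ∀ y ∈ G j,
    br i j (x + x') y = br i j x y + br i j x' y
  br_add_right : ∀ i j, ∀ x ∈ G i, ∀ y ∈ G j, ∀ y' ∈ G j,
    br i j x (y + y') = br i j x y + br i j x y'
  br_smul_left : ∀ i j (c : ℝ), ∀ x ∈ G i, ∀ y ∈ G j, br i j (c • x) y = c • br i j x y
  br_smul_right : ∀ i j (c : ℝ), ∀ x ∈ G i, ∀ y ∈ G j, br i j x (c • y) = c • br i j x y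
  br_skew : ∀ i j, ∀ x ∈ G i, ∀ y ∈ G j,
    br i j x y = -(((i * j).negOnePow : ℤ) • br j i y x)
  br_jacobi : ∀ i j k, ∀ x ∈ G i, ∀ y ∈ G j, ∀ z ∈ G k,
    br i (j + k) x (br j k y z) =
      br (i + j) k (br i j x y) z + ((i * j).negOnePow : ℤ) • br j (i + k) y (br i k x z)
  d_mem : ∀ i, ∀ x ∈ G i, δ i x ∈ G (i + 1)
  d_add : ∀ i, ∀ x ∈ G i, ∀ y ∈ G i, δ i (x + y) = δ i x + δ i y
  d_smul : ∀ i (c : ℝ), ∀ x ∈ G i, δ i (c • x) = c • δ i x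
  d_sq : ∀ i, ∀ x ∈ G i, δ (i + 1) (δ i x) = 0
  d_leibniz : ∀ i j, ∀ x ∈ G i, ∀ y ∈ G j,
    δ (i + j) (br i j x y) =
      br (i + 1) j (δ i x) y + (i.negOnePow : ℤ) • br i (j + 1) x (δ j y)

/-- `F` is a morphism of dg Lie algebras `(G, br, δ) → (G', br', δ')`: it is linear of degree `0` and
commutes with the brackets and with the differentials. -/
structure IsDGLieHom {L L' : Type} [AddCommGroup L] [Module ℝ L] [AddCommGroup L'] [Module ℝ L']
    (G : ℤ → Submodule ℝ L) (br : ℤ → ℤ → L → L → L) (δ : ℤ → L → L)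
    (G' : ℤ → Submodule ℝ L') (br' : ℤ → ℤ → L' → L' → L') (δ' : ℤ → L' → L')
    (F : L → L') : Prop where
  map_mem : ∀ i, ∀ x ∈ G i, F x ∈ G' i
  map_add : ∀ i, ∀ x ∈ G i, ∀ y ∈ G i, F (x + y) = F x + F y
  map_smul : ∀ i (c : ℝ), ∀ x ∈ G i, F (c • x) = c • F x
  map_br : ∀ i j, ∀ x ∈ G i, ∀ y ∈ G j, F (br i j x y) = br' i j (F x) (F y)
  map_d : ∀ i, ∀ x ∈ G i, F (δ i x) = δ' i (F x)

/-! ## Unshuffles -/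

/-- The unshuffles of type `(p, N - p)`: permutations `σ` of `N` letters such that `σ⁻¹` is
increasing on the first `p` letters and on the last `N - p` letters. -/
def unshuffles (p N : ℕ) : Finset (Equiv.Perm (Fin N)) :=
  Finset.univ.filter fun σ =>
    (∀ i j : Fin N, i < j → j.val < p → σ⁻¹ i < σ⁻¹ j) ∧
    (∀ i j : Fin N, i < j → p ≤ i.val → σ⁻¹ i < σ⁻¹ j)

/-! ## The graph operad and the full graph complex -/

/-- Directed multigraphs (tadpoles and multiple edges allowed) with `N` labelled vertices and `k`
labelled edges; `Γ e` is the pair (source, target) of the edge `e`. -/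
abbrev Multidigraph (N k : ℕ) : Type := Fin k → Fin N × Fin N

/-- Vector space with basis all directed multigraphs on `N` labelled vertices. -/
abbrev FreeGra (N : ℕ) : Type := (Σ k, Multidigraph N k) →₀ ℝ

/-- The basis element given by a graph. -/
def FreeGra.of {N k : ℕ} (Γ : Multidigraph N k) : FreeGra N := Finsupp.single ⟨k, Γ⟩ 1

/-- Reverse the direction of the edge `e`. -/
def Multidigraph.flip {N k : ℕ} (Γ : Multidigraph N k) (e : Fin k) : Multidigraph N k :=
  Function.update Γ e (Γ e).swap

/-- Permuting the edges by `τ` costs `sgn(τ)^(d+1)` and reversing an edge costs `(-1)^d`. -/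
def graRel (d N : ℕ) : Submodule ℝ (FreeGra N) :=
  Submodule.span ℝ
    ({z | ∃ (k : ℕ) (Γ : Multidigraph N k) (τ : Equiv.Perm (Fin k)),
        z = FreeGra.of (Γ ∘ τ) - ((Equiv.Perm.sign τ : ℤ) ^ (d + 1)) • FreeGra.of Γ} ∪
     {z | ∃ (k : ℕ) (Γ : Multidigraph N k) (e : Fin k),
        z = FreeGra.of (Γ.flip e) - ((-1 : ℤ) ^ d) • FreeGra.of Γ})

/-- The space `Gra_d(N)`: coinvariants of the graphs on `N` labelled vertices under the permutations
and the reversals of their edges, with the signs given by `d`. -/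
def Gra (d N : ℕ) : Type := FreeGra N ⧸ graRel d N

instance (d N : ℕ) : AddCommGroup (Gra d N) := Submodule.Quotient.addCommGroup (graRel d N)

instance (d N : ℕ) : Module ℝ (Gra d N) := Submodule.Quotient.module (graRel d N)

/-- The quotient map. -/
def Gra.proj (d N : ℕ) : FreeGra N →ₗ[ℝ] Gra d N := (graRel d N).mkQ

theorem Gra.proj_eq_zero {d N : ℕ} {z : FreeGra N} (hz : z ∈ graRel d N) : Gra.proj d N z = 0 :=
  (Submodule.Quotient.mk_eq_zero (graRel d N)).mpr hz

/-- The class of a graph in `Gra_d(N)`. -/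
def Gra.mk (d : ℕ) {N k : ℕ} (Γ : Multidigraph N k) : Gra d N :=
  Gra.proj d N (FreeGra.of Γ)

/-- Every edge having degree `1 - d`, this is the part of `Gra_d(N)` spanned by the graphs with `k`
edges for those `k` such that `k (1 - d) = i`. -/
def Gra.deg (d N : ℕ) (i : ℤ) : Submodule ℝ (Gra d N) :=
  Submodule.span ℝ
    {z | ∃ (k : ℕ) (Γ : Multidigraph N k), (k : ℤ) * (1 - d) = i ∧ z = Gra.mk d Γ}

theorem Gra.mk_perm (d : ℕ) {N k : ℕ} (Γ : Multidigraph N k) (τ : Equiv.Perm (Fin k)) :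
    Gra.mk d (Γ ∘ τ) = ((Equiv.Perm.sign τ : ℤ) ^ (d + 1)) • Gra.mk d Γ := by
  rw [← sub_eq_zero]
  unfold Gra.mk
  rw [← map_zsmul, ← map_sub]
  refine Gra.proj_eq_zero ?_
  exact Submodule.subset_span (Or.inl ⟨k, Γ, τ, rfl⟩)

theorem Gra.mk_flip (d : ℕ) {N k : ℕ} (Γ : Multidigraph N k) (e : Fin k) :
    Gra.mk d (Γ.flip e) = ((-1 : ℤ) ^ d) • Gra.mk d Γ := by
  rw [← sub_eq_zero]
  unfold Gra.mk
  rw [← map_zsmul, ← map_sub]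
  refine Gra.proj_eq_zero ?_
  exact Submodule.subset_span (Or.inr ⟨k, Γ, e, rfl⟩)

/-- A linear map out of `Gra_d(N)` from a function on graphs with the right symmetries. -/
def Gra.lift {d N : ℕ} {M : Type} [AddCommGroup M] [Module ℝ M]
    (F : ∀ k, Multidigraph N k → M)
    (hperm : ∀ (k) (Γ : Multidigraph N k) (τ : Equiv.Perm (Fin k)),
      F k (Γ ∘ τ) = ((Equiv.Perm.sign τ : ℤ) ^ (d + 1)) • F k Γ)
    (hflip : ∀ (k) (Γ : Multidigraph N k) (e : Fin k),
      F k (Γ.flip e) = ((-1 : ℤ) ^ d) • F k Γ) : Gra d N →ₗ[ℝ] M :=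
  (graRel d N).liftQ (Finsupp.linearCombination ℝ fun Γ => F Γ.1 Γ.2) (by
    rw [graRel, Submodule.span_le]
    rintro z (⟨k, Γ, τ, rfl⟩ | ⟨k, Γ, e, rfl⟩)
    · refine LinearMap.mem_ker.mpr ?_
      rw [map_sub, map_zsmul, sub_eq_zero]
      simpa [FreeGra.of] using hperm k Γ τ
    · refine LinearMap.mem_ker.mpr ?_
      rw [map_sub, map_zsmul, sub_eq_zero]
      simpa [FreeGra.of] using hflip k Γ e)

theorem Gra.lift_mk {d N : ℕ} {M : Type} [AddCommGroup M] [Module ℝ M]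
    (F : ∀ k, Multidigraph N k → M) (hperm) (hflip) {k : ℕ} (Γ : Multidigraph N k) :
    Gra.lift (d := d) F hperm hflip (Gra.mk d Γ) = F k Γ := by
  refine ((graRel d N).liftQ_apply _ (FreeGra.of Γ)).trans ?_
  simp [FreeGra.of]

theorem Gra.hom_ext {d N : ℕ} {M : Type} [AddCommGroup M] [Module ℝ M] {f g : Gra d N →ₗ[ℝ] M}
    (h : ∀ (k) (Γ : Multidigraph N k), f (Gra.mk d Γ) = g (Gra.mk d Γ)) : f = g := by
  refine Submodule.linearMap_qext (graRel d N) (Finsupp.lhom_ext ?_)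
  rintro ⟨k, Γ⟩ c
  have := h k Γ
  rw [← Finsupp.smul_single_one, map_smul, map_smul]
  exact congrArg (fun z : M => c • z) this

/-- Change the labels of the vertices along `v`. -/
def Multidigraph.mapVertices {N M k : ℕ} (v : Fin N → Fin M) (Γ : Multidigraph N k) :
    Multidigraph M k := fun e => ((v (Γ e).1), (v (Γ e).2))

theorem Multidigraph.mapVertices_flip {N M k : ℕ} (v : Fin N → Fin M) (Γ : Multidigraph N k)
    (e : Fin k) : (Γ.flip e).mapVertices v = (Γ.mapVertices v).flip e := by
  funext e'
  by_cases h : e' = e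
  · subst h; simp [Multidigraph.flip, Multidigraph.mapVertices]
  · simp [Multidigraph.flip, Multidigraph.mapVertices, Function.update_of_ne h]

/-- The right action `Σ_N(· | σ)` of the symmetric group on `Gra_d(N)`: the label `i` of a vertex is
replaced by `σ⁻¹ i`. -/
def Gra.relabel (d : ℕ) {N : ℕ} (σ : Equiv.Perm (Fin N)) : Gra d N →ₗ[ℝ] Gra d N :=
  Gra.lift (fun _ Γ => Gra.mk d (Γ.mapVertices ⇑σ⁻¹))
    (fun _ Γ τ => Gra.mk_perm d (Γ.mapVertices ⇑σ⁻¹) τ)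
    (fun _ Γ e => by rw [Multidigraph.mapVertices_flip, Gra.mk_flip])

/-- Collapse the first `b + 1` of the `c + 1 = a + b + 1` vertices to the first vertex. -/
def collapse {a b c : ℕ} (h : a + b = c) (v : Fin (c + 1)) : Fin (a + 1) :=
  ⟨v.val - b, by omega⟩

/-- The vertices of the inserted graph are the first `b + 1` vertices. -/
def insertVertex {a b c : ℕ} (h : a + b = c) (v : Fin (b + 1)) : Fin (c + 1) :=
  ⟨v.val, by omega⟩

/-- The insertion `Γ ∘₁ Γ'` of `Γ'` at the first vertex of `Γ`. The ways of reconnecting the ends of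
the edges of `Γ` at its first vertex to vertices of `Γ'` correspond to the graphs `G` on the new
vertex set which become `Γ` after collapsing the vertices of `Γ'`. The edges of `Γ` precede the
edges of `Γ'`. -/
def graInsert (d : ℕ) {a b c : ℕ} (h : a + b = c) {j k : ℕ} (Γ : Multidigraph (a + 1) j)
    (Γ' : Multidigraph (b + 1) k) : Gra d (c + 1) :=
  ∑ G ∈ Finset.univ.filter (fun G : Multidigraph (c + 1) j => G.mapVertices (collapse h) = Γ),
    Gra.mk d (Fin.append G (Γ'.mapVertices (insertVertex h)))

theorem graInsert_perm_left (d : ℕ) {a b c : ℕ} (h : a + b = c) {j k : ℕ}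
    (Γ : Multidigraph (a + 1) j) (Γ' : Multidigraph (b + 1) k) (τ : Equiv.Perm (Fin j)) :
    graInsert d h (Γ ∘ τ) Γ' = ((Equiv.Perm.sign τ : ℤ) ^ (d + 1)) • graInsert d h Γ Γ' := by
  unfold graInsert
  rw [Finset.smul_sum]
  refine Finset.sum_bij' (fun G _ => G ∘ τ.symm) (fun G _ => G ∘ τ) ?_ ?_ ?_ ?_ ?_
  · intro G hG
    simp only [Finset.mem_filter, Finset.mem_univ, true_and] at hG ⊢
    funext e
    have := congrFun hG (τ.symm e)
    simpa [Multidigraph.mapVertices] using this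
  · intro G hG
    simp only [Finset.mem_filter, Finset.mem_univ, true_and] at hG ⊢
    subst hG
    rfl
  · intro G _; funext e; simp
  · intro G _; funext e; simp
  · intro G _
    set S := Γ'.mapVertices (insertVertex h)
    let T : Equiv.Perm (Fin (j + k)) :=
      finSumFinEquiv.permCongr (Equiv.Perm.sumCongr τ (Equiv.refl (Fin k)))
    have hT : Equiv.Perm.sign T = Equiv.Perm.sign τ := by
      simp only [T, Equiv.Perm.sign_permCongr, Equiv.Perm.sign_sumCongr]
      simp
    have : Fin.append G S = (Fin.append (G ∘ τ.symm) S : Multidigraph (c + 1) (j + k)) ∘ T := by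
      funext e
      refine Fin.addCases (fun i => ?_) (fun i => ?_) e
      · simp [T]
      · simp [T]
    rw [this, Gra.mk_perm, hT]

theorem graInsert_perm_right (d : ℕ) {a b c : ℕ} (h : a + b = c) {j k : ℕ}
    (Γ : Multidigraph (a + 1) j) (Γ' : Multidigraph (b + 1) k) (τ : Equiv.Perm (Fin k)) :
    graInsert d h Γ (Γ' ∘ τ) = ((Equiv.Perm.sign τ : ℤ) ^ (d + 1)) • graInsert d h Γ Γ' := by
  unfold graInsert
  rw [Finset.smul_sum]
  refine Finset.sum_congr rfl fun G _ => ?_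
  let T : Equiv.Perm (Fin (j + k)) :=
    finSumFinEquiv.permCongr (Equiv.Perm.sumCongr (Equiv.refl (Fin j)) τ)
  have hT : Equiv.Perm.sign T = Equiv.Perm.sign τ := by
    simp only [T, Equiv.Perm.sign_permCongr, Equiv.Perm.sign_sumCongr]
    simp
  have : (Fin.append G (Multidigraph.mapVertices (insertVertex h) (Γ' ∘ τ)) :
      Multidigraph (c + 1) (j + k)) = Fin.append G (Γ'.mapVertices (insertVertex h)) ∘ T := by
    funext e
    refine Fin.addCases (fun i => ?_) (fun i => ?_) e
    · simp [T]
    · simp [T, Multidigraph.mapVertices]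
  rw [this, Gra.mk_perm, hT]

theorem append_flip_left {N j k : ℕ} (G : Multidigraph N j) (S : Multidigraph N k) (e : Fin j) :
    (Fin.append (G.flip e) S : Multidigraph N (j + k)) =
      Multidigraph.flip (Fin.append G S) (Fin.castAdd k e) := by
  funext e'
  refine Fin.addCases (fun i => ?_) (fun i => ?_) e'
  · by_cases hi : i = e
    · subst hi; simp [Multidigraph.flip]
    · have : Fin.castAdd k i ≠ Fin.castAdd k e := by simpa using hi
      simp [Multidigraph.flip, Function.update_of_ne hi, Function.update_of_ne this]
  · have : Fin.natAdd j i ≠ Fin.castAdd k e := by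
      intro hc; have := congrArg Fin.val hc; simp at this; omega
    simp [Multidigraph.flip, Function.update_of_ne this]

theorem append_flip_right {N j k : ℕ} (G : Multidigraph N j) (S : Multidigraph N k) (e : Fin k) :
    (Fin.append G (S.flip e) : Multidigraph N (j + k)) =
      Multidigraph.flip (Fin.append G S) (Fin.natAdd j e) := by
  funext e'
  refine Fin.addCases (fun i => ?_) (fun i => ?_) e'
  · have : Fin.castAdd k i ≠ Fin.natAdd j e := by
      intro hc; have := congrArg Fin.val hc; simp at this; omega
    simp [Multidigraph.flip, Function.update_of_ne this]
  · by_cases hi : i = e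
    · subst hi; simp [Multidigraph.flip]
    · have : Fin.natAdd j i ≠ Fin.natAdd j e := by simpa using hi
      simp [Multidigraph.flip, Function.update_of_ne hi, Function.update_of_ne this]

theorem Multidigraph.flip_flip {N k : ℕ} (Γ : Multidigraph N k) (e : Fin k) :
    (Γ.flip e).flip e = Γ := by
  simp [Multidigraph.flip]

theorem graInsert_flip_left (d : ℕ) {a b c : ℕ} (h : a + b = c) {j k : ℕ}
    (Γ : Multidigraph (a + 1) j) (Γ' : Multidigraph (b + 1) k) (e : Fin j) :
    graInsert d h (Γ.flip e) Γ' = ((-1 : ℤ) ^ d) • graInsert d h Γ Γ' := by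
  unfold graInsert
  rw [Finset.smul_sum]
  refine Finset.sum_bij' (fun G _ => G.flip e) (fun G _ => G.flip e) ?_ ?_ ?_ ?_ ?_
  · intro G hG
    simp only [Finset.mem_filter, Finset.mem_univ, true_and] at hG ⊢
    rw [Multidigraph.mapVertices_flip, hG, Multidigraph.flip_flip]
  · intro G hG
    simp only [Finset.mem_filter, Finset.mem_univ, true_and] at hG ⊢
    rw [Multidigraph.mapVertices_flip, hG]
  · intro G _; exact G.flip_flip e
  · intro G _; exact G.flip_flip e
  · intro G _
    rw [append_flip_left, Gra.mk_flip, smul_smul, ← mul_pow]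
    simp

theorem graInsert_flip_right (d : ℕ) {a b c : ℕ} (h : a + b = c) {j k : ℕ}
    (Γ : Multidigraph (a + 1) j) (Γ' : Multidigraph (b + 1) k) (e : Fin k) :
    graInsert d h Γ (Γ'.flip e) = ((-1 : ℤ) ^ d) • graInsert d h Γ Γ' := by
  unfold graInsert
  rw [Finset.smul_sum]
  refine Finset.sum_congr rfl fun G _ => ?_
  rw [Multidigraph.mapVertices_flip, append_flip_right, Gra.mk_flip]

/-- The partial composition `∘₁ : Gra_d(a + 1) ⊗ Gra_d(b + 1) → Gra_d(a + b + 1)`. -/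
def Gra.compFirst (d : ℕ) {a b c : ℕ} (h : a + b = c) :
    Gra d (a + 1) →ₗ[ℝ] Gra d (b + 1) →ₗ[ℝ] Gra d (c + 1) :=
  Gra.lift
    (fun _ Γ => Gra.lift (fun _ Γ' => graInsert d h Γ Γ')
      (fun _ Γ' τ => graInsert_perm_right d h Γ Γ' τ)
      (fun _ Γ' e => graInsert_flip_right d h Γ Γ' e))
    (fun _ Γ τ => Gra.hom_ext fun _ Γ' => by
      simp only [LinearMap.smul_apply, Gra.lift_mk, graInsert_perm_left])
    (fun _ Γ e => Gra.hom_ext fun _ Γ' => by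
      simp only [LinearMap.smul_apply, Gra.lift_mk, graInsert_flip_left])

/-- Ambient space of the full graph complex; the component `a` has `a + 1` vertices. -/
abbrev GraSeq (d : ℕ) : Type := ∀ a : ℕ, Gra d (a + 1)

/-- The piece of degree `i` of the full graph complex `fGC_d`: sequences of elements of `Gra_d(N)`,
`N ≥ 1`, which the symmetric group of the vertices fixes up to the sign `sgn(σ)^d`, a graph with `N`
vertices and `k` edges having degree `d (N - 1) + k (1 - d)`. -/
def fGC (d : ℕ) (i : ℤ) : Submodule ℝ (GraSeq d) where
  carrier := {γ | ∀ a, γ a ∈ Gra.deg d (a + 1) (i - d * a) ∧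
    ∀ σ : Equiv.Perm (Fin (a + 1)),
      Gra.relabel d σ (γ a) = ((Equiv.Perm.sign σ : ℤ) ^ d) • γ a}
  zero_mem' := fun a => ⟨Submodule.zero_mem _, fun σ => by simp⟩
  add_mem' := fun hx hy a => ⟨Submodule.add_mem _ (hx a).1 (hy a).1, fun σ => by
    rw [Pi.add_apply, map_add, (hx a).2, (hy a).2, smul_add]⟩
  smul_mem' := fun r x hx a => ⟨Submodule.smul_mem _ _ (hx a).1, fun σ => by
    rw [Pi.smul_apply, map_smul, (hx a).2, smul_comm]⟩

/-- The pre-Lie product of the full graph complex. -/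
def fGCcomp (d : ℕ) (γ γ' : GraSeq d) : GraSeq d := fun c =>
  ∑ ab ∈ (Finset.HasAntidiagonal.antidiagonal c).attach, ∑ σ ∈ unshuffles (ab.1.2 + 1) (c + 1),
    ((Equiv.Perm.sign σ : ℤ) ^ d) •
      Gra.relabel d σ
        (Gra.compFirst d (Finset.HasAntidiagonal.mem_antidiagonal.mp ab.2) (γ ab.1.1) (γ' ab.1.2))

/-- The Lie bracket of `γ` of degree `i` and `γ'` of degree `j`. -/
def fGCbracket (d : ℕ) (i j : ℤ) (γ γ' : GraSeq d) : GraSeq d :=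
  fGCcomp d γ γ' - ((i * j).negOnePow : ℤ) • fGCcomp d γ' γ

/-- The graph with two vertices and one edge `1 → 2`; it has degree `1`. -/
def edgeGraph (d : ℕ) : GraSeq d :=
  Pi.single 1 (Gra.mk d (fun _ => (0, 1) : Multidigraph 2 1))

/-- The differential of the full graph complex on degree `i`. -/
def fGCdelta (d : ℕ) (i : ℤ) (γ : GraSeq d) : GraSeq d :=
  fGCbracket d 1 i (edgeGraph d) γ

/-! ## The Chevalley–Eilenberg complex with the Nijenhuis–Richardson bracket

Here `W` carries a graded vector space with pieces `A k`, and `P` is its parity operator: it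
multiplies `A k` by `(-1)^k`. -/

section ChevalleyEilenberg

variable {W : Type} [AddCommGroup W] [Module ℝ W]

/-- Projection to the even (`ε = 0`) or odd (`ε = 1`) part. -/
def parityProj (P : W →ₗ[ℝ] W) (ε : Fin 2) : W →ₗ[ℝ] W :=
  (1 / 2 : ℝ) • (LinearMap.id + ((-1 : ℝ) ^ ε.val) • P)

/-- The Koszul sign of moving the `i`-th factor to position `σ i`, for factors of parities `ε`. -/
def koszulSign {N : ℕ} (σ : Equiv.Perm (Fin N)) (ε : Fin N → Fin 2) : ℤ :=
  ∏ i : Fin N, ∏ j : Fin N,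
    if i < j ∧ σ j < σ i then (-1) ^ ((ε i).val * (ε j).val) else 1

/-- The right action of permutations on multilinear maps,
`(θ | σ)(w₁, …, w_N) = ± θ(w_{σ⁻¹(1)}, …, w_{σ⁻¹(N)})` with the Koszul sign. -/
def permAct (P : W →ₗ[ℝ] W) {N : ℕ} (θ : MultilinearMap ℝ (fun _ : Fin N => W) W)
    (σ : Equiv.Perm (Fin N)) : MultilinearMap ℝ (fun _ : Fin N => W) W :=
  ∑ ε : Fin N → Fin 2, koszulSign σ ε •
    (θ.compLinearMap (fun l => parityProj P (ε (σ⁻¹ l)))).domDomCongr σ⁻¹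

/-- `(f ∘₁ g)(w₁, …, w_{a+b+1}) = f(g(w₁, …, w_{b+1}), w_{b+2}, …, w_{a+b+1})`. -/
def mlCompFirst {a b c : ℕ} (h : a + b = c)
    (f : MultilinearMap ℝ (fun _ : Fin (a + 1) => W) W)
    (g : MultilinearMap ℝ (fun _ : Fin (b + 1) => W) W) :
    MultilinearMap ℝ (fun _ : Fin (c + 1) => W) W :=
  (MultilinearMap.uncurrySum (f.curryLeft.compMultilinearMap g)).domDomCongr
    (finSumFinEquiv.trans (finCongr (by omega : b + 1 + a = c + 1)))

/-- Ambient space of Chevalley–Eilenberg cochains; the component `a` has `a + 1` arguments. -/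
abbrev MLSeq (W : Type) [AddCommGroup W] [Module ℝ W] : Type :=
  ∀ a : ℕ, MultilinearMap ℝ (fun _ : Fin (a + 1) => W) W

/-- The cochains of degree `k`: the sequences whose component with `a + 1` arguments is a graded
skewsymmetric multilinear map of degree `k - a`. -/
def CE (A : ℤ → Submodule ℝ W) (P : W →ₗ[ℝ] W) (k : ℤ) : Submodule ℝ (MLSeq W) where
  carrier := {f | ∀ a,
    (∀ (l : Fin (a + 1) → ℤ) (w : Fin (a + 1) → W), (∀ t, w t ∈ A (l t)) →
      f a w ∈ A (∑ t, l t + (k - a))) ∧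
    ∀ σ : Equiv.Perm (Fin (a + 1)), permAct P (f a) σ = (Equiv.Perm.sign σ : ℤ) • f a}
  zero_mem' := fun a => ⟨fun _ _ _ => Submodule.zero_mem _, fun σ => by
    ext w; simp [permAct]⟩
  add_mem' := fun {x y} hx hy a =>
    ⟨fun l w hw => Submodule.add_mem _ ((hx a).1 l w hw) ((hy a).1 l w hw), fun σ => by
      rw [Pi.add_apply, smul_add, ← (hx a).2, ← (hy a).2]
      ext w
      simp [permAct, Finset.sum_add_distrib]⟩
  smul_mem' := fun r x hx a =>
    ⟨fun l w hw => Submodule.smul_mem _ _ ((hx a).1 l w hw), fun σ => by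
      rw [Pi.smul_apply, smul_comm, ← (hx a).2]
      ext w
      simp only [permAct, sum_apply, smul_apply, Finset.smul_sum,
        MultilinearMap.domDomCongr_apply, MultilinearMap.compLinearMap_apply]
      exact Finset.sum_congr rfl fun _ _ => smul_comm _ _ _⟩

/-- The Nijenhuis–Richardson product of `f` with `g` of degree `j`: the sum over the unshuffles of
type `(q, p - 1)` of `sgn(σ) (-1)^((p - 1) |g|) (f ∘₁ g | σ)`, where `f` has `p = a + 1` arguments
and `g` has `q = b + 1` arguments and degree `|g| = j - b` as a multilinear map. -/
def nrComp (P : W →ₗ[ℝ] W) (j : ℤ) (f g : MLSeq W) : MLSeq W := fun c =>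
  ∑ ab ∈ (Finset.HasAntidiagonal.antidiagonal c).attach, ∑ σ ∈ unshuffles (ab.1.2 + 1) (c + 1),
    ((Equiv.Perm.sign σ : ℤ) * (((ab.1.1 : ℤ) * (j - ab.1.2)).negOnePow : ℤ)) •
      permAct P
        (mlCompFirst (Finset.HasAntidiagonal.mem_antidiagonal.mp ab.2) (f ab.1.1) (g ab.1.2)) σ

/-- The Nijenhuis–Richardson bracket of `f` of degree `i` and `g` of degree `j`. -/
def nrBracket (P : W →ₗ[ℝ] W) (i j : ℤ) (f g : MLSeq W) : MLSeq W :=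
  nrComp P j f g - ((i * j).negOnePow : ℤ) • nrComp P i g f

end ChevalleyEilenberg

/-! ## Smooth functions on an open set -/

section Smooth

open Classical

/-- Extension by zero of a function on `U`. -/
def extendZero {ι : Type} (U : Set (ι → ℝ)) (f : U → ℝ) (x : ι → ℝ) : ℝ :=
  if h : x ∈ U then f ⟨x, h⟩ else 0

theorem extendZero_coe {ι : Type} (U : Set (ι → ℝ)) (f : U → ℝ) (u : U) :
    extendZero U f u = f u := by
  simp [extendZero]

/-- The algebra of smooth functions on `U ⊆ ℝ^ι`. -/
def smoothSubalgebra {ι : Type} [Fintype ι] (U : Set (ι → ℝ)) : Subalgebra ℝ (U → ℝ) where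
  carrier := {f | ContDiffOn ℝ ∞ (extendZero U f) U}
  mul_mem' := fun {f g} hf hg => by
    refine (ContDiffOn.mul hf hg).congr fun x hx => ?_
    simp [extendZero, hx]
  add_mem' := fun {f g} hf hg => by
    refine (ContDiffOn.add hf hg).congr fun x hx => ?_
    simp [extendZero, hx]
  algebraMap_mem' := fun r => by
    refine (contDiffOn_const (c := r)).congr fun x hx => ?_
    simp [extendZero, hx]

/-- The type of smooth functions on `U ⊆ ℝ^ι`. -/
def SmoothFun {ι : Type} [Fintype ι] (U : Set (ι → ℝ)) : Type := smoothSubalgebra U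

instance {ι : Type} [Fintype ι] (U : Set (ι → ℝ)) : CommRing (SmoothFun U) :=
  inferInstanceAs (CommRing (smoothSubalgebra U))

instance {ι : Type} [Fintype ι] (U : Set (ι → ℝ)) : Algebra ℝ (SmoothFun U) :=
  inferInstanceAs (Algebra ℝ (smoothSubalgebra U))

/-- The partial derivative along the coordinate `t` on smooth functions on the open set `U`. -/
def partialDeriv {ι : Type} [Fintype ι] {U : Set (ι → ℝ)} (hU : IsOpen U) (t : ι) :
    SmoothFun U →ₗ[ℝ] SmoothFun U where
  toFun f := ⟨fun u => fderiv ℝ (extendZero U f.1) u (Pi.single t 1), by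
    have h1 : ContDiffOn ℝ ∞ (fderiv ℝ (extendZero U f.1)) U :=
      ContDiffOn.fderiv_of_isOpen f.2 hU (by simp)
    refine (h1.clm_apply (contDiffOn_const (c := (Pi.single t 1 : ι → ℝ)))).congr fun x hx => ?_
    · exact extendZero_coe U _ ⟨x, hx⟩⟩
  map_add' f g := by
    apply Subtype.ext
    funext u
    have hd : ∀ f : SmoothFun U, DifferentiableAt ℝ (extendZero U f.1) u := fun f =>
      ((f.2 : ContDiffOn ℝ ∞ _ U).contDiffAt (hU.mem_nhds u.2)).differentiableAt (by simp)
    have he : extendZero U (f + g).1 = extendZero U f.1 + extendZero U g.1 := by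
      funext x; by_cases hx : x ∈ U <;> simp [extendZero, hx] <;> rfl
    change fderiv ℝ (extendZero U (f + g).1) u _ = fderiv ℝ (extendZero U f.1) u _ +
      fderiv ℝ (extendZero U g.1) u _
    rw [he, fderiv_add (hd f) (hd g)]
    rfl
  map_smul' r f := by
    apply Subtype.ext
    funext u
    have hd : DifferentiableAt ℝ (extendZero U f.1) u :=
      ((f.2 : ContDiffOn ℝ ∞ _ U).contDiffAt (hU.mem_nhds u.2)).differentiableAt (by simp)
    have he : extendZero U (r • f).1 = r • extendZero U f.1 := by
      funext x; by_cases hx : x ∈ U <;> simp [extendZero, hx] <;> rfl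
    change fderiv ℝ (extendZero U (r • f).1) u _ = r • fderiv ℝ (extendZero U f.1) u _
    rw [he, fderiv_const_smul hd]
    rfl

end Smooth

/-! ## Graded symplectic manifolds in Darboux coordinates -/

/-- The homogeneous coordinates on a graded symplectic manifold of degree `n`: `x μ` of degree `0`
and `p μ` of degree `n`, for `m` values of `μ`; `ψ i α` of degree `i + 1` and `χ i α` of degree
`n - (i + 1)`, for `r i` values of `α` (so `i + 1` runs from `1` to the largest integer `< n / 2`);
`ξ a` of degree `n / 2`, for `q` values of `a`. -/
inductive Coord (n m : ℕ) (r : Fin ((n - 1) / 2) → ℕ) (q : ℕ) : Type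
  | x (μ : Fin m)
  | p (μ : Fin m)
  | ψ (i : Fin ((n - 1) / 2)) (α : Fin (r i))
  | χ (i : Fin ((n - 1) / 2)) (α : Fin (r i))
  | ξ (a : Fin q)

/-- The five families of coordinates. -/
def Coord.equivSum (n m : ℕ) (r : Fin ((n - 1) / 2) → ℕ) (q : ℕ) :
    Coord n m r q ≃
      (Fin m ⊕ Fin m) ⊕ ((Σ i, Fin (r i)) ⊕ (Σ i, Fin (r i))) ⊕ Fin q where
  toFun
    | .x μ => .inl (.inl μ)
    | .p μ => .inl (.inr μ)
    | .ψ i α => .inr (.inl (.inl ⟨i, α⟩))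
    | .χ i α => .inr (.inl (.inr ⟨i, α⟩))
    | .ξ a => .inr (.inr a)
  invFun
    | .inl (.inl μ) => .x μ
    | .inl (.inr μ) => .p μ
    | .inr (.inl (.inl ⟨i, α⟩)) => .ψ i α
    | .inr (.inl (.inr ⟨i, α⟩)) => .χ i α
    | .inr (.inr a) => .ξ a
  left_inv A := by cases A <;> rfl
  right_inv A := by rcases A with (_ | _) | (⟨_, _⟩ | ⟨_, _⟩) | _ <;> rfl

instance {n m : ℕ} {r : Fin ((n - 1) / 2) → ℕ} {q : ℕ} : Fintype (Coord n m r q) :=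
  Fintype.ofEquiv _ (Coord.equivSum n m r q).symm

instance {n m : ℕ} {r : Fin ((n - 1) / 2) → ℕ} {q : ℕ} : DecidableEq (Coord n m r q) :=
  (Coord.equivSum n m r q).decidableEq

/-- The degree of a coordinate. -/
def Coord.deg {n m : ℕ} {r : Fin ((n - 1) / 2) → ℕ} {q : ℕ} : Coord n m r q → ℕ
  | .x _ => 0
  | .p _ => n
  | .ψ i _ => i.val + 1
  | .χ i _ => n - (i.val + 1)
  | .ξ _ => n / 2

/-- A graded symplectic manifold of degree `n` (NP-manifold) presented in Darboux coordinates, with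
symplectic form `dx^μ ∧ dp_μ + ∑ dψ^α ∧ dχ_α + ½ κ_ab dξ^a ∧ dξ^b`; coordinates `ξ` occur only
for even `n`. The coordinates of degree `0` take their values in the open set `U`. -/
structure DarbouxChart (n : ℕ) where
  m : ℕ
  r : Fin ((n - 1) / 2) → ℕ
  q : ℕ
  q_odd : Odd n → q = 0
  κ : Matrix (Fin q) (Fin q) ℝ
  κ_symm : ∀ a b, κ a b = -(-1) ^ (n / 2) * κ b a
  κ_nondeg : IsUnit κ.det
  U : Set ({A : Coord n m r q // A.deg = 0} → ℝ)
  isOpen_U : IsOpen U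

namespace DarbouxChart

variable {n : ℕ} (V : DarbouxChart n)

abbrev Coords : Type := Coord n V.m V.r V.q
abbrev BaseCoord : Type := {A : V.Coords // A.deg = 0}
abbrev EvenCoord : Type := {A : V.Coords // A.deg ≠ 0 ∧ ¬ Odd A.deg}
abbrev OddCoord : Type := {A : V.Coords // Odd A.deg}

/-- The graded algebra of functions: polynomials in the graded commuting coordinates of positive
degree (ordinary polynomials in those of even degree, exterior in those of odd degree) whose
coefficients are smooth functions of the coordinates of degree `0`. -/
def Fun : Type :=
  (SmoothFun V.U ⊗[ℝ] MvPolynomial V.EvenCoord ℝ) ⊗[ℝ] ExteriorAlgebra ℝ (V.OddCoord → ℝ)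

instance : Ring V.Fun :=
  inferInstanceAs (Ring ((SmoothFun V.U ⊗[ℝ] MvPolynomial V.EvenCoord ℝ) ⊗[ℝ]
    ExteriorAlgebra ℝ (V.OddCoord → ℝ)))

instance : Algebra ℝ V.Fun :=
  inferInstanceAs (Algebra ℝ ((SmoothFun V.U ⊗[ℝ] MvPolynomial V.EvenCoord ℝ) ⊗[ℝ]
    ExteriorAlgebra ℝ (V.OddCoord → ℝ)))

/-- The functions that are homogeneous of degree `k`, spanned by smooth functions times monomials of
weight `k`. -/
def funDeg (k : ℤ) : Submodule ℝ V.Fun :=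
  Submodule.span ℝ {z | ∃ (f : SmoothFun V.U) (s : V.EvenCoord →₀ ℕ) (l : List V.OddCoord),
    (((s.sum fun A e => e * A.1.deg) + (l.map fun A => A.1.deg).sum : ℕ) : ℤ) = k ∧
    z = (f ⊗ₜ[ℝ] MvPolynomial.monomial s (1 : ℝ)) ⊗ₜ[ℝ]
      (l.map fun A => ExteriorAlgebra.ι ℝ (Pi.single A (1 : ℝ) : V.OddCoord → ℝ)).prod}

/-- The parity operator `f ↦ (-1)^|f| f`. -/
def parity : V.Fun →ₗ[ℝ] V.Fun :=
  TensorProduct.map LinearMap.id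
    (CliffordAlgebra.involute (Q := (0 : QuadraticForm ℝ (V.OddCoord → ℝ)))).toLinearMap

/-- The left partial derivative along the coordinate `A`. -/
def deriv (A : V.Coords) : V.Fun →ₗ[ℝ] V.Fun :=
  if h0 : A.deg = 0 then
    TensorProduct.map (TensorProduct.map (partialDeriv V.isOpen_U ⟨A, h0⟩) LinearMap.id)
      LinearMap.id
  else if h1 : Odd A.deg then
    TensorProduct.map LinearMap.id
      (CliffordAlgebra.contractLeft (Q := (0 : QuadraticForm ℝ (V.OddCoord → ℝ)))
        (LinearMap.proj (⟨A, h1⟩ : V.OddCoord)))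
  else
    TensorProduct.map (TensorProduct.map LinearMap.id
      (MvPolynomial.pderiv (⟨A, h0, h1⟩ : V.EvenCoord)).toLinearMap) LinearMap.id

/-- The coefficient of `∂/∂A ⊗ ∂/∂B` in the Poisson bivector inverse to the symplectic form. -/
def coeff : V.Coords → V.Coords → ℝ
  | .x μ, .p ν => if μ = ν then 1 else 0
  | .p μ, .x ν => if μ = ν then (if Even n then -1 else 1) else 0
  | .ψ i α, .χ j β => if (⟨i, α⟩ : Σ i, Fin (V.r i)) = ⟨j, β⟩ then 1 else 0
  | .χ i α, .ψ j β =>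
      if (⟨i, α⟩ : Σ i, Fin (V.r i)) = ⟨j, β⟩ then
        (if Even n then -(-1) ^ (i.val + 1) else 1) else 0
  | .ξ a, .ξ b => V.κ⁻¹ a b
  | _, _ => 0

/-- The Poisson bracket
`{f, g} = ∑ coeff(A, B) (-1)^(|f| |B|) (∂f/∂A) (∂g/∂B)`, of degree `-n`. -/
def poisson : MultilinearMap ℝ (fun _ : Fin 2 => V.Fun) V.Fun :=
  ∑ A : V.Coords, ∑ B : V.Coords, V.coeff A B •
    (MultilinearMap.mkPiAlgebraFin ℝ 2 V.Fun).compLinearMap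
      ![V.deriv A ∘ₗ V.parity ^ B.deg, V.deriv B]

/-- The derivative `∂/∂A` acting on the `i`-th factor of a tensor product; moving it there past the
preceding factors produces Koszul signs. -/
def derivAt {N : ℕ} (i : Fin N) (A : V.Coords) : Module.End ℝ (⨂[ℝ] _ : Fin N, V.Fun) :=
  PiTensorProduct.map fun j =>
    if j < i then V.parity ^ A.deg else if j = i then V.deriv A else LinearMap.id

/-- The operator `Δ_ij` attached to an edge from `i` to `j`. -/
def edgeOp {N : ℕ} (i j : Fin N) : Module.End ℝ (⨂[ℝ] _ : Fin N, V.Fun) :=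
  ∑ A : V.Coords, ∑ B : V.Coords, V.coeff A B • (V.derivAt i A * V.derivAt j B)

/-- The multilinear operation
`Rep(Γ)(f₁, …, f_N) = μ_N (∏_{edges (i, j)} Δ_ij (f₁ ⊗ ⋯ ⊗ f_N))` attached to a graph. -/
def rep {N k : ℕ} (Γ : Multidigraph N k) : MultilinearMap ℝ (fun _ : Fin N => V.Fun) V.Fun :=
  (PiTensorProduct.lift (MultilinearMap.mkPiAlgebraFin ℝ N V.Fun) ∘ₗ
    (List.ofFn fun e => V.edgeOp (Γ e).1 (Γ e).2).prod).compMultilinearMap (PiTensorProduct.tprod ℝ)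

/-- The pieces of the `n`-Schouten algebra: functions with the degree lowered by `n`. The
suspension `s` from the Schouten algebra to functions, of degree `n`, is the identity map of the
underlying spaces. -/
def schoutenDeg (k : ℤ) : Submodule ℝ V.Fun := V.funDeg (k + n)

/-- The parity operator of the `n`-Schouten algebra. -/
def schoutenParity : V.Fun →ₗ[ℝ] V.Fun := ((-1 : ℝ) ^ n) • V.parity

/-- The pullback `s⁻¹ ∘ θ ∘ (s ⊗ ⋯ ⊗ s)`. As `s` has degree `n`, the Koszul rule gives
`(s ⊗ ⋯ ⊗ s)(w₀ ⊗ ⋯ ⊗ w_a) = ± s w₀ ⊗ ⋯ ⊗ s w_a` with sign `(-1)^(n ∑ (a - t) |w_t|)`. -/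
def suspPull {a : ℕ} (θ : MultilinearMap ℝ (fun _ : Fin (a + 1) => V.Fun) V.Fun) :
    MultilinearMap ℝ (fun _ : Fin (a + 1) => V.Fun) V.Fun :=
  θ.compLinearMap fun t => V.schoutenParity ^ (n * (a - t.val))

/-- The Schouten bracket `s⁻¹ ∘ {·, ·} ∘ (s ⊗ s)` as a cochain of degree `1`. -/
def schoutenBracket : MLSeq V.Fun := Pi.single 1 (V.suspPull (a := 1) V.poisson)

/-- The Chevalley–Eilenberg differential of the `n`-Schouten algebra on cochains of degree `i`. -/
def deltaS (i : ℤ) (f : MLSeq V.Fun) : MLSeq V.Fun :=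
  nrBracket V.schoutenParity 1 i V.schoutenBracket f

/-- The map on sequences of graphs induced, through the suspension, by linear maps
`R a : Gra_d(a + 1) → Hom(Fun^⊗(a + 1), Fun)`. -/
def inducedMap {d : ℕ}
    (R : ∀ a : ℕ, Gra d (a + 1) →ₗ[ℝ] MultilinearMap ℝ (fun _ : Fin (a + 1) => V.Fun) V.Fun)
    (γ : GraSeq d) : MLSeq V.Fun := fun a => V.suspPull (R a (γ a))

end DarbouxChart

end

noncomputable section

/-! ### Koszul signs -/

/-! The cochain side. A graded skewsymmetric map becomes graded symmetric after one suspension, and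
under this décalage the signs of the Nijenhuis–Richardson product are exactly absorbed
(`permAct_susp`, `mlCompFirst_susp`, `nrComp_eq_suspSeq`): what remains is the sign-free product
`symComp`, the sum over unshuffles of `f ∘₁ g` with Koszul signs only. Unshuffles represent the
cosets of the block permutations, so each such sum is a normalised symmetrization over the full
symmetric group (`sum_unshuffles`). In `(F ∘ G) ∘ H` the map `H` enters either `G` or another
argument of `F`. The first kind of term makes up `F ∘ (G ∘ H)`; the second is graded symmetric in
`G` and `H`. Hence the product is graded pre-Lie (`symComp_preLie`), and its commutator satisfies
the Jacobi identity.

The representation. The partial derivatives of functions commute up to Koszul sign, and the bivector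
has degree `-n` and graded symmetry `(-1)^(n+1)`. Therefore reversing an edge changes `Δ_ij` by
`(-1)^d` (`edgeOp_swap`) and two edge operators commute up to `(-1)^n = (-1)^(d+1)` (`edgeOp_comm`):
these are the relations of `Gra_d`. The resulting maps `graRep` are equivariant (`graRep_relabel`).
They respect `∘₁` (`graRep_compFirst`), because the Leibniz rule for a derivative of a product is
the sum over all ways to reconnect a half-edge. After the `n`-fold suspension the signs of the two
brackets agree, so the induced map preserves brackets. It sends the one-edge graph to the Schouten
bracket. Since the one-edge graph squares to zero (`fGCcomp_edgeGraph`), so does the Schouten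
bracket, and both differentials are inner derivations by such elements.

Joint injectivity. On `T^*[n] ℝ^K`, with one conjugate pair of coordinates for each of `K` edges, a
graph `L` with `K` edges defines a test tensor: for the edge labelled `e` the coordinate `x^e` is
put at its source and `p_e` at its target. Applying the edge operators of `Γ` to it and evaluating
at the origin is a Wick contraction. It vanishes unless `Γ` also has `K` edges, and otherwise counts
with signs the ways to match the edges of `L` and `Γ`. Summing these numbers times the classes of
all `L` returns a nonzero multiple of the class of `Γ` (`sum_graPairing`), so an element of
`Gra_d(N)` is recovered from its representations (`eq_zero_of_graRep`).

The graph side. The graph complex needs no combinatorial proof of the Jacobi identity: by joint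
injectivity (`fGC_ext`) the invariance of a bracket and the Jacobi identity can be checked on the
images in the cochain algebras, where they are already known. -/

theorem koszulSign_eq_prod_pairs {N : ℕ} (σ : Equiv.Perm (Fin N)) (ε : Fin N → Fin 2) :
    koszulSign σ ε = ∏ a ∈ Equiv.Perm.finPairsLT N,
      if σ a.1 < σ a.2 then (-1 : ℤ) ^ ((ε a.2).val * (ε a.1).val) else 1 := by
  have hp : Equiv.Perm.finPairsLT N =
      (Finset.univ : Finset (Fin N)).sigma fun a => Finset.univ.filter fun b => b < a := by
    ext ⟨a, b⟩
    simp [Equiv.Perm.mem_finPairsLT]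
  rw [hp, Finset.prod_sigma, koszulSign, Finset.prod_comm]
  refine Finset.prod_congr rfl fun j _ => ?_
  rw [Finset.prod_filter]
  refine Finset.prod_congr rfl fun i _ => ?_
  by_cases h : i < j <;> simp [h]

/-- The argument is that for multiplicativity of `Equiv.Perm.sign`: `signBijAux τ` re-indexes the
pairs in the factor of `σ`, after which the identity holds pair by pair. A pair inverted by `τ` and
then inverted back by `σ` contributes the square of a sign on the right and nothing on the left. -/
theorem koszulSign_mul {N : ℕ} (σ τ : Equiv.Perm (Fin N)) (ε : Fin N → Fin 2) :
    koszulSign (σ * τ) ε = koszulSign τ ε * koszulSign σ (fun l => ε (τ⁻¹ l)) := by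
  rw [koszulSign_eq_prod_pairs, koszulSign_eq_prod_pairs, koszulSign_eq_prod_pairs]
  rw [← Finset.prod_nbij (s := Equiv.Perm.finPairsLT N) (t := Equiv.Perm.finPairsLT N)
    (f := fun a => if σ (τ.signBijAux a).1 < σ (τ.signBijAux a).2 then
        (-1 : ℤ) ^ ((ε (τ⁻¹ (τ.signBijAux a).2)).val * (ε (τ⁻¹ (τ.signBijAux a).1)).val) else 1)
    (g := fun a => if σ a.1 < σ a.2 then
        (-1 : ℤ) ^ ((ε (τ⁻¹ a.2)).val * (ε (τ⁻¹ a.1)).val) else 1)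
    (Equiv.Perm.signBijAux τ) Equiv.Perm.signBijAux_mem Equiv.Perm.signBijAux_injOn
    Equiv.Perm.signBijAux_surj (fun _ _ => rfl), ← Finset.prod_mul_distrib]
  refine Finset.prod_congr rfl ?_
  rintro ⟨a, b⟩ hab
  rw [Equiv.Perm.mem_finPairsLT] at hab
  dsimp only at hab ⊢
  rw [Equiv.Perm.mul_apply, Equiv.Perm.mul_apply]
  have hσ : σ (τ a) ≠ σ (τ b) := fun h => hab.ne' (τ.injective (σ.injective h))
  have hτ : τ a ≠ τ b := fun h => hab.ne' (τ.injective h)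
  have hsq : ∀ m : ℕ, (-1 : ℤ) ^ m * (-1) ^ m = 1 := fun m => by rw [← mul_pow]; simp
  by_cases h1 : τ b < τ a
  · simp [Equiv.Perm.signBijAux, h1, h1.le.not_gt]
  · have h2 : τ a < τ b := lt_of_le_of_ne (not_lt.mp h1) hτ
    by_cases h3 : σ (τ a) < σ (τ b)
    · simp [Equiv.Perm.signBijAux, h1, h2, h3, h3.le.not_gt]
    · have h4 : σ (τ b) < σ (τ a) := lt_of_le_of_ne (not_lt.mp h3) hσ.symm
      simp only [Equiv.Perm.signBijAux, h1, h2, h3, h4, dite_false, if_true, if_false]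
      simp [mul_comm (ε a).val, hsq]

theorem koszulSign_one {N : ℕ} (ε : Fin N → Fin 2) : koszulSign 1 ε = 1 := by
  unfold koszulSign
  refine Finset.prod_eq_one fun i _ => Finset.prod_eq_one fun j _ => ?_
  rw [if_neg]
  rintro ⟨h1, h2⟩
  exact absurd h1 (by simpa using h2.le)

/-- If the inversions of `σ` are the pairs in a rectangle `I × J`, the Koszul sign is the
product of the parities of `I` and of `J`. -/
theorem koszulSign_of_inversions {N : ℕ} (σ : Equiv.Perm (Fin N)) (ε : Fin N → Fin 2)
    (I J : Finset (Fin N)) (h : ∀ i j, (i < j ∧ σ j < σ i) ↔ (i ∈ I ∧ j ∈ J)) :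
    koszulSign σ ε = (-1) ^ ((∑ i ∈ I, (ε i).val) * ∑ j ∈ J, (ε j).val) := by
  unfold koszulSign
  simp_rw [h]
  rw [Finset.sum_mul_sum, ← Finset.prod_pow_eq_pow_sum]
  simp_rw [← Finset.prod_pow_eq_pow_sum]
  rw [← Finset.prod_subset (Finset.subset_univ I)]
  · refine Finset.prod_congr rfl fun i hi => ?_
    rw [← Finset.prod_subset (Finset.subset_univ J)]
    · exact Finset.prod_congr rfl fun j hj => by simp [hi, hj]
    · intro j _ hj; simp [hj]
  · intro i _ hi; simp [hi]

theorem koszulSign_swap_succ {n : ℕ} (i : Fin n) (ε : Fin (n + 1) → Fin 2) :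
    koszulSign (Equiv.swap i.castSucc i.succ) ε =
      (-1) ^ ((ε i.castSucc).val * (ε i.succ).val) := by
  rw [koszulSign_of_inversions _ ε {i.castSucc} {i.succ}]
  · simp
  · intro a b
    simp only [Finset.mem_singleton, Equiv.swap_apply_def]
    constructor
    · rintro ⟨h1, h2⟩
      split_ifs at h2 <;> simp only [Fin.ext_iff, Fin.lt_def, Fin.val_castSucc, Fin.val_succ] at * <;>
        omega
    · rintro ⟨rfl, rfl⟩
      have : i.succ ≠ i.castSucc := by simp [Fin.ext_iff]
      simp [this]

/-! ### The action of permutations on multilinear maps -/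

section PermAct

variable {W : Type} [AddCommGroup W] [Module ℝ W]

/-- The `w t` are homogeneous of parities `e t`. -/
def HasParity (P : W →ₗ[ℝ] W) {N : ℕ} (e : Fin N → Fin 2) (w : Fin N → W) : Prop :=
  ∀ t, P (w t) = ((-1 : ℤ) ^ (e t).val) • w t

theorem parityProj_eq_self {P : W →ₗ[ℝ] W} {ε : Fin 2} {w : W}
    (h : P w = ((-1 : ℤ) ^ ε.val) • w) : parityProj P ε w = w := by
  fin_cases ε <;> simp [parityProj] at h ⊢ <;> rw [h] <;> module

theorem parityProj_eq_zero {P : W →ₗ[ℝ] W} {ε ε' : Fin 2} {w : W} (hne : ε' ≠ ε)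
    (h : P w = ((-1 : ℤ) ^ ε.val) • w) : parityProj P ε' w = 0 := by
  fin_cases ε <;> fin_cases ε' <;> simp [parityProj] at h hne ⊢ <;> rw [h] <;> simp

theorem parity_parityProj {P : W →ₗ[ℝ] W} (hP : ∀ w, P (P w) = w) (ε : Fin 2) (w : W) :
    P (parityProj P ε w) = ((-1 : ℤ) ^ ε.val) • parityProj P ε w := by
  fin_cases ε <;> simp [parityProj, hP] <;> module

theorem parityProj_add_parityProj (P : W →ₗ[ℝ] W) (w : W) :
    parityProj P 0 w + parityProj P 1 w = w := by
  simp [parityProj]; module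

/-- Multilinear maps are determined by their values on a spanning set. -/
theorem multilinear_ext_span {M : Type} [AddCommGroup M] [Module ℝ M] {N : ℕ} {S : Set W}
    (hS : Submodule.span ℝ S = ⊤)
    {f g : MultilinearMap ℝ (fun _ : Fin N => W) M}
    (h : ∀ w : Fin N → W, (∀ t, w t ∈ S) → f w = g w) : f = g := by
  -- `T` is the set of slots whose argument is still unrestricted; the induction frees one slot at a
  -- time.
  have key : ∀ T : Finset (Fin N), ∀ w : Fin N → W, (∀ t, t ∉ T → w t ∈ S) → f w = g w := by
    intro T
    induction T using Finset.induction_on with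
    | empty => exact fun w hw => h w fun t => hw t (by simp)
    | insert a T ha ih =>
      intro w hw
      have : ∀ x ∈ Submodule.span ℝ S, f (Function.update w a x) = g (Function.update w a x) := by
        intro x hx
        induction hx using Submodule.span_induction with
        | mem x hx =>
          refine ih _ fun t ht => ?_
          by_cases hta : t = a
          · subst hta; simpa using hx
          · rw [Function.update_of_ne hta]; exact hw t (by simp [hta, ht])
        | zero => simp
        | add x y _ _ hx hy => rw [f.map_update_add, g.map_update_add, hx, hy]
        | smul c x _ hx => rw [f.map_update_smul, g.map_update_smul, hx]
      have h2 := this (w a) (by rw [hS]; trivial)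
      simpa using h2
  ext w
  exact key Finset.univ w fun t ht => absurd (Finset.mem_univ t) ht

/-- Multilinear maps are determined by their values on tuples of vectors of definite parity. -/
theorem multilinear_ext_parity {M : Type} [AddCommGroup M] [Module ℝ M] {P : W →ₗ[ℝ] W}
    (hP : ∀ w, P (P w) = w) {N : ℕ}
    {f g : MultilinearMap ℝ (fun _ : Fin N => W) M}
    (h : ∀ (e : Fin N → Fin 2) (w : Fin N → W), HasParity P e w → f w = g w) : f = g := by
  refine multilinear_ext_span (S := {x | ∃ ε : Fin 2, P x = ((-1 : ℤ) ^ ε.val) • x}) ?_ ?_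
  · refine eq_top_iff.mpr fun x _ => ?_
    rw [← parityProj_add_parityProj P x]
    exact Submodule.add_mem _ (Submodule.subset_span ⟨0, parity_parityProj hP 0 x⟩)
      (Submodule.subset_span ⟨1, parity_parityProj hP 1 x⟩)
  · intro w hw
    choose e he using hw
    exact h e w he

/-- On homogeneous arguments only the summand with `ε = e` survives, since any other `ε` has a slot
where the parity projection kills the argument. Later sign computations all pass through this
formula. -/
theorem permAct_apply {P : W →ₗ[ℝ] W} {N : ℕ} (θ : MultilinearMap ℝ (fun _ : Fin N => W) W)
    (σ : Equiv.Perm (Fin N)) {e : Fin N → Fin 2} {w : Fin N → W} (hw : HasParity P e w) :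
    permAct P θ σ w = koszulSign σ e • θ (fun l => w (σ⁻¹ l)) := by
  rw [permAct, sum_apply, Finset.sum_eq_single e]
  · simp only [smul_apply, MultilinearMap.domDomCongr_apply,
      MultilinearMap.compLinearMap_apply]
    congr 2
    funext l
    exact parityProj_eq_self (hw _)
  · intro ε _ hε
    obtain ⟨t, ht⟩ := Function.ne_iff.mp hε
    simp only [smul_apply, MultilinearMap.domDomCongr_apply,
      MultilinearMap.compLinearMap_apply]
    rw [θ.map_coord_zero (σ t), smul_zero]
    have h1 : σ⁻¹ (σ t) = t := by simp
    rw [h1]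
    exact parityProj_eq_zero ht (hw _)
  · simp

/-- The cocycle identity `koszulSign_mul`, read on homogeneous arguments: `permAct` is a right
action. -/
theorem permAct_mul {P : W →ₗ[ℝ] W} (hP : ∀ w, P (P w) = w) {N : ℕ}
    (θ : MultilinearMap ℝ (fun _ : Fin N => W) W) (σ τ : Equiv.Perm (Fin N)) :
    permAct P θ (σ * τ) = permAct P (permAct P θ σ) τ := by
  refine multilinear_ext_parity hP fun e w hw => ?_
  have hw' : HasParity P (fun l => e (τ⁻¹ l)) (fun l => w (τ⁻¹ l)) := fun t => hw _
  rw [permAct_apply _ _ hw, permAct_apply _ _ hw, permAct_apply _ _ hw', koszulSign_mul,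
    smul_smul]
  simp

theorem permAct_one {P : W →ₗ[ℝ] W} (hP : ∀ w, P (P w) = w) {N : ℕ}
    (θ : MultilinearMap ℝ (fun _ : Fin N => W) W) : permAct P θ 1 = θ := by
  refine multilinear_ext_parity hP fun e w hw => ?_
  rw [permAct_apply _ _ hw, koszulSign_one]
  simp

/-- `permAct` as a linear map. -/
def permActₗ (P : W →ₗ[ℝ] W) {N : ℕ} (σ : Equiv.Perm (Fin N)) :
    MultilinearMap ℝ (fun _ : Fin N => W) W →ₗ[ℝ] MultilinearMap ℝ (fun _ : Fin N => W) W where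
  toFun θ := permAct P θ σ
  map_add' x y := by ext w; simp [permAct, Finset.sum_add_distrib]
  map_smul' r x := by
    ext w
    simp only [permAct, sum_apply, smul_apply, Finset.smul_sum,
      MultilinearMap.domDomCongr_apply, MultilinearMap.compLinearMap_apply, RingHom.id_apply]
    exact Finset.sum_congr rfl fun _ _ => smul_comm _ _ _

theorem permActₗ_apply (P : W →ₗ[ℝ] W) {N : ℕ} (σ : Equiv.Perm (Fin N))
    (θ : MultilinearMap ℝ (fun _ : Fin N => W) W) : permActₗ P σ θ = permAct P θ σ := rfl

theorem permAct_add (P : W →ₗ[ℝ] W) {N : ℕ} (σ : Equiv.Perm (Fin N))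
    (θ θ' : MultilinearMap ℝ (fun _ : Fin N => W) W) :
    permAct P (θ + θ') σ = permAct P θ σ + permAct P θ' σ := (permActₗ P σ).map_add θ θ'

theorem permAct_smul (P : W →ₗ[ℝ] W) {N : ℕ} (σ : Equiv.Perm (Fin N)) (c : ℝ)
    (θ : MultilinearMap ℝ (fun _ : Fin N => W) W) :
    permAct P (c • θ) σ = c • permAct P θ σ := (permActₗ P σ).map_smul c θ

theorem permAct_zsmul (P : W →ₗ[ℝ] W) {N : ℕ} (σ : Equiv.Perm (Fin N)) (c : ℤ)
    (θ : MultilinearMap ℝ (fun _ : Fin N => W) W) :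
    permAct P (c • θ) σ = c • permAct P θ σ := map_zsmul (permActₗ P σ) c θ

theorem permAct_sum (P : W →ₗ[ℝ] W) {N : ℕ} (σ : Equiv.Perm (Fin N)) {ι : Type} (s : Finset ι)
    (θ : ι → MultilinearMap ℝ (fun _ : Fin N => W) W) :
    permAct P (∑ i ∈ s, θ i) σ = ∑ i ∈ s, permAct P (θ i) σ := map_sum (permActₗ P σ) θ s

/-- Induction on permutations by adjacent transpositions. -/
theorem perm_induction_swap_succ {n : ℕ} {C : Equiv.Perm (Fin (n + 1)) → Prop} (h1 : C 1)
    (hs : ∀ σ (i : Fin n), C σ → C (σ * Equiv.swap i.castSucc i.succ)) (σ) : C σ := by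
  have h : σ ∈ Submonoid.closure (Set.range fun i : Fin n => Equiv.swap i.castSucc i.succ) := by
    rw [Equiv.Perm.mclosure_swap_castSucc_succ]; trivial
  induction h using Submonoid.closure_induction_right with
  | one => exact h1
  | mul_right x _ y hy ih =>
    obtain ⟨i, rfl⟩ := hy
    exact hs x i ih

theorem swap_castSucc_succ_inv {n : ℕ} (i : Fin n) :
    (Equiv.swap i.castSucc i.succ)⁻¹ = Equiv.swap i.castSucc i.succ := Equiv.swap_inv _ _

theorem sign_swap_castSucc_succ {n : ℕ} (i : Fin n) :
    Equiv.Perm.sign (Equiv.swap i.castSucc i.succ) = -1 :=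
  Equiv.Perm.sign_swap (by simp [Fin.ext_iff])

end PermAct

/-! ### Partial compositions of multilinear maps -/

section Compose

variable {W : Type} [AddCommGroup W] [Module ℝ W]

/-- The vertices behind the inserted ones. -/
def restVertex {a b c : ℕ} (h : a + b = c) (i : Fin a) : Fin (c + 1) := ⟨b + 1 + i.val, by omega⟩

theorem mlCompFirst_apply {a b c : ℕ} (h : a + b = c)
    (f : MultilinearMap ℝ (fun _ : Fin (a + 1) => W) W)
    (g : MultilinearMap ℝ (fun _ : Fin (b + 1) => W) W) (w : Fin (c + 1) → W) :
    mlCompFirst h f g w =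
      f.curryLeft (g fun i => w (insertVertex h i)) (fun i => w (restVertex h i)) := by
  subst h
  simp only [mlCompFirst, MultilinearMap.domDomCongr_apply, MultilinearMap.uncurrySum_apply,
    LinearMap.compMultilinearMap_apply]
  congr 2

/-- The composition `∘₁` as a bilinear map. -/
def mlCompFirstₗ (W : Type) [AddCommGroup W] [Module ℝ W] {a b c : ℕ} (h : a + b = c) :
    MultilinearMap ℝ (fun _ : Fin (a + 1) => W) W →ₗ[ℝ]
      MultilinearMap ℝ (fun _ : Fin (b + 1) => W) W →ₗ[ℝ]
        MultilinearMap ℝ (fun _ : Fin (c + 1) => W) W :=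
  LinearMap.mk₂ ℝ (mlCompFirst h)
    (fun f f' g => by ext w; simp [mlCompFirst_apply])
    (fun r f g => by ext w; simp [mlCompFirst_apply])
    (fun f g g' => by ext w; simp [mlCompFirst_apply, -MultilinearMap.curryLeft_apply])
    (fun r f g => by ext w; simp [mlCompFirst_apply, -MultilinearMap.curryLeft_apply])

theorem mlCompFirstₗ_apply {a b c : ℕ} (h : a + b = c)
    (f : MultilinearMap ℝ (fun _ : Fin (a + 1) => W) W)
    (g : MultilinearMap ℝ (fun _ : Fin (b + 1) => W) W) :
    mlCompFirstₗ W h f g = mlCompFirst h f g := rfl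

/-- No sign arises because both insertions take place in the first argument, where the inserted map
has nothing to pass. -/
theorem mlCompFirst_assoc {a b c n m e : ℕ} (hn : a + b = n) (he : n + c = e) (hm : b + c = m)
    (he' : a + m = e)
    (F : MultilinearMap ℝ (fun _ : Fin (a + 1) => W) W)
    (G : MultilinearMap ℝ (fun _ : Fin (b + 1) => W) W)
    (H : MultilinearMap ℝ (fun _ : Fin (c + 1) => W) W) :
    mlCompFirst he (mlCompFirst hn F G) H = mlCompFirst he' F (mlCompFirst hm G H) := by
  ext w
  simp only [mlCompFirst_apply, MultilinearMap.curryLeft_apply]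
  congr 2
  · congr 1
    funext i
    refine Fin.cases ?_ (fun i => ?_) i
    · rfl
    · change w _ = w _
      congr 1
  · funext i
    have : restVertex hn i = Fin.succ ⟨b + i.val, by omega⟩ := by
      simp only [restVertex, Fin.ext_iff, Fin.val_succ]; omega
    rw [this, Fin.cons_succ]
    congr 1
    simp only [restVertex, Fin.ext_iff]
    omega

/-- The arguments of a composition, in two blocks. -/
def blockEquiv {a b c : ℕ} (h : a + b = c) : Fin (b + 1) ⊕ Fin a ≃ Fin (c + 1) :=
  finSumFinEquiv.trans (finCongr (by omega))

theorem blockEquiv_inl {a b c : ℕ} (h : a + b = c) (i : Fin (b + 1)) :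
    blockEquiv h (Sum.inl i) = insertVertex h i := by
  simp [blockEquiv, insertVertex, Fin.ext_iff]

theorem blockEquiv_inr {a b c : ℕ} (h : a + b = c) (i : Fin a) :
    blockEquiv h (Sum.inr i) = restVertex h i := by
  simp [blockEquiv, restVertex, Fin.ext_iff]

/-- The permutations which preserve the two blocks. -/
def blockPerm {a b c : ℕ} (h : a + b = c) :
    Equiv.Perm (Fin (b + 1)) × Equiv.Perm (Fin a) →* Equiv.Perm (Fin (c + 1)) :=
  (blockEquiv h).permCongrHom.toMonoidHom.comp (Equiv.Perm.sumCongrHom _ _)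

theorem blockPerm_insertVertex {a b c : ℕ} (h : a + b = c) (τ) (i : Fin (b + 1)) :
    blockPerm h τ (insertVertex h i) = insertVertex h (τ.1 i) := by
  rw [← blockEquiv_inl, ← blockEquiv_inl]
  simp [blockPerm]

theorem blockPerm_restVertex {a b c : ℕ} (h : a + b = c) (τ) (i : Fin a) :
    blockPerm h τ (restVertex h i) = restVertex h (τ.2 i) := by
  rw [← blockEquiv_inr, ← blockEquiv_inr]
  simp [blockPerm]

theorem block_cases {a b c : ℕ} (h : a + b = c) {C : Fin (c + 1) → Prop}
    (h1 : ∀ i, C (insertVertex h i)) (h2 : ∀ i, C (restVertex h i)) (v) : C v := by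
  obtain ⟨x, rfl⟩ := (blockEquiv h).surjective v
  rcases x with i | i
  · rw [blockEquiv_inl]; exact h1 i
  · rw [blockEquiv_inr]; exact h2 i

theorem insertVertex_injective {a b c : ℕ} (h : a + b = c) :
    Function.Injective (insertVertex h) := fun i j hij => by
  simpa [insertVertex, Fin.ext_iff] using hij

theorem restVertex_injective {a b c : ℕ} (h : a + b = c) :
    Function.Injective (restVertex h) := fun i j hij => by
  simpa [restVertex, Fin.ext_iff] using hij

theorem insertVertex_ne_restVertex {a b c : ℕ} (h : a + b = c) (i : Fin (b + 1)) (j : Fin a) :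
    insertVertex h i ≠ restVertex h j := by
  simp only [insertVertex, restVertex, ne_eq, Fin.ext_iff]; omega

theorem blockPerm_swap_left {a b c : ℕ} (h : a + b = c) (i j : Fin (b + 1)) :
    blockPerm h (Equiv.swap i j, 1) = Equiv.swap (insertVertex h i) (insertVertex h j) := by
  refine Equiv.ext fun v => ?_
  induction v using block_cases h with
  | h1 v => rw [blockPerm_insertVertex, (insertVertex_injective h).swap_apply]
  | h2 v =>
    rw [blockPerm_restVertex, Equiv.swap_apply_of_ne_of_ne (insertVertex_ne_restVertex h _ _).symm
      (insertVertex_ne_restVertex h _ _).symm]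
    rfl

theorem blockPerm_swap_right {a b c : ℕ} (h : a + b = c) (i j : Fin a) :
    blockPerm h (1, Equiv.swap i j) = Equiv.swap (restVertex h i) (restVertex h j) := by
  refine Equiv.ext fun v => ?_
  induction v using block_cases h with
  | h2 v => rw [blockPerm_restVertex, (restVertex_injective h).swap_apply]
  | h1 v =>
    rw [blockPerm_insertVertex, Equiv.swap_apply_of_ne_of_ne (insertVertex_ne_restVertex h _ _)
      (insertVertex_ne_restVertex h _ _)]
    rfl

/-- For an adjacent transposition both sides carry the same Koszul sign, the exchanged arguments
being the same two vectors; such transpositions generate. -/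
theorem permAct_mlCompFirst_right {P : W →ₗ[ℝ] W} (hP : ∀ w, P (P w) = w) {a b c : ℕ}
    (h : a + b = c) (f : MultilinearMap ℝ (fun _ : Fin (a + 1) => W) W)
    (g : MultilinearMap ℝ (fun _ : Fin (b + 1) => W) W) (τ : Equiv.Perm (Fin (b + 1))) :
    permAct P (mlCompFirst h f g) (blockPerm h (τ, 1)) = mlCompFirst h f (permAct P g τ) := by
  induction τ using perm_induction_swap_succ with
  | h1 =>
    change permAct P _ (blockPerm h 1) = _
    rw [map_one, permAct_one hP, permAct_one hP]
  | hs σ i ih =>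
    have : ((σ * Equiv.swap i.castSucc i.succ, 1) :
        Equiv.Perm (Fin (b + 1)) × Equiv.Perm (Fin a)) =
        (σ, 1) * (Equiv.swap i.castSucc i.succ, 1) := by simp
    rw [this, map_mul, permAct_mul hP, ih, permAct_mul hP]
    clear ih this
    generalize permAct P g σ = g
    refine multilinear_ext_parity hP fun e w hw => ?_
    have hw' : HasParity P (fun l => e (insertVertex h l)) (fun l => w (insertVertex h l)) :=
      fun t => hw _
    have hsw : blockPerm h (Equiv.swap i.castSucc i.succ, 1) =
        Equiv.swap (⟨i.val, by omega⟩ : Fin c).castSucc (⟨i.val, by omega⟩ : Fin c).succ := by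
      rw [blockPerm_swap_left]; rfl
    rw [mlCompFirst_apply, permAct_apply _ _ hw, permAct_apply _ _ hw', mlCompFirst_apply,
      map_zsmul, smul_apply, hsw, koszulSign_swap_succ, koszulSign_swap_succ,
      ← hsw, ← map_inv]
    simp only [blockPerm_insertVertex, blockPerm_restVertex]
    rfl

/-- A permutation of the arguments behind the first one. -/
def shiftPerm {a : ℕ} : Equiv.Perm (Fin a) →* Equiv.Perm (Fin (a + 1)) where
  toFun τ := Equiv.Perm.decomposeFin.symm (0, τ)
  map_one' := Equiv.Perm.decomposeFin_symm_of_one 0 |>.trans (Equiv.swap_self 0)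
  map_mul' σ τ := by
    refine Equiv.ext fun v => ?_
    refine Fin.cases ?_ (fun v => ?_) v
    · simp
    · simp

theorem shiftPerm_zero {a : ℕ} (τ : Equiv.Perm (Fin a)) : shiftPerm τ 0 = 0 := by
  simp [shiftPerm]

theorem shiftPerm_succ {a : ℕ} (τ : Equiv.Perm (Fin a)) (i : Fin a) :
    shiftPerm τ i.succ = (τ i).succ := by
  simp [shiftPerm]

theorem shiftPerm_swap {a : ℕ} (i j : Fin a) :
    shiftPerm (Equiv.swap i j) = Equiv.swap i.succ j.succ := by
  refine Equiv.ext fun v => ?_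
  refine Fin.cases ?_ (fun v => ?_) v
  · rw [shiftPerm_zero, Equiv.swap_apply_of_ne_of_ne (Fin.succ_ne_zero _).symm
      (Fin.succ_ne_zero _).symm]
  · rw [shiftPerm_succ, (Fin.succ_injective _).swap_apply]

/-- `g` has parity `m` with respect to the parity operator `P`. -/
def MapParity (P : W →ₗ[ℝ] W) {N : ℕ} (m : ℤ) (g : MultilinearMap ℝ (fun _ : Fin N => W) W) :
    Prop := ∀ w, P (g w) = (m.negOnePow : ℤ) • g fun t => P (w t)

theorem negOnePow_natCast (m : ℕ) : ((m : ℤ).negOnePow : ℤ) = (-1) ^ m := by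
  rw [Int.negOnePow_def]; simp

theorem negOnePow_cast_mul (i j : ℤ) :
    ((i + j).negOnePow : ℤ) = (i.negOnePow : ℤ) * (j.negOnePow : ℤ) := by
  rw [Int.negOnePow_add]; simp

theorem negOnePow_eq_of_even_sub {i j : ℤ} (h : Even (i - j)) :
    (i.negOnePow : ℤ) = (j.negOnePow : ℤ) := by
  rw [(Int.negOnePow_eq_iff i j).mpr h]

/-- Parities of integers as elements of `Fin 2`. -/
def parityFin (m : ℤ) : Fin 2 := if Even m then 0 else 1

theorem neg_one_pow_parityFin (m : ℤ) : (-1 : ℤ) ^ (parityFin m).val = (m.negOnePow : ℤ) := by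
  unfold parityFin
  split_ifs with h
  · simp [Int.negOnePow_even m h]
  · simp [Int.negOnePow_odd m (Int.not_even_iff_odd.mp h)]

theorem MapParity.apply {P : W →ₗ[ℝ] W} {N : ℕ} {m : ℤ}
    {g : MultilinearMap ℝ (fun _ : Fin N => W) W} (hg : MapParity P m g) {e : Fin N → Fin 2}
    {w : Fin N → W} (hw : HasParity P e w) :
    P (g w) = ((m + ∑ t, ((e t).val : ℤ)).negOnePow : ℤ) • g w := by
  have h1 : (fun t => P (w t)) = fun t => ((-1 : ℝ) ^ (e t).val) • w t := by
    funext t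
    rw [hw t, ← Int.cast_smul_eq_zsmul ℝ]
    simp
  rw [hg w, h1, g.map_smul_univ, Finset.prod_pow_eq_pow_sum, negOnePow_cast_mul, mul_smul,
    ← Nat.cast_sum, negOnePow_natCast, ← Int.cast_smul_eq_zsmul ℝ ((-1) ^ _)]
  simp

theorem MapParity.apply_fin {P : W →ₗ[ℝ] W} {N : ℕ} {m : ℤ}
    {g : MultilinearMap ℝ (fun _ : Fin N => W) W} (hg : MapParity P m g) {e : Fin N → Fin 2}
    {w : Fin N → W} (hw : HasParity P e w) :
    P (g w) = ((-1 : ℤ) ^ (parityFin (m + ∑ t, ((e t).val : ℤ))).val) • g w := by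
  rw [hg.apply hw, neg_one_pow_parityFin]

theorem hasParity_cons {P : W →ₗ[ℝ] W} {N : ℕ} {e : Fin N → Fin 2} {w : Fin N → W}
    (hw : HasParity P e w) {x : W} {ε : Fin 2} (hx : P x = ((-1 : ℤ) ^ ε.val) • x) :
    HasParity P (Fin.cons ε e : Fin (N + 1) → Fin 2) (Fin.cons x w : Fin (N + 1) → W) := by
  intro t
  refine Fin.cases ?_ (fun t => ?_) t
  · simpa using hx
  · simpa using hw t

/-- The parity of `g` serves to make the first argument of `f` homogeneous, so that the Koszul sign
can be evaluated. As `shiftPerm τ` fixes that slot, this parity does not enter the sign. -/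
theorem permAct_mlCompFirst_left {P : W →ₗ[ℝ] W} (hP : ∀ w, P (P w) = w) {a b c : ℕ}
    (h : a + b = c) (f : MultilinearMap ℝ (fun _ : Fin (a + 1) => W) W)
    {g : MultilinearMap ℝ (fun _ : Fin (b + 1) => W) W} {m : ℤ} (hg : MapParity P m g)
    (τ : Equiv.Perm (Fin a)) :
    permAct P (mlCompFirst h f g) (blockPerm h (1, τ)) =
      mlCompFirst h (permAct P f (shiftPerm τ)) g := by
  cases a with
  | zero =>
    have : τ = 1 := Subsingleton.elim _ _
    subst this
    change permAct P _ (blockPerm h 1) = _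
    rw [map_one, map_one, permAct_one hP, permAct_one hP]
  | succ n =>
  induction τ using perm_induction_swap_succ with
  | h1 =>
    change permAct P _ (blockPerm h 1) = _
    rw [map_one, map_one, permAct_one hP, permAct_one hP]
  | hs σ i ih =>
    have : ((1, σ * Equiv.swap i.castSucc i.succ) :
        Equiv.Perm (Fin (b + 1)) × Equiv.Perm (Fin (n + 1))) =
        (1, σ) * (1, Equiv.swap i.castSucc i.succ) := by simp
    rw [this, map_mul, permAct_mul hP, ih, map_mul, permAct_mul hP]
    clear ih this
    generalize permAct P f (shiftPerm σ) = f
    refine multilinear_ext_parity hP fun e w hw => ?_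
    have hw' : HasParity P (fun l => e (restVertex h l)) (fun l => w (restVertex h l)) :=
      fun t => hw _
    have hw2 : HasParity P (fun l => e (insertVertex h l)) (fun l => w (insertVertex h l)) :=
      fun t => hw _
    have hw3 := hasParity_cons hw' (hg.apply_fin hw2)
    have hsw : blockPerm h (1, Equiv.swap i.castSucc i.succ) =
        Equiv.swap (⟨b + 1 + i.val, by omega⟩ : Fin c).castSucc
          (⟨b + 1 + i.val, by omega⟩ : Fin c).succ := by
      rw [blockPerm_swap_right]; rfl
    have hsw2 : shiftPerm (Equiv.swap i.castSucc i.succ) =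
        Equiv.swap i.succ.castSucc i.succ.succ := by
      rw [shiftPerm_swap]; rfl
    rw [mlCompFirst_apply, permAct_apply _ _ hw, MultilinearMap.curryLeft_apply,
      permAct_apply _ _ hw3, mlCompFirst_apply, hsw, hsw2, koszulSign_swap_succ,
      koszulSign_swap_succ, ← hsw, ← hsw2, ← map_inv, ← map_inv, MultilinearMap.curryLeft_apply]
    simp only [blockPerm_insertVertex, blockPerm_restVertex, Prod.inv_mk]
    congr 2
    funext t
    refine Fin.cases ?_ (fun t => ?_) t
    · rw [shiftPerm_zero]; rfl
    · rw [shiftPerm_succ]; rfl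

end Compose

/-! ### Sums over unshuffles -/

theorem mem_unshuffles_iff {a b c : ℕ} (h : a + b = c) (u : Equiv.Perm (Fin (c + 1))) :
    u ∈ unshuffles (b + 1) (c + 1) ↔
      StrictMono (fun i => u⁻¹ (insertVertex h i)) ∧
        StrictMono (fun i => u⁻¹ (restVertex h i)) := by
  simp only [unshuffles, Finset.mem_filter, Finset.mem_univ, true_and]
  refine and_congr ⟨fun H i j hij => H _ _ hij j.2, fun H i j hij hj => ?_⟩
    ⟨fun H i j hij => H _ _ ?_ ?_, fun H i j hij hi => ?_⟩
  · exact H (a := ⟨i.val, by omega⟩) (b := ⟨j.val, hj⟩) hij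
  · exact Nat.add_lt_add_left hij (b + 1)
  · exact Nat.le_add_right (b + 1) i.val
  · have := H (a := ⟨i.val - (b + 1), by omega⟩) (b := ⟨j.val - (b + 1), by omega⟩)
      (by simp only [Fin.lt_def] at *; omega)
    have e1 : restVertex h ⟨i.val - (b + 1), by omega⟩ = i := Fin.ext (Nat.add_sub_cancel' hi)
    have e2 : restVertex h ⟨j.val - (b + 1), by omega⟩ = j :=
      Fin.ext (Nat.add_sub_cancel' (hi.trans hij.le))
    simpa only [e1, e2] using this

theorem blockPerm_injective {a b c : ℕ} (h : a + b = c) : Function.Injective (blockPerm h) :=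
  (blockEquiv h).permCongrHom.injective.comp Equiv.Perm.sumCongrHom_injective

/-- Uniqueness of the representative of a coset: in both blocks the inverses of the two unshuffles
are increasing enumerations of the same set, hence equal. -/
theorem blockPerm_mul_unshuffle_injective {a b c : ℕ} (h : a + b = c) {τ τ'}
    {u u' : Equiv.Perm (Fin (c + 1))} (hu : u ∈ unshuffles (b + 1) (c + 1))
    (hu' : u' ∈ unshuffles (b + 1) (c + 1)) (H : blockPerm h τ * u = blockPerm h τ' * u') :
    τ = τ' ∧ u = u' := by
  rw [mem_unshuffles_iff h] at hu hu'
  have hinv : u⁻¹ = u'⁻¹ * blockPerm h (τ'⁻¹ * τ) := by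
    rw [map_mul, map_inv, eq_comm, ← mul_assoc, ← mul_inv_rev, ← H, mul_inv_rev, mul_assoc,
      inv_mul_cancel, mul_one]
  have h1 : (fun i => u⁻¹ (insertVertex h i)) = fun i => u'⁻¹ (insertVertex h i) := by
    refine (StrictMono.range_inj hu.1 hu'.1).mp ?_
    have : (fun i => u⁻¹ (insertVertex h i)) =
        (fun i => u'⁻¹ (insertVertex h i)) ∘ (τ'⁻¹ * τ).1 := by
      funext i
      rw [hinv, Equiv.Perm.mul_apply, blockPerm_insertVertex]; rfl
    rw [this, (τ'⁻¹ * τ).1.surjective.range_comp]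
  have h2 : (fun i => u⁻¹ (restVertex h i)) = fun i => u'⁻¹ (restVertex h i) := by
    refine (StrictMono.range_inj hu.2 hu'.2).mp ?_
    have : (fun i => u⁻¹ (restVertex h i)) =
        (fun i => u'⁻¹ (restVertex h i)) ∘ (τ'⁻¹ * τ).2 := by
      funext i
      rw [hinv, Equiv.Perm.mul_apply, blockPerm_restVertex]; rfl
    rw [this, (τ'⁻¹ * τ).2.surjective.range_comp]
  have h3 : u⁻¹ = u'⁻¹ := by
    refine Equiv.ext fun v => ?_
    induction v using block_cases h with
    | h1 v => exact congrFun h1 v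
    | h2 v => exact congrFun h2 v
  have h4 : u = u' := inv_injective h3
  subst h4
  exact ⟨blockPerm_injective h (mul_right_cancel H), rfl⟩

/-- Let `u⁻¹` enumerate increasingly the preimage `S` of the first block under `σ` and then its
complement. Then `σ u⁻¹` preserves the blocks. -/
theorem exists_blockPerm_mul_unshuffle {a b c : ℕ} (h : a + b = c) (σ : Equiv.Perm (Fin (c + 1))) :
    ∃ τ, ∃ u ∈ unshuffles (b + 1) (c + 1), blockPerm h τ * u = σ := by
  classical
  let S : Finset (Fin (c + 1)) := Finset.univ.image fun i => σ⁻¹ (insertVertex h i)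
  have hS : S.card = b + 1 := by
    exact (Finset.card_image_of_injective _
      (σ⁻¹.injective.comp (insertVertex_injective h))).trans (by rw [Finset.card_univ, Fintype.card_fin])
  have hSc : Sᶜ.card = a := by
    rw [Finset.card_compl, hS, Fintype.card_fin]; omega
  let e := finSumEquivOfFinset hS hSc
  let u : Equiv.Perm (Fin (c + 1)) := e.symm.trans (blockEquiv h)
  have hu1 : ∀ i, u⁻¹ (insertVertex h i) = S.orderEmbOfFin hS i := fun i => by
    rw [← blockEquiv_inl, Equiv.Perm.inv_eq_iff_eq]
    rw [← finSumEquivOfFinset_inl hS hSc]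
    exact congrArg (blockEquiv h) (e.symm_apply_apply _).symm
  have hu2 : ∀ i, u⁻¹ (restVertex h i) = Sᶜ.orderEmbOfFin hSc i := fun i => by
    rw [← blockEquiv_inr, Equiv.Perm.inv_eq_iff_eq]
    rw [← finSumEquivOfFinset_inr hS hSc]
    exact congrArg (blockEquiv h) (e.symm_apply_apply _).symm
  have hu : u ∈ unshuffles (b + 1) (c + 1) := by
    rw [mem_unshuffles_iff h]
    simp only [hu1, hu2]
    exact ⟨(S.orderEmbOfFin hS).strictMono, (Sᶜ.orderEmbOfFin hSc).strictMono⟩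
  have hr : (blockEquiv h).symm.permCongr (σ * u⁻¹) ∈
      (Equiv.Perm.sumCongrHom (Fin (b + 1)) (Fin a)).range := by
    refine Equiv.Perm.mem_sumCongrHom_range_of_perm_mapsTo_inl ?_
    rintro _ ⟨i, rfl⟩
    have := S.orderEmbOfFin_mem hS i
    simp only [S, Finset.mem_image, Finset.mem_univ, true_and] at this
    obtain ⟨j, hj⟩ := this
    refine ⟨j, ?_⟩
    rw [Equiv.permCongr_apply, Equiv.symm_symm, blockEquiv_inl, Equiv.Perm.mul_apply, hu1, ← hj,
      Equiv.eq_symm_apply, blockEquiv_inl]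
    simp
  obtain ⟨τ, hτ⟩ := hr
  refine ⟨τ, u, hu, ?_⟩
  rw [← eq_mul_inv_iff_mul_eq]
  change (blockEquiv h).permCongr _ = _
  rw [hτ]
  ext v
  simp

/-- Unshuffles represent the cosets of the block permutations, a subgroup of order `(b+1)! a!`.
Passing to the sum over the whole group makes it unnecessary to compose unshuffles with one another.
-/
theorem sum_unshuffles {M : Type} [AddCommGroup M] [Module ℝ M] {a b c : ℕ} (h : a + b = c)
    (ψ : Equiv.Perm (Fin (c + 1)) → M) (hψ : ∀ τ σ, ψ (blockPerm h τ * σ) = ψ σ) :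
    ∑ u ∈ unshuffles (b + 1) (c + 1), ψ u =
      ((((b + 1).factorial * a.factorial : ℕ) : ℝ)⁻¹) • ∑ σ, ψ σ := by
  have h1 : ∑ σ, ψ σ = ∑ x ∈ (Finset.univ : Finset (Equiv.Perm (Fin (b + 1)) ×
      Equiv.Perm (Fin a))) ×ˢ unshuffles (b + 1) (c + 1), ψ x.2 := by
    symm
    refine Finset.sum_bij (fun x _ => blockPerm h x.1 * x.2) (fun _ _ => Finset.mem_univ _) ?_ ?_ ?_
    · rintro ⟨τ, u⟩ hu ⟨τ', u'⟩ hu' H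
      obtain ⟨h1, h2⟩ := blockPerm_mul_unshuffle_injective h (Finset.mem_product.mp hu).2
        (Finset.mem_product.mp hu').2 H
      exact Prod.ext h1 h2
    · intro σ _
      obtain ⟨τ, u, hu, H⟩ := exists_blockPerm_mul_unshuffle h σ
      exact ⟨(τ, u), Finset.mem_product.mpr ⟨Finset.mem_univ _, hu⟩, H⟩
    · rintro ⟨τ, u⟩ _
      exact (hψ τ u).symm
  rw [h1, Finset.sum_product]
  dsimp only
  rw [Finset.sum_const, Finset.card_univ, Fintype.card_prod,
    Fintype.card_perm, Fintype.card_perm, Fintype.card_fin, Fintype.card_fin,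
    ← Nat.cast_smul_eq_nsmul ℝ, smul_smul, inv_mul_cancel₀, one_smul]
  positivity

theorem exists_shiftPerm {a : ℕ} {σ : Equiv.Perm (Fin (a + 1))} (hσ : σ 0 = 0) :
    ∃ τ, σ = shiftPerm τ := by
  obtain ⟨⟨p, τ⟩, rfl⟩ := Equiv.Perm.decomposeFin.symm.surjective σ
  rw [Equiv.Perm.decomposeFin_symm_apply_zero] at hσ
  subst hσ
  exact ⟨τ, rfl⟩

/-- A sum over all permutations of a function which is left invariant under block permutations
and right invariant under permutations that fix the first letter. -/
theorem sum_perm_double_coset {M : Type} [AddCommGroup M] [Module ℝ M] {a b n : ℕ} (h : a + b = n)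
    (φ : Equiv.Perm (Fin (n + 1)) → M) (hφ : ∀ τ σ, φ (blockPerm h τ * σ) = φ σ)
    (hφ' : ∀ σ τ, φ (σ * shiftPerm τ) = φ σ) (κ : Equiv.Perm (Fin (n + 1)))
    (hκ : ∀ ha : 0 < a, κ 0 = restVertex h ⟨0, ha⟩) :
    ∑ σ, φ σ = (((b + 1) * n.factorial : ℕ) : ℝ) • φ 1 + ((a * n.factorial : ℕ) : ℝ) • φ κ := by
  -- Right invariance makes `φ σ` depend on `σ 0` alone, and left invariance only on the block
  -- containing `σ 0`. Each value of `σ 0` is taken by `n!` permutations, and the blocks have `b +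
  -- 1` and `a` elements.
  have h0 : ∀ σ σ' : Equiv.Perm (Fin (n + 1)), σ 0 = σ' 0 → φ σ = φ σ' := by
    intro σ σ' H
    obtain ⟨τ, hτ⟩ := exists_shiftPerm (σ := σ'⁻¹ * σ) (by simp [H])
    rw [inv_mul_eq_iff_eq_mul] at hτ
    rw [hτ, hφ']
  rw [← Equiv.sum_comp Equiv.Perm.decomposeFin.symm, Fintype.sum_prod_type]
  have h1 : ∀ p : Fin (n + 1), ∑ e : Equiv.Perm (Fin n),
      φ (Equiv.Perm.decomposeFin.symm (p, e)) = (n.factorial : ℝ) • φ (Equiv.swap 0 p) := by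
    intro p
    have : ∀ e : Equiv.Perm (Fin n), φ (Equiv.Perm.decomposeFin.symm (p, e)) = φ (Equiv.swap 0 p) :=
      fun e => h0 _ _ (by simp)
    simp only [this, Finset.sum_const, Finset.card_univ, Fintype.card_perm, Fintype.card_fin,
      Nat.cast_smul_eq_nsmul]
  simp only [h1]
  rw [← Finset.smul_sum, ← Equiv.sum_comp (blockEquiv h), Fintype.sum_sum_type]
  have h2 : ∀ i : Fin (b + 1), φ (Equiv.swap 0 (blockEquiv h (Sum.inl i))) = φ 1 := by
    intro i
    have : (0 : Fin (n + 1)) = insertVertex h 0 := rfl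
    rw [blockEquiv_inl, this, ← blockPerm_swap_left, ← mul_one (blockPerm h _), hφ]
  have h3 : ∀ i : Fin a, φ (Equiv.swap 0 (blockEquiv h (Sum.inr i))) = φ κ := by
    intro i
    rw [blockEquiv_inr, ← hφ (1, Equiv.swap ⟨0, i.pos⟩ i) κ]
    refine h0 _ _ ?_
    rw [Equiv.swap_apply_left, Equiv.Perm.mul_apply, hκ i.pos, blockPerm_restVertex]
    simp
  simp only [h2, h3, Finset.sum_const, Finset.card_univ, Fintype.card_fin]
  rw [smul_add, ← Nat.cast_smul_eq_nsmul ℝ, ← Nat.cast_smul_eq_nsmul ℝ, smul_smul, smul_smul]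
  push_cast
  ring_nf


/-! ### Symmetrization and the pre-Lie product of symmetric multilinear maps -/

section SymmComp

variable {W : Type} [AddCommGroup W] [Module ℝ W]

/-- The sum over all permutations of the arguments. -/
def symmetrize (P : W →ₗ[ℝ] W) {N : ℕ} :
    MultilinearMap ℝ (fun _ : Fin N => W) W →ₗ[ℝ] MultilinearMap ℝ (fun _ : Fin N => W) W :=
  ∑ σ, permActₗ P σ

theorem symmetrize_apply (P : W →ₗ[ℝ] W) {N : ℕ} (θ : MultilinearMap ℝ (fun _ : Fin N => W) W) :
    symmetrize P θ = ∑ σ, permAct P θ σ := by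
  simp [symmetrize, permActₗ_apply]

theorem symmetrize_permAct {P : W →ₗ[ℝ] W} (hP : ∀ w, P (P w) = w) {N : ℕ}
    (θ : MultilinearMap ℝ (fun _ : Fin N => W) W) (τ) :
    symmetrize P (permAct P θ τ) = symmetrize P θ := by
  simp only [symmetrize_apply, ← permAct_mul hP]
  exact Equiv.sum_comp (Equiv.mulLeft τ) (permAct P θ)

theorem permAct_symmetrize {P : W →ₗ[ℝ] W} (hP : ∀ w, P (P w) = w) {N : ℕ}
    (θ : MultilinearMap ℝ (fun _ : Fin N => W) W) (τ) :
    permAct P (symmetrize P θ) τ = symmetrize P θ := by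
  simp only [symmetrize_apply, permAct_sum, ← permAct_mul hP]
  exact Equiv.sum_comp (Equiv.mulRight τ) (permAct P θ)

/-- Invariance under permutations of the arguments. -/
def IsSymm (P : W →ₗ[ℝ] W) {N : ℕ} (θ : MultilinearMap ℝ (fun _ : Fin N => W) W) : Prop :=
  ∀ σ, permAct P θ σ = θ

theorem permAct_mlCompFirst_blockPerm {P : W →ₗ[ℝ] W} (hP : ∀ w, P (P w) = w) {a b c : ℕ}
    (h : a + b = c) {f : MultilinearMap ℝ (fun _ : Fin (a + 1) => W) W}
    {g : MultilinearMap ℝ (fun _ : Fin (b + 1) => W) W} {m : ℤ} (hf : IsSymm P f)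
    (hgs : IsSymm P g) (hg : MapParity P m g) (τ) :
    permAct P (mlCompFirst h f g) (blockPerm h τ) = mlCompFirst h f g := by
  have : τ = (τ.1, 1) * (1, τ.2) := by simp
  rw [this, map_mul, permAct_mul hP, permAct_mlCompFirst_right hP, hgs,
    permAct_mlCompFirst_left hP h f hg, hf]

/-- Permuting the arguments of `g` is a block permutation of the composite, which the outer
symmetrization absorbs; so all `(b+1)!` summands agree. -/
theorem symmetrize_mlCompFirst_symmetrize_right {P : W →ₗ[ℝ] W} (hP : ∀ w, P (P w) = w)
    {a b c : ℕ} (h : a + b = c) (f : MultilinearMap ℝ (fun _ : Fin (a + 1) => W) W)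
    (g : MultilinearMap ℝ (fun _ : Fin (b + 1) => W) W) :
    symmetrize P (mlCompFirst h f (symmetrize P g)) =
      ((b + 1).factorial : ℝ) • symmetrize P (mlCompFirst h f g) := by
  rw [symmetrize_apply P g, ← mlCompFirstₗ_apply, map_sum, map_sum]
  simp only [mlCompFirstₗ_apply, ← permAct_mlCompFirst_right hP, symmetrize_permAct hP]
  rw [Finset.sum_const, Finset.card_univ, Fintype.card_perm, Fintype.card_fin,
    Nat.cast_smul_eq_nsmul]

/-- After symmetrization the summand for `σ` depends only on a double coset: permutations fixing the
first slot, where `H` enters, are absorbed, and `θ` is invariant under block permutations. For `θ =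
F ∘₁ G` the two classes say whether `H` enters an argument of `G` or another argument of `F`. -/
theorem symmetrize_mlCompFirst_symmetrize_left {P : W →ₗ[ℝ] W} (hP : ∀ w, P (P w) = w)
    {a b c n e : ℕ} (h : a + b = n) (he : n + c = e)
    (θ : MultilinearMap ℝ (fun _ : Fin (n + 1) => W) W)
    (hθ : ∀ τ, permAct P θ (blockPerm h τ) = θ)
    (H : MultilinearMap ℝ (fun _ : Fin (c + 1) => W) W) {k : ℤ} (hH : MapParity P k H)
    (κ : Equiv.Perm (Fin (n + 1))) (hκ : ∀ ha : 0 < a, κ 0 = restVertex h ⟨0, ha⟩) :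
    symmetrize P (mlCompFirst he (symmetrize P θ) H) =
      (((b + 1) * n.factorial : ℕ) : ℝ) • symmetrize P (mlCompFirst he θ H) +
        ((a * n.factorial : ℕ) : ℝ) • symmetrize P (mlCompFirst he (permAct P θ κ) H) := by
  have := sum_perm_double_coset h
    (fun σ => symmetrize P (mlCompFirst he (permAct P θ σ) H))
    (fun τ σ => by rw [permAct_mul hP, hθ])
    (fun σ τ => by
      rw [permAct_mul hP, ← permAct_mlCompFirst_left hP he _ hH, symmetrize_permAct hP]) κ hκ
  rw [permAct_one hP] at this
  have h2 : mlCompFirst he (∑ σ, permAct P θ σ) H = ∑ σ, mlCompFirst he (permAct P θ σ) H :=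
    map_sum ((mlCompFirstₗ W he).flip H) _ _
  rw [← this, symmetrize_apply P θ, h2, map_sum]

/-- Exchange the first `p` letters with the next `q` letters. -/
def blockSwap (N p q : ℕ) (h : p + q ≤ N) : Equiv.Perm (Fin N) where
  -- The reduction modulo `N` has no effect, as `i + q < p + q ≤ N`; it only supplies the bound.
  toFun i := if i.val < p then ⟨(i.val + q) % N, Nat.mod_lt _ i.pos⟩
    else if i.val < p + q then ⟨i.val - p, by omega⟩ else i
  invFun i := if i.val < q then ⟨(i.val + p) % N, Nat.mod_lt _ i.pos⟩
    else if i.val < p + q then ⟨i.val - q, by omega⟩ else i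
  left_inv i := by
    have hi := i.2
    by_cases h1 : i.val < p
    · have : (i.val + q) % N = i.val + q := Nat.mod_eq_of_lt (by omega)
      simp only [h1, if_true, this]
      rw [if_neg (by omega), if_pos (by omega)]
      ext; simp
    · by_cases h2 : i.val < p + q
      · simp only [h1, h2, if_false, if_true]
        rw [if_pos (by omega)]
        ext
        have : (i.val - p + p) % N = i.val := by
          rw [Nat.mod_eq_of_lt (by omega)]; omega
        simpa using this
      · simp only [h1, h2, if_false]
        rw [if_neg (by omega)]
  right_inv i := by
    have hi := i.2
    by_cases h1 : i.val < q
    · have : (i.val + p) % N = i.val + p := Nat.mod_eq_of_lt (by omega)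
      simp only [h1, if_true, this]
      rw [if_neg (by omega), if_pos (by omega)]
      ext; simp
    · by_cases h2 : i.val < p + q
      · simp only [h1, h2, if_false, if_true]
        rw [if_pos (by omega)]
        ext
        have : (i.val - q + q) % N = i.val := by
          rw [Nat.mod_eq_of_lt (by omega)]; omega
        simpa using this
      · simp only [h1, h2, if_false]
        rw [if_neg (by omega)]

theorem blockSwap_val {N p q : ℕ} (h : p + q ≤ N) (i : Fin N) :
    (blockSwap N p q h i).val =
      if i.val < p then i.val + q else if i.val < p + q then i.val - p else i.val := by
  have hi := i.2
  simp only [blockSwap, Equiv.coe_fn_mk]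
  split_ifs
  · exact Nat.mod_eq_of_lt (by omega)
  · rfl
  · rfl

theorem blockSwap_inv {N p q : ℕ} (h : p + q ≤ N) :
    (blockSwap N p q h)⁻¹ = blockSwap N q p (by omega) := by
  rw [inv_eq_iff_mul_eq_one]
  refine Equiv.ext fun i => Fin.ext ?_
  rw [Equiv.Perm.mul_apply, blockSwap_val, blockSwap_val]
  simp only [Equiv.Perm.one_apply]
  split_ifs <;> omega

theorem koszulSign_blockSwap {N p q : ℕ} (h : p + q ≤ N) (ε : Fin N → Fin 2) :
    koszulSign (blockSwap N p q h) ε =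
      (-1) ^ ((∑ i : Fin p, (ε ⟨i.val, by omega⟩).val) *
        ∑ j : Fin q, (ε ⟨p + j.val, by omega⟩).val) := by
  let E1 : Fin p ↪ Fin N := ⟨fun i => ⟨i.val, by omega⟩, fun i j hij => by
    simpa [Fin.ext_iff] using hij⟩
  let E2 : Fin q ↪ Fin N := ⟨fun i => ⟨p + i.val, by omega⟩, fun i j hij => by
    exact Fin.ext (Nat.add_left_cancel (congrArg Fin.val hij))⟩
  rw [koszulSign_of_inversions _ ε (Finset.univ.map E1) (Finset.univ.map E2), Finset.sum_map,
    Finset.sum_map]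
  · rfl
  · intro i j
    have h1 : i ∈ Finset.univ.map E1 ↔ i.val < p := by
      simp only [Finset.mem_map, Finset.mem_univ, true_and, E1]
      exact ⟨fun ⟨a, ha⟩ => ha ▸ a.2, fun hi => ⟨⟨i.val, hi⟩, rfl⟩⟩
    have h2 : j ∈ Finset.univ.map E2 ↔ p ≤ j.val ∧ j.val < p + q := by
      simp only [Finset.mem_map, Finset.mem_univ, true_and, E2]
      refine ⟨fun ⟨a, ha⟩ => ha ▸ ⟨Nat.le_add_right _ _, Nat.add_lt_add_left a.2 p⟩, fun hj => ⟨⟨j.val - p, by omega⟩, ?_⟩⟩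
      exact Fin.ext (Nat.add_sub_cancel' hj.1)
    rw [h1, h2, Fin.lt_def, Fin.lt_def, blockSwap_val, blockSwap_val]
    split_ifs <;> omega

theorem neg_one_pow_parityFin_mul (m : ℤ) (k : ℕ) :
    (-1 : ℤ) ^ ((parityFin m).val * k) = ((m * k).negOnePow : ℤ) := by
  unfold parityFin
  split_ifs with h
  · rw [Int.negOnePow_even _ (h.mul_right _)]; simp
  · rw [Int.not_even_iff_odd] at h
    rw [← negOnePow_natCast]
    refine negOnePow_eq_of_even_sub ?_
    obtain ⟨t, rfl⟩ := h
    exact ⟨-t * k, by push_cast; simp; ring⟩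

/-- Nest `G` and `H` in two different arguments of `F`. -/
theorem mlCompFirst_permAct_blockSwap_apply {P : W →ₗ[ℝ] W}
    {a b c n e : ℕ} (hn : a + 1 + b = n) (he : n + c = e)
    (F : MultilinearMap ℝ (fun _ : Fin (a + 1 + 1) => W) W)
    (G : MultilinearMap ℝ (fun _ : Fin (b + 1) => W) W)
    (H : MultilinearMap ℝ (fun _ : Fin (c + 1) => W) W) {k : ℤ} (hH : MapParity P k H)
    {ε : Fin (e + 1) → Fin 2} {w : Fin (e + 1) → W} (hw : HasParity P ε w) :
    mlCompFirst he (permAct P (mlCompFirst hn F G) (blockSwap (n + 1) 1 (b + 1) (by omega))) H w =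
      (((k + ∑ i : Fin (c + 1), ((ε ⟨i.val, by omega⟩).val : ℤ)) *
        (∑ i : Fin (b + 1), ((ε ⟨c + 1 + i.val, by omega⟩).val : ℤ))).negOnePow : ℤ) •
      F (Fin.cons (G fun i => w ⟨c + 1 + i.val, by omega⟩)
        (Fin.cons (H fun i => w ⟨i.val, by omega⟩)
          (fun i => w ⟨c + 1 + (b + 1) + i.val, by omega⟩))) := by
  have hw1 : HasParity P (fun l => ε (restVertex he l)) (fun l => w (restVertex he l)) :=
    fun t => hw _
  have hw2 : HasParity P (fun l => ε (insertVertex he l)) (fun l => w (insertVertex he l)) :=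
    fun t => hw _
  have hw3 := hasParity_cons hw1 (hH.apply_fin hw2)
  -- The block swap carries the value of `H`, in slot `0`, past the `b + 1` inputs of `G`. The sign
  -- pairs the parity of that value, `k` plus the parities of the inputs of `H`, with the total
  -- parity of the inputs of `G`.
  rw [mlCompFirst_apply, MultilinearMap.curryLeft_apply, permAct_apply _ _ hw3,
    koszulSign_blockSwap, Fin.sum_univ_one]
  have e1 : ∀ j : Fin (b + 1), (⟨1 + j.val, by omega⟩ : Fin (n + 1)) =
      Fin.succ ⟨j.val, by omega⟩ := fun j => Fin.ext (by simp [add_comm])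
  simp only [e1, Fin.cons_succ]
  have e2 : (⟨(0 : Fin 1).val, by omega⟩ : Fin (n + 1)) = 0 := rfl
  rw [e2, Fin.cons_zero, neg_one_pow_parityFin_mul, mlCompFirst_apply,
    MultilinearMap.curryLeft_apply]
  push_cast
  congr 2
  rw [blockSwap_inv]
  funext t
  refine Fin.cases ?_ (fun t => ?_) t
  · simp only [Fin.cons_zero]
    congr 1
    funext i
    have : blockSwap (n + 1) (b + 1) 1 (by omega) (insertVertex hn i) =
        Fin.succ ⟨i.val, by omega⟩ := by
      refine Fin.ext ?_
      rw [blockSwap_val, if_pos (by exact i.2)]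
      rfl
    rw [this, Fin.cons_succ]
    rfl
  · simp only [Fin.cons_succ]
    refine Fin.cases ?_ (fun t => ?_) t
    · have : blockSwap (n + 1) (b + 1) 1 (by omega) (restVertex hn 0) = 0 := by
        refine Fin.ext ?_
        rw [blockSwap_val]
        simp [restVertex]
      rw [this]
      rfl
    · have : blockSwap (n + 1) (b + 1) 1 (by omega) (restVertex hn t.succ) =
          Fin.succ ⟨b + 1 + t.val, by omega⟩ := by
        refine Fin.ext ?_
        rw [blockSwap_val]
        have h1 : (restVertex hn t.succ).val = b + 1 + (t.val + 1) := rfl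
        rw [h1, if_neg (by omega), if_neg (by omega), Fin.val_succ]
        exact (add_assoc _ _ _).symm
      rw [this, Fin.cons_succ, Fin.cons_succ]
      congr 1
      refine Fin.ext ?_
      simp [restVertex]
      omega

theorem IsSymm.swap_zero_one {P : W →ₗ[ℝ] W} {a : ℕ}
    {F : MultilinearMap ℝ (fun _ : Fin (a + 1 + 1) => W) W} (hF : IsSymm P F) {x y : W}
    {z : Fin a → W} {α β : ℤ} {ε : Fin a → Fin 2} (hx : P x = (α.negOnePow : ℤ) • x)
    (hy : P y = (β.negOnePow : ℤ) • y) (hz : HasParity P ε z) :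
    F (Fin.cons x (Fin.cons y z)) = ((α * β).negOnePow : ℤ) • F (Fin.cons y (Fin.cons x z)) := by
  rw [← neg_one_pow_parityFin] at hx hy
  have hw := hasParity_cons (hasParity_cons hz hy) hx
  conv_lhs => rw [← hF (Equiv.swap (0 : Fin (a + 1)).castSucc (0 : Fin (a + 1)).succ)]
  rw [permAct_apply _ _ hw, koszulSign_swap_succ, swap_castSucc_succ_inv]
  congr 1
  · have : ((Fin.cons (parityFin α) (Fin.cons (parityFin β) ε : Fin (a + 1) → Fin 2) :
      Fin (a + 1 + 1) → Fin 2) (0 : Fin (a + 1)).succ).val = (parityFin β).val := rfl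
    have h2 : ((Fin.cons (parityFin α) (Fin.cons (parityFin β) ε : Fin (a + 1) → Fin 2) :
      Fin (a + 1 + 1) → Fin 2) (0 : Fin (a + 1)).castSucc).val = (parityFin α).val := rfl
    rw [this, h2, neg_one_pow_parityFin_mul]
    refine negOnePow_eq_of_even_sub ?_
    unfold parityFin
    split_ifs with h
    · simpa using h.mul_left α
    · rw [Int.not_even_iff_odd] at h
      obtain ⟨t, rfl⟩ := h
      exact ⟨-(α * t), by simp; ring⟩
  · congr 1
    funext t
    refine Fin.cases ?_ (fun t => ?_) t
    · simp
    · refine Fin.cases ?_ (fun t => ?_) t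
      · simp
      · rw [Equiv.swap_apply_of_ne_of_ne]
        · rfl
        · simp [Fin.ext_iff]
        · simp [Fin.ext_iff]

/-- On both sides the values of `G` and `H` occupy the first two slots of `F`. Symmetry of `F`
exchanges them, and the exchange of their inputs is a block swap absorbed by `symmetrize`. The
Koszul signs of the inputs cancel, leaving the sign of exchanging the maps themselves. -/
theorem symmetrize_nest_comm {P : W →ₗ[ℝ] W} (hP : ∀ w, P (P w) = w)
    {a b c n n' e : ℕ} (hn : a + 1 + b = n) (he : n + c = e) (hn' : a + 1 + c = n')
    (he' : n' + b = e)
    {F : MultilinearMap ℝ (fun _ : Fin (a + 1 + 1) => W) W} (hF : IsSymm P F)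
    {G : MultilinearMap ℝ (fun _ : Fin (b + 1) => W) W}
    {H : MultilinearMap ℝ (fun _ : Fin (c + 1) => W) W} {j k : ℤ} (hG : MapParity P j G)
    (hH : MapParity P k H) :
    symmetrize P (mlCompFirst he
        (permAct P (mlCompFirst hn F G) (blockSwap (n + 1) 1 (b + 1) (by omega))) H) =
      ((j * k).negOnePow : ℤ) • symmetrize P (mlCompFirst he'
        (permAct P (mlCompFirst hn' F H) (blockSwap (n' + 1) 1 (c + 1) (by omega))) G) := by
  rw [← symmetrize_permAct hP (mlCompFirst he' _ G)
    (blockSwap (e + 1) (c + 1) (b + 1) (by omega)), ← map_zsmul]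
  congr 1
  refine multilinear_ext_parity hP fun ε w hw => ?_
  have hw' : HasParity P (fun l => ε ((blockSwap (e + 1) (c + 1) (b + 1) (by omega))⁻¹ l))
      (fun l => w ((blockSwap (e + 1) (c + 1) (b + 1) (by omega))⁻¹ l)) := fun t => hw _
  rw [smul_apply, permAct_apply _ _ hw, mlCompFirst_permAct_blockSwap_apply hn he F G H hH hw,
    mlCompFirst_permAct_blockSwap_apply hn' he' F H G hG hw']
  have e1 : ∀ i : Fin (b + 1), blockSwap (e + 1) (b + 1) (c + 1) (by omega) ⟨i.val, by omega⟩ =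
      ⟨c + 1 + i.val, by omega⟩ := fun i => Fin.ext (by
    rw [blockSwap_val, if_pos (by exact i.2)]; exact add_comm _ _)
  have e2 : ∀ i : Fin (c + 1), blockSwap (e + 1) (b + 1) (c + 1) (by omega)
      ⟨b + 1 + i.val, by omega⟩ = ⟨i.val, by omega⟩ := fun i => Fin.ext (by
    have := i.2; rw [blockSwap_val]; dsimp only; split_ifs <;> omega)
  have e3 : ∀ i : Fin a, blockSwap (e + 1) (b + 1) (c + 1) (by omega)
      ⟨b + 1 + (c + 1) + i.val, by omega⟩ = ⟨c + 1 + (b + 1) + i.val, by omega⟩ :=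
    fun i => Fin.ext (by
      have := i.2; rw [blockSwap_val]; dsimp only; split_ifs <;> omega)
  simp only [blockSwap_inv, e1, e2, e3]
  have hx : HasParity P (fun i : Fin (b + 1) => ε ⟨c + 1 + i.val, by omega⟩)
      (fun i => w ⟨c + 1 + i.val, by omega⟩) := fun t => hw _
  have hy : HasParity P (fun i : Fin (c + 1) => ε ⟨i.val, by omega⟩)
      (fun i => w ⟨i.val, by omega⟩) := fun t => hw _
  have hz : HasParity P (fun i : Fin a => ε ⟨c + 1 + (b + 1) + i.val, by omega⟩)
      (fun i => w ⟨c + 1 + (b + 1) + i.val, by omega⟩) := fun t => hw _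
  rw [hF.swap_zero_one (hG.apply hx) (hH.apply hy) hz, koszulSign_blockSwap, smul_smul, smul_smul,
    smul_smul, ← negOnePow_natCast, ← negOnePow_cast_mul, ← negOnePow_cast_mul,
    ← negOnePow_cast_mul]
  congr 1
  refine negOnePow_eq_of_even_sub ?_
  push_cast
  generalize ∑ i : Fin (c + 1), ((ε ⟨i.val, by omega⟩).val : ℤ) = Y
  generalize ∑ i : Fin (b + 1), ((ε ⟨c + 1 + i.val, by omega⟩).val : ℤ) = X
  exact ⟨(k * X + 0), by ring⟩

end SymmComp

/-! ### The pre-Lie identity for the sign-free product -/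

theorem sum_antidiagonal_assoc {M : Type} [AddCommMonoid M] (f : ℕ → ℕ → ℕ → M) (e : ℕ) :
    ∑ nc ∈ Finset.HasAntidiagonal.antidiagonal e, ∑ ab ∈ Finset.HasAntidiagonal.antidiagonal nc.1, f ab.1 ab.2 nc.2 =
      ∑ am ∈ Finset.HasAntidiagonal.antidiagonal e, ∑ bc ∈ Finset.HasAntidiagonal.antidiagonal am.2, f am.1 bc.1 bc.2 := by
  rw [Finset.sum_sigma', Finset.sum_sigma']
  refine Finset.sum_nbij' (fun x => ⟨(x.2.1, x.2.2 + x.1.2), (x.2.2, x.1.2)⟩)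
    (fun x => ⟨(x.1.1 + x.2.1, x.2.2), (x.1.1, x.2.1)⟩) ?_ ?_ ?_ ?_ ?_
  · rintro ⟨⟨n, c⟩, ⟨a, b⟩⟩ hx
    simp only [Finset.mem_sigma, Finset.HasAntidiagonal.mem_antidiagonal] at hx ⊢
    obtain ⟨rfl, rfl⟩ := hx
    exact ⟨(add_assoc _ _ _).symm, trivial⟩
  · rintro ⟨⟨n, c⟩, ⟨a, b⟩⟩ hx
    simp only [Finset.mem_sigma, Finset.HasAntidiagonal.mem_antidiagonal] at hx ⊢
    obtain ⟨rfl, rfl⟩ := hx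
    exact ⟨add_assoc _ _ _, trivial⟩
  · rintro ⟨⟨n, c⟩, ⟨a, b⟩⟩ hx
    simp only [Finset.mem_sigma, Finset.HasAntidiagonal.mem_antidiagonal] at hx ⊢
    obtain ⟨rfl, rfl⟩ := hx
    rfl
  · rintro ⟨⟨n, c⟩, ⟨a, b⟩⟩ hx
    simp only [Finset.mem_sigma, Finset.HasAntidiagonal.mem_antidiagonal] at hx ⊢
    obtain ⟨rfl, rfl⟩ := hx
    rfl
  · intro _ _; rfl

section SymmComp

variable {W : Type} [AddCommGroup W] [Module ℝ W]

/-- The composition `∘₁`, extended by zero to all arities. -/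
def mlCompD {a b : ℕ} (c : ℕ) (f : MultilinearMap ℝ (fun _ : Fin (a + 1) => W) W)
    (g : MultilinearMap ℝ (fun _ : Fin (b + 1) => W) W) :
    MultilinearMap ℝ (fun _ : Fin (c + 1) => W) W :=
  if h : a + b = c then mlCompFirst h f g else 0

theorem mlCompD_eq {a b c : ℕ} (h : a + b = c)
    (f : MultilinearMap ℝ (fun _ : Fin (a + 1) => W) W)
    (g : MultilinearMap ℝ (fun _ : Fin (b + 1) => W) W) :
    mlCompD c f g = mlCompFirst h f g := dif_pos h

/-- The sign-free analogue of the Nijenhuis–Richardson product, for symmetric maps. -/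
def symComp (P : W →ₗ[ℝ] W) (F G : MLSeq W) : MLSeq W := fun c =>
  ∑ ab ∈ (Finset.HasAntidiagonal.antidiagonal c).attach, ∑ σ ∈ unshuffles (ab.1.2 + 1) (c + 1),
    permAct P
      (mlCompFirst (Finset.HasAntidiagonal.mem_antidiagonal.mp ab.2) (F ab.1.1) (G ab.1.2)) σ

/-- Sequences of graded symmetric maps of parity `m`. -/
def IsSymmSeq (P : W →ₗ[ℝ] W) (m : ℤ) (F : MLSeq W) : Prop :=
  ∀ a, IsSymm P (F a) ∧ MapParity P m (F a)

/-- Symmetry of `F` and `G` makes every summand constant on the cosets of block permutations, so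
`sum_unshuffles` applies. -/
theorem symComp_apply {P : W →ₗ[ℝ] W} (hP : ∀ w, P (P w) = w) {i j : ℤ} {F G : MLSeq W}
    (hF : IsSymmSeq P i F) (hG : IsSymmSeq P j G) (c : ℕ) :
    symComp P F G c = ∑ ab ∈ Finset.HasAntidiagonal.antidiagonal c,
      ((((ab.2 + 1).factorial * ab.1.factorial : ℕ) : ℝ)⁻¹) •
        symmetrize P (mlCompD c (F ab.1) (G ab.2)) := by
  rw [symComp, ← Finset.sum_attach (Finset.HasAntidiagonal.antidiagonal c)]
  refine Finset.sum_congr rfl fun ab _ => ?_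
  have h := Finset.HasAntidiagonal.mem_antidiagonal.mp ab.2
  rw [mlCompD_eq h, symmetrize_apply]
  refine sum_unshuffles h _ fun τ σ => ?_
  rw [permAct_mul hP,
    permAct_mlCompFirst_blockPerm hP h (hF _).1 (hG _).1 (hG _).2]

theorem mapParity_of_homogeneous {P : W →ₗ[ℝ] W} (hP : ∀ w, P (P w) = w) {N : ℕ} {m : ℤ}
    {g : MultilinearMap ℝ (fun _ : Fin N => W) W}
    (h : ∀ (e : Fin N → Fin 2) (w : Fin N → W), HasParity P e w →
      P (g w) = ((m + ∑ t, ((e t).val : ℤ)).negOnePow : ℤ) • g w) : MapParity P m g := by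
  have key : P.compMultilinearMap g = (m.negOnePow : ℤ) • g.compLinearMap fun _ => P := by
    refine multilinear_ext_parity hP fun e w hw => ?_
    have h1 : (fun t => P (w t)) = fun t => ((-1 : ℝ) ^ (e t).val) • w t := by
      funext t
      rw [hw t, ← Int.cast_smul_eq_zsmul ℝ]
      simp
    rw [LinearMap.compMultilinearMap_apply, h e w hw, smul_apply,
      MultilinearMap.compLinearMap_apply, h1, g.map_smul_univ, Finset.prod_pow_eq_pow_sum,
      negOnePow_cast_mul, mul_smul, ← Nat.cast_sum, negOnePow_natCast,
      ← Int.cast_smul_eq_zsmul ℝ ((-1) ^ _)]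
    simp
  intro w
  exact congrArg (fun θ => θ w) key

theorem MapParity.permAct {P : W →ₗ[ℝ] W} (hP : ∀ w, P (P w) = w) {N : ℕ} {m : ℤ}
    {g : MultilinearMap ℝ (fun _ : Fin N => W) W} (hg : MapParity P m g) (σ) :
    MapParity P m (permAct P g σ) := by
  refine mapParity_of_homogeneous hP fun e w hw => ?_
  have hw' : HasParity P (fun l => e (σ⁻¹ l)) (fun l => w (σ⁻¹ l)) := fun t => hw _
  rw [permAct_apply _ _ hw, map_zsmul, hg.apply hw', smul_comm]
  congr 3
  exact congrArg (m + ·) (Equiv.sum_comp σ⁻¹ fun t => ((e t).val : ℤ))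

theorem MapParity.sum {P : W →ₗ[ℝ] W} {N : ℕ} {m : ℤ} {ι : Type} {s : Finset ι}
    {g : ι → MultilinearMap ℝ (fun _ : Fin N => W) W} (hg : ∀ i ∈ s, MapParity P m (g i)) :
    MapParity P m (∑ i ∈ s, g i) := by
  intro w
  rw [sum_apply, sum_apply, map_sum, Finset.smul_sum]
  exact Finset.sum_congr rfl fun i hi => hg i hi w

theorem MapParity.mlCompFirst {P : W →ₗ[ℝ] W} {a b c : ℕ} (h : a + b = c) {i j : ℤ}
    {f : MultilinearMap ℝ (fun _ : Fin (a + 1) => W) W}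
    {g : MultilinearMap ℝ (fun _ : Fin (b + 1) => W) W} (hf : MapParity P i f)
    (hg : MapParity P j g) : MapParity P (i + j) (mlCompFirst h f g) := by
  intro w
  have h1 : (fun t => P ((Fin.cons (g fun i => w (insertVertex h i))
      (fun i => w (restVertex h i)) : Fin (a + 1) → W) t)) =
      Fin.cons ((j.negOnePow : ℤ) • g fun i => P (w (insertVertex h i)))
        (fun i => P (w (restVertex h i))) := by
    funext t
    refine Fin.cases ?_ (fun t => ?_) t
    · rw [Fin.cons_zero, Fin.cons_zero, hg]
    · rfl
  rw [mlCompFirst_apply, mlCompFirst_apply, MultilinearMap.curryLeft_apply, hf, h1,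
    ← MultilinearMap.curryLeft_apply, map_zsmul, smul_apply, smul_smul, negOnePow_cast_mul]

theorem IsSymmSeq.symComp {P : W →ₗ[ℝ] W} (hP : ∀ w, P (P w) = w) {i j : ℤ} {F G : MLSeq W}
    (hF : IsSymmSeq P i F) (hG : IsSymmSeq P j G) : IsSymmSeq P (i + j) (symComp P F G) := by
  intro c
  constructor
  · intro σ
    rw [symComp_apply hP hF hG, permAct_sum]
    refine Finset.sum_congr rfl fun ab _ => ?_
    rw [permAct_smul, permAct_symmetrize hP]
  · exact MapParity.sum fun ab _ => MapParity.sum fun σ _ =>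
      ((hF _).2.mlCompFirst _ (hG _).2).permAct hP σ

/-- `G` and `H` nested in two different arguments of `F`. -/
def nestTerm (P : W →ₗ[ℝ] W) (F G H : MLSeq W) (e a b c : ℕ) :
    MultilinearMap ℝ (fun _ : Fin (e + 1) => W) W :=
  if h : 0 < a ∧ a + b + c = e then
    -- The factor `a` counts the arguments of `F` besides the one taken by `G`, any of which can
    -- receive `H`; it comes from the second double coset.
    (a : ℝ) • ((((c + 1).factorial * (b + 1).factorial * a.factorial : ℕ) : ℝ)⁻¹) •
      symmetrize P (mlCompFirst h.2 (permAct P (mlCompFirst rfl (F a) (G b))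
        (blockSwap (a + b + 1) 1 (b + 1) (by omega))) (H c))
  else 0

theorem nestTerm_comm {P : W →ₗ[ℝ] W} (hP : ∀ w, P (P w) = w) {i j k : ℤ} {F G H : MLSeq W}
    (hF : IsSymmSeq P i F) (hG : IsSymmSeq P j G) (hH : IsSymmSeq P k H) (e a b c : ℕ) :
    nestTerm P F G H e a b c = ((j * k).negOnePow : ℤ) • nestTerm P F H G e a c b := by
  unfold nestTerm
  by_cases h : 0 < a ∧ a + b + c = e
  · rw [dif_pos h, dif_pos (by omega)]
    obtain ⟨a, rfl⟩ : ∃ a', a = a' + 1 := ⟨a - 1, by omega⟩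
    rw [symmetrize_nest_comm hP rfl h.2 rfl (by omega) (hF _).1 (hG _).2 (hH _).2,
      smul_comm _ ((j * k).negOnePow : ℤ), smul_comm _ ((j * k).negOnePow : ℤ),
      mul_comm (c + 1).factorial]
  · rw [dif_neg h, dif_neg (by omega), smul_zero]

/-- `H` nested in `G` and `G` in `F`. -/
def chainTerm (P : W →ₗ[ℝ] W) (F G H : MLSeq W) (e a b c : ℕ) :
    MultilinearMap ℝ (fun _ : Fin (e + 1) => W) W :=
  ((((c + 1).factorial * b.factorial * a.factorial : ℕ) : ℝ)⁻¹) •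
    symmetrize P (mlCompD e (F a) (mlCompD (b + c) (G b) (H c)))

/-- Absorbing the inner symmetrization costs `(m+1)!`, which cancels the same factorial in the outer
normalisation. -/
theorem symComp_symComp_right {P : W →ₗ[ℝ] W} (hP : ∀ w, P (P w) = w) {i j k : ℤ}
    {F G H : MLSeq W} (hF : IsSymmSeq P i F) (hG : IsSymmSeq P j G) (hH : IsSymmSeq P k H)
    (e : ℕ) :
    symComp P F (symComp P G H) e =
      ∑ am ∈ Finset.HasAntidiagonal.antidiagonal e, ∑ bc ∈ Finset.HasAntidiagonal.antidiagonal am.2,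
        chainTerm P F G H e am.1 bc.1 bc.2 := by
  rw [symComp_apply hP hF (hG.symComp hP hH)]
  refine Finset.sum_congr rfl ?_
  rintro ⟨a, m⟩ ham
  rw [Finset.HasAntidiagonal.mem_antidiagonal] at ham
  dsimp only at ham ⊢
  rw [mlCompD_eq ham, symComp_apply hP hG hH, ← mlCompFirstₗ_apply, map_sum, map_sum,
    Finset.smul_sum]
  refine Finset.sum_congr rfl ?_
  rintro ⟨b, c⟩ hbc
  rw [Finset.HasAntidiagonal.mem_antidiagonal] at hbc
  dsimp only at hbc ⊢
  subst hbc
  rw [map_smul, map_smul, mlCompFirstₗ_apply, symmetrize_mlCompFirst_symmetrize_right hP,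
    chainTerm, mlCompD_eq ham, smul_smul, smul_smul]
  congr 1
  have h1 : ((b + c + 1).factorial : ℝ) ≠ 0 := by positivity
  have h2 : ((c + 1).factorial : ℝ) ≠ 0 := by positivity
  have h3 : (b.factorial : ℝ) ≠ 0 := by positivity
  have h4 : (a.factorial : ℝ) ≠ 0 := by positivity
  push_cast
  field_simp

/-- The two double cosets of `symmetrize_mlCompFirst_symmetrize_left` give the two kinds of terms.
In the first, `mlCompFirst_assoc` turns `(F ∘₁ G) ∘₁ H` into `F ∘₁ (G ∘₁ H)`, and the count `b + 1`
reduces `(b+1)!` to `b!`. -/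
theorem symComp_symComp_left {P : W →ₗ[ℝ] W} (hP : ∀ w, P (P w) = w) {i j k : ℤ}
    {F G H : MLSeq W} (hF : IsSymmSeq P i F) (hG : IsSymmSeq P j G) (hH : IsSymmSeq P k H)
    (e : ℕ) :
    symComp P (symComp P F G) H e =
      ∑ nc ∈ Finset.HasAntidiagonal.antidiagonal e, ∑ ab ∈ Finset.HasAntidiagonal.antidiagonal nc.1,
        (chainTerm P F G H e ab.1 ab.2 nc.2 + nestTerm P F G H e ab.1 ab.2 nc.2) := by
  rw [symComp_apply hP (hF.symComp hP hG) hH]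
  refine Finset.sum_congr rfl ?_
  rintro ⟨n, c⟩ hnc
  rw [Finset.HasAntidiagonal.mem_antidiagonal] at hnc
  dsimp only at hnc ⊢
  have h2 : mlCompD e (symComp P F G n) (H c) = ∑ ab ∈ Finset.HasAntidiagonal.antidiagonal n,
      ((((ab.2 + 1).factorial * ab.1.factorial : ℕ) : ℝ)⁻¹) • mlCompFirst hnc
        (symmetrize P (mlCompD n (F ab.1) (G ab.2))) (H c) := by
    rw [mlCompD_eq hnc, symComp_apply hP hF hG]
    refine (map_sum ((mlCompFirstₗ W hnc).flip (H c)) _ _).trans ?_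
    refine Finset.sum_congr rfl fun ab _ => ?_
    exact map_smul ((mlCompFirstₗ W hnc).flip (H c)) _ _
  rw [h2, map_sum, Finset.smul_sum]
  refine Finset.sum_congr rfl ?_
  rintro ⟨a, b⟩ hab
  rw [Finset.HasAntidiagonal.mem_antidiagonal] at hab
  dsimp only at hab ⊢
  subst hab
  have hθ := permAct_mlCompFirst_blockPerm hP (rfl : a + b = a + b) (hF a).1 (hG b).1 (hG b).2
  have h3 : ((c + 1).factorial : ℝ) ≠ 0 := by positivity
  have h4 : (b.factorial : ℝ) ≠ 0 := by positivity
  have h5 : (a.factorial : ℝ) ≠ 0 := by positivity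
  have h6 : ((a + b).factorial : ℝ) ≠ 0 := by positivity
  have h7 : ((b + 1).factorial : ℝ) = (b + 1) * b.factorial := by
    rw [Nat.factorial_succ]; push_cast; ring
  have h8 : (b + 1 : ℝ) ≠ 0 := by positivity
  rw [map_smul, mlCompD_eq rfl, chainTerm, mlCompD_eq (by omega : a + (b + c) = e),
    mlCompD_eq rfl, ← mlCompFirst_assoc rfl hnc]
  by_cases ha : 0 < a
  · rw [symmetrize_mlCompFirst_symmetrize_left hP rfl hnc _ hθ (H c) (hH c).2
      (blockSwap (a + b + 1) 1 (b + 1) (by omega)) (fun _ => Fin.ext (by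
        rw [blockSwap_val]; simp [restVertex])), nestTerm, dif_pos ⟨ha, hnc⟩, smul_add, smul_add,
      smul_smul, smul_smul, smul_smul, smul_smul, smul_smul]
    congr 2
    · push_cast
      rw [h7]
      field_simp
    · push_cast
      rw [h7]
      field_simp
  -- With no further argument of `F` the second double coset is empty, and the representative `1` is
  -- a dummy with coefficient `0`.
  · obtain rfl : a = 0 := by omega
    rw [symmetrize_mlCompFirst_symmetrize_left hP rfl hnc _ hθ (H c) (hH c).2 1
      (fun h => absurd h ha), nestTerm, dif_neg (fun h => ha h.1)]
    simp only [zero_mul, Nat.cast_zero, zero_smul, add_zero, smul_smul]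
    congr 1
    push_cast
    rw [h7, zero_add]
    field_simp

/-- The chain terms cancel in the associator; what is left has `G` and `H` in different arguments of
`F` and is graded symmetric by `nestTerm_comm`. -/
theorem symComp_preLie {P : W →ₗ[ℝ] W} (hP : ∀ w, P (P w) = w) {i j k : ℤ}
    {F G H : MLSeq W} (hF : IsSymmSeq P i F) (hG : IsSymmSeq P j G) (hH : IsSymmSeq P k H) :
    symComp P (symComp P F G) H - symComp P F (symComp P G H) = ((j * k).negOnePow : ℤ) •
      (symComp P (symComp P F H) G - symComp P F (symComp P H G)) := by
  have h1 : ∀ {j k : ℤ} {G H : MLSeq W} (hG : IsSymmSeq P j G) (hH : IsSymmSeq P k H) (e : ℕ),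
      (symComp P (symComp P F G) H - symComp P F (symComp P G H)) e =
      ∑ am ∈ Finset.HasAntidiagonal.antidiagonal e, ∑ bc ∈ Finset.HasAntidiagonal.antidiagonal am.2,
        nestTerm P F G H e am.1 bc.1 bc.2 := by
    intro j k G H hG hH e
    rw [Pi.sub_apply, symComp_symComp_left hP hF hG hH, symComp_symComp_right hP hF hG hH,
      sum_antidiagonal_assoc (fun a b c => chainTerm P F G H e a b c + nestTerm P F G H e a b c),
      ← Finset.sum_sub_distrib]
    refine Finset.sum_congr rfl fun am _ => ?_
    rw [← Finset.sum_sub_distrib]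
    exact Finset.sum_congr rfl fun bc _ => add_sub_cancel_left _ _
  funext e
  rw [Pi.smul_apply, h1 hG hH, h1 hH hG, Finset.smul_sum]
  refine Finset.sum_congr rfl fun am _ => ?_
  rw [← Finset.Nat.sum_antidiagonal_swap, Finset.smul_sum]
  exact Finset.sum_congr rfl fun bc _ => nestTerm_comm hP hF hG hH _ _ _ _

end SymmComp

/-! ### The Lie bracket of symmetric sequences -/

section SymmBracket

variable {W : Type} [AddCommGroup W] [Module ℝ W]

/-- The product of symmetric sequences as a bilinear map. -/
def symCompₗ (P : W →ₗ[ℝ] W) : MLSeq W →ₗ[ℝ] MLSeq W →ₗ[ℝ] MLSeq W :=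
  LinearMap.mk₂ ℝ (symComp P)
    (fun f f' g => by
      funext c
      simp only [symComp, Pi.add_apply, ← mlCompFirstₗ_apply, map_add, LinearMap.add_apply,
        permAct_add, Finset.sum_add_distrib])
    (fun r f g => by
      funext c
      simp only [symComp, Pi.smul_apply, ← mlCompFirstₗ_apply, map_smul, LinearMap.smul_apply,
        permAct_smul, Finset.smul_sum])
    (fun f g g' => by
      funext c
      simp only [symComp, Pi.add_apply, ← mlCompFirstₗ_apply, map_add,
        permAct_add, Finset.sum_add_distrib])
    (fun r f g => by
      funext c
      simp only [symComp, Pi.smul_apply, ← mlCompFirstₗ_apply, map_smul,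
        permAct_smul, Finset.smul_sum])

theorem symCompₗ_apply (P : W →ₗ[ℝ] W) (F G : MLSeq W) : symCompₗ P F G = symComp P F G := rfl

/-- The graded commutator. -/
def symBracket (P : W →ₗ[ℝ] W) (i j : ℤ) (F G : MLSeq W) : MLSeq W :=
  symComp P F G - ((i * j).negOnePow : ℤ) • symComp P G F

theorem isSymmSeq_of_eq {P : W →ₗ[ℝ] W} {i j : ℤ} {F : MLSeq W} (hF : IsSymmSeq P i F)
    (h : i = j) : IsSymmSeq P j F := h ▸ hF

theorem IsSymmSeq.sub {P : W →ₗ[ℝ] W} {i : ℤ} {F G : MLSeq W} (hF : IsSymmSeq P i F)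
    (hG : IsSymmSeq P i G) : IsSymmSeq P i (F - G) := fun a =>
  ⟨fun σ => by
    rw [Pi.sub_apply, ← permActₗ_apply, map_sub, permActₗ_apply, permActₗ_apply, (hF a).1,
      (hG a).1],
   fun w => by
    rw [Pi.sub_apply, sub_apply, sub_apply, map_sub, (hF a).2, (hG a).2, smul_sub]⟩

theorem IsSymmSeq.zsmul {P : W →ₗ[ℝ] W} {i : ℤ} {F : MLSeq W} (hF : IsSymmSeq P i F) (c : ℤ) :
    IsSymmSeq P i (c • F) := fun a =>
  ⟨fun σ => by rw [Pi.smul_apply, permAct_zsmul, (hF a).1],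
   fun w => by rw [Pi.smul_apply, smul_apply, smul_apply, map_zsmul, (hF a).2, smul_comm]⟩

theorem IsSymmSeq.symBracket {P : W →ₗ[ℝ] W} (hP : ∀ w, P (P w) = w) {i j : ℤ} {F G : MLSeq W}
    (hF : IsSymmSeq P i F) (hG : IsSymmSeq P j G) : IsSymmSeq P (i + j) (symBracket P i j F G) :=
  (hF.symComp hP hG).sub ((isSymmSeq_of_eq (hG.symComp hP hF) (add_comm _ _)).zsmul _)

theorem negOnePow_eq_one_or (m : ℤ) : (m.negOnePow : ℤ) = 1 ∨ (m.negOnePow : ℤ) = -1 := by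
  rcases Int.even_or_odd m with h | h
  · left; simp [Int.negOnePow_even m h]
  · right; simp [Int.negOnePow_odd m h]

/-- The Jacobi identity of a graded pre-Lie commutator. The twelve iterated products become free
variables, three instances of the pre-Lie identity eliminate three of them, and the rest is linear
algebra for each choice of the three signs. -/
theorem symBracket_jacobi {P : W →ₗ[ℝ] W} (hP : ∀ w, P (P w) = w) {i j k : ℤ}
    {F G H : MLSeq W} (hF : IsSymmSeq P i F) (hG : IsSymmSeq P j G) (hH : IsSymmSeq P k H) :
    symBracket P i (j + k) F (symBracket P j k G H) =
      symBracket P (i + j) k (symBracket P i j F G) H +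
        ((i * j).negOnePow : ℤ) • symBracket P j (i + k) G (symBracket P i k F H) := by
  have h1 := symComp_preLie hP hF hG hH
  have h2 := symComp_preLie hP hG hF hH
  have h3 := symComp_preLie hP hH hF hG
  simp only [symBracket, mul_add, add_mul, negOnePow_cast_mul, ← symCompₗ_apply, map_sub,
    map_zsmul, LinearMap.sub_apply, LinearMap.smul_apply] at h1 h2 h3 ⊢
  generalize symCompₗ P F (symCompₗ P G H) = t1 at *
  generalize symCompₗ P F (symCompₗ P H G) = t2 at *
  generalize symCompₗ P G (symCompₗ P F H) = t3 at *
  generalize symCompₗ P G (symCompₗ P H F) = t4 at *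
  generalize symCompₗ P H (symCompₗ P F G) = t5 at *
  generalize symCompₗ P H (symCompₗ P G F) = t6 at *
  generalize symCompₗ P (symCompₗ P F G) H = u1 at *
  generalize symCompₗ P (symCompₗ P F H) G = u2 at *
  generalize symCompₗ P (symCompₗ P G F) H = u3 at *
  generalize symCompₗ P (symCompₗ P G H) F = u4 at *
  generalize symCompₗ P (symCompₗ P H F) G = u5 at *
  generalize symCompₗ P (symCompₗ P H G) F = u6 at *
  have e1 : t1 = u1 - ((j * k).negOnePow : ℤ) • (u2 - t2) := by rw [← h1]; abel
  have e2 : t3 = u3 - ((i * k).negOnePow : ℤ) • (u4 - t4) := by rw [← h2]; abel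
  have e3 : t5 = u5 - ((i * j).negOnePow : ℤ) • (u6 - t6) := by rw [← h3]; abel
  rw [e1, e2, e3, mul_comm j i]
  rcases negOnePow_eq_one_or (i * j) with a | a <;>
  rcases negOnePow_eq_one_or (i * k) with b | b <;>
  rcases negOnePow_eq_one_or (j * k) with c | c <;>
  · rw [a, b, c]
    module

end SymmBracket

/-! ### Suspension -/

section Susp

variable {W : Type} [AddCommGroup W] [Module ℝ W]

/-- Pullback along the `m`-fold suspension. -/
def susp (m : ℕ) (P : W →ₗ[ℝ] W) {a : ℕ} (θ : MultilinearMap ℝ (fun _ : Fin (a + 1) => W) W) :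
    MultilinearMap ℝ (fun _ : Fin (a + 1) => W) W :=
  θ.compLinearMap fun t => P ^ (m * (a - t.val))

theorem parity_pow_apply {P : W →ₗ[ℝ] W} {ε : Fin 2} {x : W}
    (hx : P x = ((-1 : ℤ) ^ ε.val) • x) (k : ℕ) : (P ^ k) x = ((-1 : ℝ) ^ (k * ε.val)) • x := by
  induction k with
  | zero => simp
  | succ k ih =>
    rw [pow_succ', Module.End.mul_apply, ih, map_smul, hx, ← Int.cast_smul_eq_zsmul ℝ, smul_smul,
      add_mul, pow_add]
    simp

theorem parity_pow_parity_pow {P : W →ₗ[ℝ] W} (hP : ∀ w, P (P w) = w) (k : ℕ) (x : W) :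
    (P ^ k) ((P ^ k) x) = x := by
  have : P * P = 1 := LinearMap.ext hP
  rw [← Module.End.mul_apply, ← (Commute.refl P).mul_pow, this, one_pow]
  rfl

/-- As `P` is an involution, the sign operator is its own inverse, so it also serves as the
desuspension. -/
theorem susp_susp {P : W →ₗ[ℝ] W} (hP : ∀ w, P (P w) = w) (m : ℕ) {a : ℕ}
    (θ : MultilinearMap ℝ (fun _ : Fin (a + 1) => W) W) : susp m P (susp m P θ) = θ := by
  ext w
  simp [susp, parity_pow_parity_pow hP]

theorem susp_apply {P : W →ₗ[ℝ] W} (m : ℕ) {a : ℕ}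
    (θ : MultilinearMap ℝ (fun _ : Fin (a + 1) => W) W) {e : Fin (a + 1) → Fin 2}
    {w : Fin (a + 1) → W} (hw : HasParity P e w) :
    susp m P θ w = ((-1 : ℤ) ^ (∑ t : Fin (a + 1), m * (a - t.val) * (e t).val)) • θ w := by
  rw [susp, MultilinearMap.compLinearMap_apply]
  simp only [parity_pow_apply (hw _)]
  rw [θ.map_smul_univ, Finset.prod_pow_eq_pow_sum, ← Int.cast_smul_eq_zsmul ℝ]
  simp

/-- Pullback along the suspension is linear. -/
def suspₗ (m : ℕ) (P : W →ₗ[ℝ] W) (a : ℕ) : MultilinearMap ℝ (fun _ : Fin (a + 1) => W) W →ₗ[ℝ]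
    MultilinearMap ℝ (fun _ : Fin (a + 1) => W) W where
  toFun := susp m P
  map_add' _ _ := rfl
  map_smul' _ _ := rfl

theorem suspₗ_apply (m : ℕ) (P : W →ₗ[ℝ] W) {a : ℕ}
    (θ : MultilinearMap ℝ (fun _ : Fin (a + 1) => W) W) : suspₗ m P a θ = susp m P θ := rfl

theorem HasParity.shift {P : W →ₗ[ℝ] W} {N : ℕ} {e : Fin N → Fin 2} {w : Fin N → W}
    (hw : HasParity P e w) (m : ℕ) :
    HasParity (((-1 : ℝ) ^ m) • P) (fun t => parityFin (m + (e t).val)) w := by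
  intro t
  rw [LinearMap.smul_apply, hw t, neg_one_pow_parityFin, ← Nat.cast_add, negOnePow_natCast,
    ← Int.cast_smul_eq_zsmul ℝ, ← Int.cast_smul_eq_zsmul ℝ, smul_smul, pow_add]
  push_cast
  rfl

theorem shift_involutive {P : W →ₗ[ℝ] W} (hP : ∀ w, P (P w) = w) (m : ℕ) (w : W) :
    (((-1 : ℝ) ^ m) • P) ((((-1 : ℝ) ^ m) • P) w) = w := by
  rw [LinearMap.smul_apply, LinearMap.smul_apply, map_smul, hP, smul_smul, ← mul_pow]
  simp

/-- Neighbouring weights `a - t` differ by one, so the exponent of the suspension sign changes by `m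
(e_{i+1} - e_i)`; the equation is arranged to avoid subtraction in `ℕ`. -/
theorem sum_swap_castSucc_succ (m : ℕ) {a : ℕ} (i : Fin a) (e : Fin (a + 1) → Fin 2) :
    (∑ t : Fin (a + 1), m * (a - t.val) * (e (Equiv.swap i.castSucc i.succ t)).val) +
        m * (e i.castSucc).val =
      (∑ t : Fin (a + 1), m * (a - t.val) * (e t).val) + m * (e i.succ).val := by
  have hne : i.succ ∈ Finset.univ.erase i.castSucc := by simp [Fin.ext_iff]
  rw [← Finset.add_sum_erase _ _ (Finset.mem_univ i.castSucc), ← Finset.add_sum_erase _ _ hne,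
    ← Finset.add_sum_erase Finset.univ (fun t : Fin (a + 1) => m * (a - t.val) * (e t).val)
      (Finset.mem_univ i.castSucc), ← Finset.add_sum_erase _ _ hne,
    Finset.sum_congr rfl (g := fun t : Fin (a + 1) => m * (a - t.val) * (e t).val)]
  · obtain ⟨k, hk⟩ : ∃ k, a = i.val + 1 + k := ⟨a - (i.val + 1), by omega⟩
    have h1 : a - i.val = k + 1 := by omega
    have h2 : a - (i.val + 1) = k := by omega
    simp only [Equiv.swap_apply_left, Equiv.swap_apply_right, Fin.val_castSucc, Fin.val_succ, h1,
      h2]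
    ring
  · intro t ht
    simp only [Finset.mem_erase] at ht
    rw [Equiv.swap_apply_of_ne_of_ne ht.2.1 ht.1]

theorem neg_one_pow_parityFin_mul_parityFin (k l : ℤ) :
    (-1 : ℤ) ^ ((parityFin k).val * (parityFin l).val) = ((k * l).negOnePow : ℤ) := by
  rw [neg_one_pow_parityFin_mul]
  refine negOnePow_eq_of_even_sub ?_
  unfold parityFin
  split_ifs with h
  · simpa using h.mul_left k
  · rw [Int.not_even_iff_odd] at h
    obtain ⟨t, rfl⟩ := h
    exact ⟨-(k * t), by simp; ring⟩

/-- Décalage. An `m`-fold shift replaces the parity operator by `(-1)^m P` and twists the action of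
permutations by `sgn^m`. Checking adjacent transpositions suffices. -/
theorem permAct_susp {P : W →ₗ[ℝ] W} (hP : ∀ w, P (P w) = w) (m : ℕ) {a : ℕ}
    (θ : MultilinearMap ℝ (fun _ : Fin (a + 1) => W) W) (σ : Equiv.Perm (Fin (a + 1))) :
    permAct P (susp m P θ) σ =
      ((Equiv.Perm.sign σ : ℤ) ^ m) • susp m P (permAct (((-1 : ℝ) ^ m) • P) θ σ) := by
  have hP' := shift_involutive hP m
  induction σ using perm_induction_swap_succ with
  | h1 => simp [permAct_one hP, permAct_one hP']
  | hs σ i ih =>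
    rw [permAct_mul hP, ih, permAct_mul hP', permAct_zsmul, Equiv.Perm.sign_mul, Units.val_mul,
      mul_pow, mul_smul]
    congr 1
    clear ih
    generalize permAct (((-1 : ℝ) ^ m) • P) θ σ = θ
    refine multilinear_ext_parity hP fun e w hw => ?_
    have hw' : HasParity P (fun l => e ((Equiv.swap i.castSucc i.succ)⁻¹ l))
      (fun l => w ((Equiv.swap i.castSucc i.succ)⁻¹ l)) := fun t => hw _
    rw [permAct_apply _ _ hw, susp_apply _ _ hw', smul_apply, susp_apply _ _ hw,
      permAct_apply _ _ (hw.shift m), koszulSign_swap_succ, koszulSign_swap_succ,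
      sign_swap_castSucc_succ, smul_smul, smul_smul, smul_smul]
    congr 1
    have hS := sum_swap_castSucc_succ m i e
    rw [swap_castSucc_succ_inv, neg_one_pow_parityFin_mul_parityFin, Units.val_neg, Units.val_one,
      ← pow_add, ← pow_add, ← negOnePow_natCast, ← negOnePow_natCast, ← negOnePow_cast_mul]
    refine negOnePow_eq_of_even_sub ?_
    zify at hS
    push_cast
    generalize ((e i.castSucc).val : ℤ) = x at *
    generalize ((e i.succ).val : ℤ) = y at *
    -- Both exchanged parities are shifted by `m`, which yields `m²` in the Koszul exponent, while
    -- `sgn^m` yields `m`; their sum is even.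
    obtain ⟨r, hr⟩ := Int.even_mul_succ_self (m : ℤ)
    exact ⟨-(m * x) - r, by linear_combination hS - hr⟩

/-- The first slot of the outer map carries `P^(m a)`. Moving it through `g`, of parity `j`, costs
`(-1)^(m a j)`; on the inputs of `g` the weights then add up as `a + (b - i) = c - i`. -/
theorem mlCompFirst_susp {P : W →ₗ[ℝ] W} (m : ℕ) {a b c : ℕ} (h : a + b = c)
    (f : MultilinearMap ℝ (fun _ : Fin (a + 1) => W) W)
    (g : MultilinearMap ℝ (fun _ : Fin (b + 1) => W) W) {j : ℤ}
    (hg : MapParity P j (susp m P g)) :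
    mlCompFirst h (susp m P f) (susp m P g) =
      ((m * a * j).negOnePow : ℤ) • susp m P (mlCompFirst h f g) := by
  have hk : ∀ (k : ℕ) (w : Fin (b + 1) → W), (P ^ k) (susp m P g w) =
      ((k * j).negOnePow : ℤ) • susp m P g (fun t => (P ^ k) (w t)) := by
    intro k
    induction k with
    | zero => simp
    | succ k ih =>
      intro w
      rw [pow_succ, Module.End.mul_apply, hg, map_zsmul, ih, smul_smul, ← negOnePow_cast_mul]
      congr 3
      push_cast; ring
  ext w
  have h1 : (fun t : Fin (a + 1) => (P ^ (m * (a - t.val)))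
      ((Fin.cons (susp m P g fun i => w (insertVertex h i))
        (fun i => w (restVertex h i)) : Fin (a + 1) → W) t)) =
      Fin.cons (((m * a * j).negOnePow : ℤ) •
          g fun i => (P ^ (m * (c - (insertVertex h i).val))) (w (insertVertex h i)))
        (fun i => (P ^ (m * (c - (restVertex h i).val))) (w (restVertex h i))) := by
    funext t
    refine Fin.cases ?_ (fun t => ?_) t
    · rw [Fin.cons_zero, Fin.cons_zero, hk, susp, MultilinearMap.compLinearMap_apply]
      have hi : ∀ i : Fin (b + 1), (P ^ (m * (b - i.val)))
          ((P ^ (m * (a - (0 : Fin (a + 1)).val))) (w (insertVertex h i))) =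
          (P ^ (m * (c - (insertVertex h i).val))) (w (insertVertex h i)) := by
        intro i
        rw [← Module.End.mul_apply, ← pow_add, ← mul_add]
        have : b - i.val + (a - (0 : Fin (a + 1)).val) = c - (insertVertex h i).val := by
          have := i.2
          simp only [insertVertex, Fin.val_zero]; omega
        rw [this]
      simp only [hi]
      simp
    · rw [Fin.cons_succ, Fin.cons_succ]
      have : a - t.succ.val = c - (restVertex h t).val := by
        simp only [restVertex, Fin.val_succ]; omega
      rw [this]
  rw [mlCompFirst_apply, smul_apply, MultilinearMap.curryLeft_apply]
  change f (fun t : Fin (a + 1) => (P ^ (m * (a - t.val))) ((Fin.cons _ _ : Fin (a + 1) → W) t)) =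
    _ • mlCompFirst h f g (fun t => (P ^ (m * (c - t.val))) (w t))
  rw [h1, ← MultilinearMap.curryLeft_apply, map_zsmul, smul_apply, mlCompFirst_apply]

end Susp

/-! ### The dg Lie algebra of cochains -/

section CELie

variable {W : Type} [AddCommGroup W] [Module ℝ W]

/-- The parity operator after a shift of degrees by one. -/
abbrev oppParity (P : W →ₗ[ℝ] W) : W →ₗ[ℝ] W := ((-1 : ℝ) ^ 1) • P

/-- The pieces `A k` span, and `P` is their parity operator. -/
structure IsParityGrading (A : ℤ → Submodule ℝ W) (P : W →ₗ[ℝ] W) : Prop where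
  parity_apply : ∀ k, ∀ w ∈ A k, P w = (k.negOnePow : ℤ) • w
  span_eq_top : Submodule.span ℝ {w | ∃ k, w ∈ A k} = ⊤

theorem IsParityGrading.involutive {A : ℤ → Submodule ℝ W} {P : W →ₗ[ℝ] W}
    (hA : IsParityGrading A P) (w : W) : P (P w) = w := by
  have hw : w ∈ Submodule.span ℝ {w | ∃ k, w ∈ A k} := by rw [hA.span_eq_top]; trivial
  induction hw using Submodule.span_induction with
  | mem w hw =>
    obtain ⟨k, hk⟩ := hw
    rw [hA.parity_apply k w hk, map_zsmul, hA.parity_apply k w hk, smul_smul]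
    rcases negOnePow_eq_one_or k with h | h <;> simp [h]
  | zero => simp
  | add x y _ _ hx hy => rw [map_add, map_add, hx, hy]
  | smul c x _ hx => rw [map_smul, map_smul, hx]

/-- `θ` is homogeneous of degree `m`. -/
def HasDeg (A : ℤ → Submodule ℝ W) {N : ℕ} (m : ℤ) (θ : MultilinearMap ℝ (fun _ : Fin N => W) W) :
    Prop := ∀ (l : Fin N → ℤ) (w : Fin N → W), (∀ t, w t ∈ A (l t)) → θ w ∈ A (∑ t, l t + m)

theorem IsParityGrading.hasParity {A : ℤ → Submodule ℝ W} {P : W →ₗ[ℝ] W}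
    (hA : IsParityGrading A P) {N : ℕ} {l : Fin N → ℤ} {w : Fin N → W}
    (hw : ∀ t, w t ∈ A (l t)) : HasParity P (fun t => parityFin (l t)) w := fun t => by
  rw [neg_one_pow_parityFin]; exact hA.parity_apply _ _ (hw t)

theorem HasDeg.mapParity {A : ℤ → Submodule ℝ W} {P : W →ₗ[ℝ] W} (hA : IsParityGrading A P)
    {N : ℕ} {m : ℤ} {θ : MultilinearMap ℝ (fun _ : Fin N => W) W} (hθ : HasDeg A m θ) :
    MapParity P m θ := by
  have key : P.compMultilinearMap θ = (m.negOnePow : ℤ) • θ.compLinearMap fun _ => P := by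
    refine multilinear_ext_span hA.span_eq_top fun w hw => ?_
    choose l hl using hw
    have h1 : (fun t => P (w t)) = fun t => (((l t).negOnePow : ℤ) : ℝ) • w t := by
      funext t
      rw [hA.parity_apply _ _ (hl t), Int.cast_smul_eq_zsmul]
    have h2 : ∏ t, (((l t).negOnePow : ℤ) : ℝ) = (((∑ t, l t).negOnePow : ℤ) : ℝ) := by
      rw [← Int.cast_prod]
      congr 1
      induction (Finset.univ : Finset (Fin N)) using Finset.induction_on with
      | empty => simp
      | insert a s ha ih => rw [Finset.prod_insert ha, Finset.sum_insert ha, ih, negOnePow_cast_mul]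
    rw [LinearMap.compMultilinearMap_apply, hA.parity_apply _ _ (hθ l w hl), smul_apply,
      MultilinearMap.compLinearMap_apply, h1, θ.map_smul_univ, h2, Int.cast_smul_eq_zsmul,
      smul_smul, ← negOnePow_cast_mul, add_comm]
  intro w
  exact congrArg (fun θ => θ w) key

theorem HasDeg.permAct {A : ℤ → Submodule ℝ W} {P : W →ₗ[ℝ] W} (hA : IsParityGrading A P)
    {N : ℕ} {m : ℤ} {θ : MultilinearMap ℝ (fun _ : Fin N => W) W} (hθ : HasDeg A m θ) (σ) :
    HasDeg A m (permAct P θ σ) := by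
  intro l w hw
  rw [permAct_apply _ _ (hA.hasParity hw), ← Equiv.sum_comp σ⁻¹ l]
  exact zsmul_mem (hθ _ _ fun t => hw _) _

theorem HasDeg.mlCompFirst {A : ℤ → Submodule ℝ W} {a b c : ℕ} (h : a + b = c) {i j m : ℤ}
    {f : MultilinearMap ℝ (fun _ : Fin (a + 1) => W) W}
    {g : MultilinearMap ℝ (fun _ : Fin (b + 1) => W) W} (hf : HasDeg A i f) (hg : HasDeg A j g)
    (hm : i + j = m) : HasDeg A m (mlCompFirst h f g) := by
  intro l w hw
  rw [mlCompFirst_apply, MultilinearMap.curryLeft_apply]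
  have h1 := hg _ _ fun i => hw (insertVertex h i)
  have h2 := hf (Fin.cons _ fun i => l (restVertex h i))
    (Fin.cons _ fun i => w (restVertex h i)) (Fin.cases h1 fun i => hw (restVertex h i))
  convert h2 using 1
  rw [← Equiv.sum_comp (blockEquiv h), Fintype.sum_sum_type, Fin.sum_cons]
  simp only [blockEquiv_inl, blockEquiv_inr]
  rw [← hm]
  congr 1
  ring

theorem HasDeg.sum {A : ℤ → Submodule ℝ W} {N : ℕ} {m : ℤ} {ι : Type} {s : Finset ι}
    {g : ι → MultilinearMap ℝ (fun _ : Fin N => W) W} (hg : ∀ i ∈ s, HasDeg A m (g i)) :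
    HasDeg A m (∑ i ∈ s, g i) := by
  intro l w hw
  rw [sum_apply]
  exact Submodule.sum_mem _ fun i hi => hg i hi l w hw

theorem HasDeg.zsmul {A : ℤ → Submodule ℝ W} {N : ℕ} {m : ℤ}
    {g : MultilinearMap ℝ (fun _ : Fin N => W) W} (hg : HasDeg A m g) (c : ℤ) :
    HasDeg A m (c • g) := fun l w hw => zsmul_mem (hg l w hw) c

theorem CE.hasDeg {A : ℤ → Submodule ℝ W} {P : W →ₗ[ℝ] W} {k : ℤ} {f : MLSeq W}
    (hf : f ∈ CE A P k) (a : ℕ) : HasDeg A (k - a) (f a) := (hf a).1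

/-- Componentwise pullback along the simple suspension. -/
def suspSeq (P : W →ₗ[ℝ] W) (f : MLSeq W) : MLSeq W := fun a => susp 1 P (f a)

theorem suspSeq_suspSeq {P : W →ₗ[ℝ] W} (hP : ∀ w, P (P w) = w) (f : MLSeq W) :
    suspSeq P (suspSeq P f) = f := funext fun _ => susp_susp hP 1 _

theorem suspSeq_add (P : W →ₗ[ℝ] W) (f g : MLSeq W) :
    suspSeq P (f + g) = suspSeq P f + suspSeq P g := rfl

theorem suspSeq_zsmul (P : W →ₗ[ℝ] W) (c : ℤ) (f : MLSeq W) :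
    suspSeq P (c • f) = c • suspSeq P f := rfl

/-- The twist `sgn` of `permAct_susp` for `m = 1` cancels skewsymmetry. For the shifted grading all
components of a cochain of degree `k` have the same parity `k`, because the `a + 1` shifted inputs
and the shifted output compensate the degree `k - a`. -/
theorem isSymmSeq_suspSeq {A : ℤ → Submodule ℝ W} {P : W →ₗ[ℝ] W} (hA : IsParityGrading A P)
    {k : ℤ} {f : MLSeq W} (hf : f ∈ CE A P k) : IsSymmSeq (oppParity P) k (suspSeq P f) := by
  have hP := hA.involutive
  intro a
  constructor
  · intro σ
    have h1 := permAct_susp hP 1 (susp 1 P (f a)) σ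
    rw [susp_susp hP, (hf a).2, pow_one] at h1
    have h2 : f a = susp 1 P (permAct (oppParity P) (susp 1 P (f a)) σ) := by
      have h3 := congrArg (fun x => (Equiv.Perm.sign σ : ℤ) • x) h1
      simp only [smul_smul] at h3
      have h4 : (Equiv.Perm.sign σ : ℤ) * (Equiv.Perm.sign σ : ℤ) = 1 := by
        rcases Int.units_eq_one_or (Equiv.Perm.sign σ) with h | h <;> simp [h]
      rwa [h4, one_smul, one_smul] at h3
    have h5 := congrArg (susp 1 P) h2
    rw [susp_susp hP] at h5
    exact h5.symm
  · intro w
    have h1 := (CE.hasDeg hf a).mapParity hA fun t => (P ^ (1 * (a - t.val))) (w t)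
    have h2 : (fun t => (oppParity P) (w t)) = fun t => (-1 : ℝ) • P (w t) := by
      funext t; simp
    rw [h2, (suspSeq P f a).map_smul_univ, LinearMap.smul_apply]
    change (-1 : ℝ) ^ 1 • P (f a fun t => (P ^ (1 * (a - t.val))) (w t)) = _
    rw [h1]
    have h3 : (fun t : Fin (a + 1) => P ((P ^ (1 * (a - t.val))) (w t))) =
        fun t : Fin (a + 1) => (P ^ (1 * (a - t.val))) (P (w t)) := by
      funext t
      rw [← Module.End.mul_apply, ← Module.End.mul_apply, ← pow_succ, ← pow_succ']
    rw [h3]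
    change _ • _ • (suspSeq P f a fun t => P (w t)) = _ • _ • (suspSeq P f a fun t => P (w t))
    rw [← Int.cast_smul_eq_zsmul ℝ, ← Int.cast_smul_eq_zsmul ℝ, smul_smul, smul_smul]
    congr 1
    rw [Finset.prod_const, Finset.card_univ, Fintype.card_fin, Int.negOnePow_sub, Units.val_mul,
      negOnePow_natCast]
    push_cast
    ring

/-- The factor `sgn σ` is the twist in `permAct_susp`, and `(-1)^((p-1)|g|)` is the sign in
`mlCompFirst_susp`, both for `m = 1`. Thus the Nijenhuis–Richardson product is `symComp` transported
along the suspension. -/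
theorem nrComp_eq_suspSeq {P : W →ₗ[ℝ] W} (hP : ∀ w, P (P w) = w) {j : ℤ} {f g : MLSeq W}
    (hg : ∀ b : ℕ, MapParity P (j - b) (g b)) :
    nrComp P j f g = suspSeq P (symComp (oppParity P) (suspSeq P f) (suspSeq P g)) := by
  funext c
  rw [nrComp, suspSeq, symComp, ← suspₗ_apply, map_sum]
  refine Finset.sum_congr rfl fun ab _ => ?_
  rw [map_sum]
  refine Finset.sum_congr rfl fun σ _ => ?_
  have h := Finset.HasAntidiagonal.mem_antidiagonal.mp ab.2
  have h1 := mlCompFirst_susp 1 h (susp 1 P (f ab.1.1)) (susp 1 P (g ab.1.2)) (P := P)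
    (j := j - ab.1.2) (by rw [susp_susp hP]; exact hg _)
  rw [susp_susp hP, susp_susp hP] at h1
  rw [h1, permAct_zsmul, permAct_susp hP, smul_smul, smul_smul, suspₗ_apply, pow_one, Nat.cast_one,
    one_mul]
  have h4 : (Equiv.Perm.sign σ : ℤ) * (Equiv.Perm.sign σ : ℤ) = 1 := by
    rcases Int.units_eq_one_or (Equiv.Perm.sign σ) with h | h <;> simp [h]
  have h5 : (((ab.1.1 : ℤ) * (j - ab.1.2)).negOnePow : ℤ) *
      (((ab.1.1 : ℤ) * (j - ab.1.2)).negOnePow : ℤ) = 1 := by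
    rcases negOnePow_eq_one_or ((ab.1.1 : ℤ) * (j - ab.1.2)) with h | h <;> simp [h]
  have h6 : ∀ s t : ℤ, s * s = 1 → t * t = 1 → s * t * t * s = 1 := fun s t hs ht => by
    rw [mul_assoc s, ht, mul_one, hs]
  rw [h6 _ _ h4 h5, one_smul]
  rfl

theorem nrBracket_eq_suspSeq {A : ℤ → Submodule ℝ W} {P : W →ₗ[ℝ] W} (hA : IsParityGrading A P)
    {i j : ℤ} {f g : MLSeq W} (hf : f ∈ CE A P i) (hg : g ∈ CE A P j) :
    nrBracket P i j f g = suspSeq P (symBracket (oppParity P) i j (suspSeq P f) (suspSeq P g)) := by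
  rw [nrBracket, nrComp_eq_suspSeq hA.involutive fun b => (CE.hasDeg hg b).mapParity hA,
    nrComp_eq_suspSeq hA.involutive fun b => (CE.hasDeg hf b).mapParity hA]
  rfl

theorem nrComp_hasDeg {A : ℤ → Submodule ℝ W} {P : W →ₗ[ℝ] W} (hA : IsParityGrading A P)
    {i j : ℤ} {f g : MLSeq W} (hf : f ∈ CE A P i) (hg : g ∈ CE A P j) (c : ℕ) :
    HasDeg A (i + j - c) (nrComp P j f g c) := by
  refine HasDeg.sum fun ab _ => HasDeg.sum fun σ _ => HasDeg.zsmul (HasDeg.permAct hA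
    (HasDeg.mlCompFirst _ (CE.hasDeg hf _) (CE.hasDeg hg _) ?_) _) _
  have h := Finset.HasAntidiagonal.mem_antidiagonal.mp ab.2
  have h' : (ab.1.1 : ℤ) + ab.1.2 = c := by exact_mod_cast h
  linarith

theorem nrBracket_mem {A : ℤ → Submodule ℝ W} {P : W →ₗ[ℝ] W} (hA : IsParityGrading A P)
    {i j : ℤ} {f g : MLSeq W} (hf : f ∈ CE A P i) (hg : g ∈ CE A P j) :
    nrBracket P i j f g ∈ CE A P (i + j) := by
  intro c
  constructor
  · intro l w hw
    refine Submodule.sub_mem _ (nrComp_hasDeg hA hf hg c l w hw) (zsmul_mem ?_ _)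
    rw [add_comm i j]
    exact nrComp_hasDeg hA hg hf c l w hw
  · intro σ
    have hS := (isSymmSeq_suspSeq hA hf).symBracket (shift_involutive hA.involutive 1)
      (isSymmSeq_suspSeq hA hg)
    rw [nrBracket_eq_suspSeq hA hf hg, suspSeq, permAct_susp hA.involutive, (hS c).1, pow_one]

theorem nrBracket_jacobi {A : ℤ → Submodule ℝ W} {P : W →ₗ[ℝ] W} (hA : IsParityGrading A P)
    {i j k : ℤ} {f g h : MLSeq W} (hf : f ∈ CE A P i) (hg : g ∈ CE A P j) (hh : h ∈ CE A P k) :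
    nrBracket P i (j + k) f (nrBracket P j k g h) =
      nrBracket P (i + j) k (nrBracket P i j f g) h +
        ((i * j).negOnePow : ℤ) • nrBracket P j (i + k) g (nrBracket P i k f h) := by
  have hP := hA.involutive
  rw [nrBracket_eq_suspSeq hA hf (nrBracket_mem hA hg hh),
    nrBracket_eq_suspSeq hA (nrBracket_mem hA hf hg) hh,
    nrBracket_eq_suspSeq hA hg (nrBracket_mem hA hf hh), nrBracket_eq_suspSeq hA hg hh,
    nrBracket_eq_suspSeq hA hf hg, nrBracket_eq_suspSeq hA hf hh, suspSeq_suspSeq hP,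
    suspSeq_suspSeq hP, suspSeq_suspSeq hP, ← suspSeq_zsmul, ← suspSeq_add,
    symBracket_jacobi (shift_involutive hP 1) (isSymmSeq_suspSeq hA hf)
      (isSymmSeq_suspSeq hA hg) (isSymmSeq_suspSeq hA hh)]

/-- The Nijenhuis–Richardson product as a bilinear map. -/
def nrCompₗ (P : W →ₗ[ℝ] W) (j : ℤ) : MLSeq W →ₗ[ℝ] MLSeq W →ₗ[ℝ] MLSeq W :=
  LinearMap.mk₂ ℝ (nrComp P j)
    (fun f f' g => by
      funext c
      simp only [nrComp, Pi.add_apply, ← mlCompFirstₗ_apply, map_add, LinearMap.add_apply,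
        permAct_add, Finset.sum_add_distrib, smul_add])
    (fun r f g => by
      funext c
      simp only [nrComp, Pi.smul_apply, ← mlCompFirstₗ_apply, map_smul, LinearMap.smul_apply,
        permAct_smul, Finset.smul_sum, smul_comm r])
    (fun f g g' => by
      funext c
      simp only [nrComp, Pi.add_apply, ← mlCompFirstₗ_apply, map_add,
        permAct_add, Finset.sum_add_distrib, smul_add])
    (fun r f g => by
      funext c
      simp only [nrComp, Pi.smul_apply, ← mlCompFirstₗ_apply, map_smul,
        permAct_smul, Finset.smul_sum, smul_comm r])

end CELie

/-- A graded Lie algebra together with an element of degree one and square zero. -/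
theorem isDGLieAlgebra_of_mul_self {L : Type} [AddCommGroup L] [Module ℝ L]
    {G : ℤ → Submodule ℝ L} (comp : ℤ → L →ₗ[ℝ] L →ₗ[ℝ] L) {br : ℤ → ℤ → L → L → L}
    (hbr : ∀ i j x y, br i j x y = comp j x y - ((i * j).negOnePow : ℤ) • comp i y x)
    (br_mem : ∀ i j, ∀ x ∈ G i, ∀ y ∈ G j, br i j x y ∈ G (i + j))
    (br_jacobi : ∀ i j k, ∀ x ∈ G i, ∀ y ∈ G j, ∀ z ∈ G k,
      br i (j + k) x (br j k y z) =
        br (i + j) k (br i j x y) z + ((i * j).negOnePow : ℤ) • br j (i + k) y (br i k x z))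
    {m : L} (hm : m ∈ G 1) (hmm : br 1 1 m m = 0) :
    IsDGLieAlgebra G br (fun i => br 1 i m) := by
  have add_left : ∀ i j x x' y, br i j (x + x') y = br i j x y + br i j x' y := by
    intro i j x x' y
    simp only [hbr, map_add, LinearMap.add_apply, smul_add]
    abel
  have add_right : ∀ i j x y y', br i j x (y + y') = br i j x y + br i j x y' := by
    intro i j x x' y
    simp only [hbr, map_add, LinearMap.add_apply, smul_add]
    abel
  have smul_left : ∀ i j (c : ℝ) x y, br i j (c • x) y = c • br i j x y := by
    intro i j c x y
    simp only [hbr, map_smul, LinearMap.smul_apply, smul_sub, smul_comm c]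
  have smul_right : ∀ i j (c : ℝ) x y, br i j x (c • y) = c • br i j x y := by
    intro i j c x y
    simp only [hbr, map_smul, LinearMap.smul_apply, smul_sub, smul_comm c]
  refine
    { br_mem := br_mem
      br_add_left := fun i j x _ x' _ y _ => add_left i j x x' y
      br_add_right := fun i j x _ y _ y' _ => add_right i j x y y'
      br_smul_left := fun i j c x _ y _ => smul_left i j c x y
      br_smul_right := fun i j c x _ y _ => smul_right i j c x y
      br_skew := fun i j x _ y _ => ?_
      br_jacobi := br_jacobi
      d_mem := fun i x hx => add_comm i 1 ▸ br_mem 1 i m hm x hx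
      d_add := fun i x _ y _ => add_right 1 i m x y
      d_smul := fun i c x _ => smul_right 1 i c m x
      d_sq := fun i x hx => ?_
      d_leibniz := fun i j x hx y hy => ?_ }
  · rw [hbr, hbr, mul_comm j i]
    rcases negOnePow_eq_one_or (i * j) with h | h <;> rw [h] <;> module
  -- As `m` is odd, the Jacobi identity for `m, m, x` says `2 [m, [m, x]] = [[m, m], x]`, which is
  -- zero.
  · have h := br_jacobi 1 1 i m hm m hm x hx
    have h0 : br (1 + 1) i (br 1 1 m m) x = 0 := by
      have := smul_left (1 + 1) i 0 0 x
      rw [hmm]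
      rwa [zero_smul, zero_smul] at this
    rw [h0, zero_add, mul_one, Int.negOnePow_one, Units.val_neg, Units.val_one, neg_one_smul] at h
    rw [add_comm i 1]
    have h2 : (2 : ℝ) • br 1 (1 + i) m (br 1 i m x) = 0 := by
      rw [two_smul]; nth_rewrite 1 [h]; simp
    exact (smul_eq_zero.mp h2).resolve_left two_ne_zero
  · have h := br_jacobi 1 i j m hm x hx y hy
    rw [one_mul] at h
    rw [add_comm i 1, add_comm j 1]
    exact h

theorem CE_isDGLieAlgebra {W : Type} [AddCommGroup W] [Module ℝ W] {A : ℤ → Submodule ℝ W}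
    {P : W →ₗ[ℝ] W} (hA : IsParityGrading A P) {m : MLSeq W} (hm : m ∈ CE A P 1)
    (hmm : nrBracket P 1 1 m m = 0) :
    IsDGLieAlgebra (CE A P) (nrBracket P) (fun i => nrBracket P 1 i m) :=
  isDGLieAlgebra_of_mul_self (nrCompₗ P) (fun _ _ _ _ => rfl)
    (fun _ _ _ hx _ hy => nrBracket_mem hA hx hy)
    (fun _ _ _ _ hx _ hy _ hz => nrBracket_jacobi hA hx hy hz) hm hmm


/-! ### Exterior algebras: graded commutativity and contractions -/

section Exterior

variable {M : Type} [AddCommGroup M] [Module ℝ M]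

local notation "inv" => CliffordAlgebra.involute (Q := (0 : QuadraticForm ℝ M))

theorem exterior_ι_mul (v : M) (y : ExteriorAlgebra ℝ M) :
    ExteriorAlgebra.ι ℝ v * y = inv y * ExteriorAlgebra.ι ℝ v := by
  induction y using ExteriorAlgebra.induction with
  | algebraMap r => rw [AlgHom.commutes, Algebra.commutes]
  | ι w =>
    have : inv (ExteriorAlgebra.ι ℝ w) = -ExteriorAlgebra.ι ℝ w := CliffordAlgebra.involute_ι w
    rw [this, neg_mul, eq_neg_iff_add_eq_zero]
    exact ExteriorAlgebra.ι_add_mul_swap v w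
  | mul a b ha hb => rw [map_mul, ← mul_assoc, ha, mul_assoc, hb, mul_assoc]
  | add a b ha hb => rw [map_add, mul_add, add_mul, ha, hb]

/-- `x y = ± y x` for `y` of definite parity. -/
theorem exterior_mul_comm (x : ExteriorAlgebra ℝ M) {y : ExteriorAlgebra ℝ M} {k : ℕ}
    (hy : inv y = ((-1 : ℝ) ^ k) • y) : x * y = y * ((inv)^[k]) x := by
  have hk : ∀ k : ℕ, ∃ φ : ExteriorAlgebra ℝ M →ₐ[ℝ] ExteriorAlgebra ℝ M,
      ∀ x, φ x = ((inv)^[k]) x := by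
    intro k
    induction k with
    | zero => exact ⟨AlgHom.id _ _, fun _ => rfl⟩
    | succ k ih =>
      obtain ⟨φ, hφ⟩ := ih
      exact ⟨AlgHom.comp inv φ, fun x => by
        rw [AlgHom.comp_apply, hφ, Function.iterate_succ_apply']⟩
  obtain ⟨φ, hφ⟩ := hk k
  rw [← hφ]
  have hι : ∀ v, φ (ExteriorAlgebra.ι ℝ v) = ((-1 : ℝ) ^ k) • ExteriorAlgebra.ι ℝ v := by
    intro v
    rw [hφ]
    clear hφ hy
    induction k with
    | zero => simp
    | succ k ih =>
      have : inv (ExteriorAlgebra.ι ℝ v) = -ExteriorAlgebra.ι ℝ v := CliffordAlgebra.involute_ι v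
      rw [Function.iterate_succ_apply', ih, map_smul, this, pow_succ]
      simp
  induction x using ExteriorAlgebra.induction with
  | algebraMap r => rw [AlgHom.commutes, Algebra.commutes]
  | ι v => rw [exterior_ι_mul, hy, hι, smul_mul_assoc, mul_smul_comm]
  | mul a b ha hb => rw [map_mul, mul_assoc, hb, ← mul_assoc, ha, mul_assoc]
  | add a b ha hb => rw [map_add, mul_add, add_mul, ha, hb]

theorem contractLeft_mul (d : Module.Dual ℝ M) (x y : ExteriorAlgebra ℝ M) :
    CliffordAlgebra.contractLeft (Q := (0 : QuadraticForm ℝ M)) d (x * y) =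
      CliffordAlgebra.contractLeft (Q := (0 : QuadraticForm ℝ M)) d x * y +
        inv x * CliffordAlgebra.contractLeft (Q := (0 : QuadraticForm ℝ M)) d y := by
  induction x using CliffordAlgebra.left_induction with
  | algebraMap r =>
    rw [AlgHom.commutes, CliffordAlgebra.contractLeft_algebraMap, zero_mul, zero_add,
      CliffordAlgebra.contractLeft_algebraMap_mul]
  | add a b ha hb => rw [add_mul, map_add, map_add, ha, hb, map_add, add_mul, add_mul]; abel
  | ι_mul x m hx =>
    rw [mul_assoc, CliffordAlgebra.contractLeft_ι_mul, hx, CliffordAlgebra.contractLeft_ι_mul,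
      map_mul, CliffordAlgebra.involute_ι, sub_mul, smul_mul_assoc, mul_add]
    simp only [mul_assoc, neg_mul]
    abel

theorem contractLeft_involute (d : Module.Dual ℝ M) (x : ExteriorAlgebra ℝ M) :
    CliffordAlgebra.contractLeft (Q := (0 : QuadraticForm ℝ M)) d (inv x) =
      -inv (CliffordAlgebra.contractLeft (Q := (0 : QuadraticForm ℝ M)) d x) := by
  induction x using CliffordAlgebra.left_induction with
  | algebraMap r =>
    rw [AlgHom.commutes, CliffordAlgebra.contractLeft_algebraMap, map_zero, neg_zero]
  | add a b ha hb => rw [map_add, map_add, ha, hb, map_add, map_add]; abel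
  | ι_mul x m hx =>
    rw [map_mul, CliffordAlgebra.involute_ι, neg_mul, map_neg, CliffordAlgebra.contractLeft_ι_mul,
      hx, CliffordAlgebra.contractLeft_ι_mul, map_sub, map_smul, map_mul,
      CliffordAlgebra.involute_ι]
    simp

end Exterior

/-! ### Partial derivatives of smooth functions -/

section Smooth

open Classical

variable {ι : Type} [Fintype ι] {U : Set (ι → ℝ)}

theorem SmoothFun.differentiableAt (hU : IsOpen U) (f : SmoothFun U) (u : U) :
    DifferentiableAt ℝ (extendZero U f.1) u :=
  ((f.2 : ContDiffOn ℝ ∞ _ U).contDiffAt (hU.mem_nhds u.2)).differentiableAt (by simp)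

theorem extendZero_mul (f g : SmoothFun U) :
    extendZero U (f * g).1 = extendZero U f.1 * extendZero U g.1 := by
  funext x
  by_cases hx : x ∈ U
  · simp only [extendZero, hx, dif_pos, Pi.mul_apply]; rfl
  · simp [extendZero, hx]

theorem partialDeriv_apply (hU : IsOpen U) (t : ι) (f : SmoothFun U) (u : U) :
    (partialDeriv hU t f).1 u = fderiv ℝ (extendZero U f.1) u (Pi.single t 1) := rfl

theorem partialDeriv_mul (hU : IsOpen U) (t : ι) (f g : SmoothFun U) :
    partialDeriv hU t (f * g) = partialDeriv hU t f * g + f * partialDeriv hU t g := by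
  apply Subtype.ext
  funext u
  change (partialDeriv hU t (f * g)).1 u =
    (partialDeriv hU t f).1 u * g.1 u + f.1 u * (partialDeriv hU t g).1 u
  rw [partialDeriv_apply, partialDeriv_apply, partialDeriv_apply, extendZero_mul,
    fderiv_mul (f.differentiableAt hU u) (g.differentiableAt hU u)]
  simp [extendZero_coe]
  ring

/-- Symmetry of the second derivative. Openness of `U` ensures that near a point of `U` the
extension by zero of `∂_t f` is the derivative of the extension of `f`. -/
theorem partialDeriv_comm (hU : IsOpen U) (s t : ι) (f : SmoothFun U) :
    partialDeriv hU s (partialDeriv hU t f) = partialDeriv hU t (partialDeriv hU s f) := by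
  have key : ∀ s t : ι, ∀ u : U, (partialDeriv hU s (partialDeriv hU t f)).1 u =
      fderiv ℝ (fderiv ℝ (extendZero U f.1)) u (Pi.single s 1) (Pi.single t 1) := by
    intro s t u
    rw [partialDeriv_apply]
    have h1 : extendZero U (partialDeriv hU t f).1 =ᶠ[nhds u.1]
        fun x => fderiv ℝ (extendZero U f.1) x (Pi.single t 1) := by
      filter_upwards [hU.mem_nhds u.2] with x hx
      exact extendZero_coe U _ ⟨x, hx⟩
    rw [h1.fderiv_eq]
    have h2 : DifferentiableAt ℝ (fderiv ℝ (extendZero U f.1)) u := by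
      have h3 : ContDiffOn ℝ ∞ (fderiv ℝ (extendZero U f.1)) U :=
        ContDiffOn.fderiv_of_isOpen f.2 hU (by simp)
      exact (h3.contDiffAt (hU.mem_nhds u.2)).differentiableAt (by simp)
    rw [fderiv_clm_apply h2 (differentiableAt_const _)]
    simp
  apply Subtype.ext
  funext u
  rw [key, key]
  have h4 : ContDiffAt ℝ ∞ (extendZero U f.1) u :=
    (f.2 : ContDiffOn ℝ ∞ _ U).contDiffAt (hU.mem_nhds u.2)
  exact (h4.isSymmSndFDerivAt (by
    rw [minSmoothness_of_isRCLikeNormedField]; exact WithTop.coe_le_coe.mpr le_top)).eq _ _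

end Smooth

/-- The commutator of two derivations is a derivation, and this one vanishes on the variables. -/
theorem pderiv_comm {σ : Type} (i j : σ) (p : MvPolynomial σ ℝ) :
    MvPolynomial.pderiv i (MvPolynomial.pderiv j p) =
      MvPolynomial.pderiv j (MvPolynomial.pderiv i p) := by
  classical
  have : (⁅(MvPolynomial.pderiv i : Derivation ℝ (MvPolynomial σ ℝ) (MvPolynomial σ ℝ)),
      MvPolynomial.pderiv j⁆ : Derivation ℝ (MvPolynomial σ ℝ) (MvPolynomial σ ℝ)) = 0 := by
    refine MvPolynomial.derivation_ext fun k => ?_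
    rw [Derivation.commutator_apply, MvPolynomial.pderiv_X, MvPolynomial.pderiv_X]
    simp only [Pi.single_apply]
    split_ifs <;> simp
  have h := congrArg (fun D => D p) this
  simp only [Derivation.commutator_apply, Derivation.zero_apply] at h
  exact sub_eq_zero.mp h

/-! ### The algebra of functions -/

namespace DarbouxChart

variable {n : ℕ} {V : DarbouxChart n}

/-- The product of a smooth function, a polynomial and an exterior form. -/
def fmk (f : SmoothFun V.U) (p : MvPolynomial V.EvenCoord ℝ)
    (x : ExteriorAlgebra ℝ (V.OddCoord → ℝ)) : V.Fun := (f ⊗ₜ[ℝ] p) ⊗ₜ[ℝ] x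

theorem mk_mul_fmk (f f' : SmoothFun V.U) (p p' : MvPolynomial V.EvenCoord ℝ)
    (x x' : ExteriorAlgebra ℝ (V.OddCoord → ℝ)) :
    fmk f p x * fmk f' p' x' = fmk (f * f') (p * p') (x * x') := by
  unfold fmk
  exact (Algebra.TensorProduct.tmul_mul_tmul _ _ _ _).trans
    (congrArg (· ⊗ₜ[ℝ] (x * x')) (Algebra.TensorProduct.tmul_mul_tmul _ _ _ _))

theorem one_eq_fmk : (1 : V.Fun) = fmk 1 1 1 := rfl

theorem Fun.induction {C : V.Fun → Prop} (z : V.Fun) (hmk : ∀ f p x, C (fmk f p x))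
    (hadd : ∀ a b, C a → C b → C (a + b)) : C z := by
  have h0 : C 0 := by
    have := hmk 0 0 0
    rwa [show (fmk 0 0 0 : V.Fun) = 0 from TensorProduct.tmul_zero _ _] at this
  refine TensorProduct.induction_on (motive := C) z h0 ?_ hadd
  intro a x
  refine TensorProduct.induction_on (motive := fun a => C (a ⊗ₜ[ℝ] x)) a ?_ (fun f p => hmk f p x) ?_
  · rw [TensorProduct.zero_tmul]; exact h0
  · intro a b ha hb
    rw [TensorProduct.add_tmul]
    exact hadd _ _ ha hb

theorem mk_smul (c : ℝ) (f : SmoothFun V.U) (p : MvPolynomial V.EvenCoord ℝ)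
    (x : ExteriorAlgebra ℝ (V.OddCoord → ℝ)) : fmk f p (c • x) = c • fmk f p x :=
  TensorProduct.tmul_smul _ _ _

theorem mk_neg (f : SmoothFun V.U) (p : MvPolynomial V.EvenCoord ℝ)
    (x : ExteriorAlgebra ℝ (V.OddCoord → ℝ)) : fmk f p (-x) = -fmk f p x :=
  TensorProduct.tmul_neg _ _

theorem mk_add (f : SmoothFun V.U) (p : MvPolynomial V.EvenCoord ℝ)
    (x y : ExteriorAlgebra ℝ (V.OddCoord → ℝ)) : fmk f p (x + y) = fmk f p x + fmk f p y :=
  TensorProduct.tmul_add _ _ _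

theorem mk_add_left (f g : SmoothFun V.U) (p : MvPolynomial V.EvenCoord ℝ)
    (x : ExteriorAlgebra ℝ (V.OddCoord → ℝ)) : fmk (f + g) p x = fmk f p x + fmk g p x :=
  (congrArg (· ⊗ₜ[ℝ] x) (TensorProduct.add_tmul f g p)).trans (TensorProduct.add_tmul _ _ _)

theorem mk_add_mid (f : SmoothFun V.U) (p q : MvPolynomial V.EvenCoord ℝ)
    (x : ExteriorAlgebra ℝ (V.OddCoord → ℝ)) : fmk f (p + q) x = fmk f p x + fmk f q x :=
  (congrArg (· ⊗ₜ[ℝ] x) (TensorProduct.tmul_add f p q)).trans (TensorProduct.add_tmul _ _ _)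

theorem parity_fmk (f : SmoothFun V.U) (p : MvPolynomial V.EvenCoord ℝ)
    (x : ExteriorAlgebra ℝ (V.OddCoord → ℝ)) :
    V.parity (fmk f p x) = fmk f p (CliffordAlgebra.involute x) := rfl

theorem deriv_fmk_base {A : V.Coords} (h : A.deg = 0) (f : SmoothFun V.U)
    (p : MvPolynomial V.EvenCoord ℝ) (x : ExteriorAlgebra ℝ (V.OddCoord → ℝ)) :
    V.deriv A (fmk f p x) = fmk (partialDeriv V.isOpen_U ⟨A, h⟩ f) p x := by
  have := congrArg (fun D : V.Fun →ₗ[ℝ] V.Fun => D (fmk f p x)) (dif_pos h : V.deriv A = _)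
  exact this

theorem deriv_fmk_odd {A : V.Coords} (h : Odd A.deg) (f : SmoothFun V.U)
    (p : MvPolynomial V.EvenCoord ℝ) (x : ExteriorAlgebra ℝ (V.OddCoord → ℝ)) :
    V.deriv A (fmk f p x) = fmk f p (CliffordAlgebra.contractLeft
      (LinearMap.proj (⟨A, h⟩ : V.OddCoord)) x) := by
  have h0 : ¬ A.deg = 0 := by rintro h0; rw [h0] at h; exact absurd h (by decide)
  have := congrArg (fun D : V.Fun →ₗ[ℝ] V.Fun => D (fmk f p x))
    (((dif_neg h0 : V.deriv A = _)).trans (dif_pos h))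
  exact this

theorem deriv_fmk_even {A : V.Coords} (h : A.deg ≠ 0 ∧ ¬ Odd A.deg) (f : SmoothFun V.U)
    (p : MvPolynomial V.EvenCoord ℝ) (x : ExteriorAlgebra ℝ (V.OddCoord → ℝ)) :
    V.deriv A (fmk f p x) = fmk f (MvPolynomial.pderiv (⟨A, h⟩ : V.EvenCoord) p) x := by
  have := congrArg (fun D : V.Fun →ₗ[ℝ] V.Fun => D (fmk f p x))
    (((dif_neg h.1 : V.deriv A = _)).trans (dif_neg h.2))
  exact this

theorem coord_trichotomy (A : V.Coords) : A.deg = 0 ∨ Odd A.deg ∨ (A.deg ≠ 0 ∧ ¬ Odd A.deg) := by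
  tauto

theorem parity_mul (a b : V.Fun) : V.parity (a * b) = V.parity a * V.parity b := by
  induction a using Fun.induction with
  | hadd a a' ha ha' => rw [add_mul, map_add, map_add, add_mul, ha, ha']
  | hmk f p x =>
    induction b using Fun.induction with
    | hadd a a' ha ha' => rw [mul_add, map_add, map_add, mul_add, ha, ha']
    | hmk g q y => rw [mk_mul_fmk, parity_fmk, parity_fmk, parity_fmk, mk_mul_fmk, map_mul]

theorem parity_parity (a : V.Fun) : V.parity (V.parity a) = a := by
  induction a using Fun.induction with
  | hadd a a' ha ha' => rw [map_add, map_add, ha, ha']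
  | hmk f p x => rw [parity_fmk, parity_fmk, CliffordAlgebra.involute_involute]

theorem parity_one : V.parity 1 = 1 := by
  rw [one_eq_fmk, parity_fmk, map_one]

theorem parity_pow_mul (k : ℕ) (a b : V.Fun) :
    (V.parity ^ k) (a * b) = (V.parity ^ k) a * (V.parity ^ k) b := by
  induction k generalizing a b with
  | zero => rfl
  | succ k ih =>
    rw [pow_succ, Module.End.mul_apply, Module.End.mul_apply, Module.End.mul_apply, parity_mul, ih]

theorem parity_pow_fmk (k : ℕ) (f : SmoothFun V.U) (p : MvPolynomial V.EvenCoord ℝ)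
    (x : ExteriorAlgebra ℝ (V.OddCoord → ℝ)) :
    (V.parity ^ k) (fmk f p x) = fmk f p ((CliffordAlgebra.involute^[k]) x) := by
  induction k with
  | zero => rfl
  | succ k ih => rw [pow_succ', Module.End.mul_apply, ih, parity_fmk, Function.iterate_succ_apply']

theorem parity_pow_of_even {k : ℕ} (h : Even k) : V.parity ^ k = 1 := by
  obtain ⟨m, rfl⟩ := h
  have : V.parity * V.parity = 1 := LinearMap.ext parity_parity
  rw [pow_add, ← (Commute.refl V.parity).mul_pow, this, one_pow]

theorem parity_pow_of_odd {k : ℕ} (h : Odd k) : V.parity ^ k = V.parity := by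
  obtain ⟨m, rfl⟩ := h
  rw [pow_succ, parity_pow_of_even (even_two_mul m), one_mul]

/-- Graded commutativity of functions. -/
theorem mul_comm_of_parity (a : V.Fun) {b : V.Fun} {k : Fin 2}
    (hb : V.parity b = ((-1 : ℤ) ^ k.val) • b) : a * b = b * (V.parity ^ k.val) a := by
  -- The identity is proved for the parity projection of an arbitrary function, which can be
  -- decomposed into product terms without losing the hypothesis; a function of definite parity
  -- equals its projection.
  have key : ∀ a b : V.Fun, a * parityProj V.parity k b =
      parityProj V.parity k b * (V.parity ^ k.val) a := by
    intro a b
    induction b using Fun.induction with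
    | hadd b b' hb hb' => rw [map_add, mul_add, add_mul, hb, hb']
    | hmk g q y =>
      have h1 : parityProj V.parity k (fmk g q y) =
          fmk g q ((1 / 2 : ℝ) • (y + ((-1 : ℝ) ^ k.val) • CliffordAlgebra.involute y)) := by
        rw [mk_smul, mk_add, mk_smul]; rfl
      rw [h1]
      induction a using Fun.induction with
      | hadd a a' ha ha' => rw [map_add, mul_add, add_mul, ha, ha']
      | hmk f p x =>
        rw [mk_mul_fmk, parity_pow_fmk, mk_mul_fmk, mul_comm f, mul_comm p,
          exterior_mul_comm (k := k.val)]
        rw [map_smul, map_add, map_smul, CliffordAlgebra.involute_involute]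
        fin_cases k
        · simp [add_comm]
        · simp [add_comm]
  have h2 := key a b
  rwa [parityProj_eq_self hb] at h2

/-- The graded Leibniz rule. -/
theorem deriv_mul (A : V.Coords) (a b : V.Fun) :
    V.deriv A (a * b) = V.deriv A a * b + (V.parity ^ A.deg) a * V.deriv A b := by
  induction a using Fun.induction with
  | hadd a a' ha ha' => rw [add_mul, map_add, map_add, map_add, add_mul, add_mul, ha, ha']; abel
  | hmk f p x =>
    induction b using Fun.induction with
    | hadd b b' hb hb' => rw [mul_add, map_add, map_add, mul_add, mul_add, hb, hb']; abel
    | hmk g q y =>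
      rcases coord_trichotomy A with h | h | h
      · rw [h, pow_zero, Module.End.one_apply, mk_mul_fmk, deriv_fmk_base h, deriv_fmk_base h,
          deriv_fmk_base h, mk_mul_fmk, mk_mul_fmk, partialDeriv_mul, mk_add_left]
      · rw [parity_pow_of_odd h, mk_mul_fmk, deriv_fmk_odd h, deriv_fmk_odd h, deriv_fmk_odd h,
          parity_fmk, mk_mul_fmk, mk_mul_fmk, contractLeft_mul, mk_add]
      · rw [parity_pow_of_even (Nat.not_odd_iff_even.mp h.2), Module.End.one_apply, mk_mul_fmk,
          deriv_fmk_even h, deriv_fmk_even h, deriv_fmk_even h, mk_mul_fmk, mk_mul_fmk,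
          Derivation.leibniz, add_comm, smul_eq_mul, smul_eq_mul, mk_add_mid, mul_comm q]

theorem deriv_parity (A : V.Coords) (a : V.Fun) :
    V.deriv A (V.parity a) = ((-1 : ℝ) ^ A.deg) • V.parity (V.deriv A a) := by
  induction a using Fun.induction with
  | hadd a a' ha ha' => rw [map_add, map_add, map_add, map_add, smul_add, ha, ha']
  | hmk f p x =>
    rcases coord_trichotomy A with h | h | h
    · rw [h, pow_zero, one_smul, parity_fmk, deriv_fmk_base h, deriv_fmk_base h, parity_fmk]
    · rw [h.neg_one_pow, parity_fmk, deriv_fmk_odd h, deriv_fmk_odd h, parity_fmk,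
        contractLeft_involute, mk_neg, neg_one_smul]
    · rw [(Nat.not_odd_iff_even.mp h.2).neg_one_pow, one_smul, parity_fmk, deriv_fmk_even h,
        deriv_fmk_even h, parity_fmk]

theorem deriv_comm (A B : V.Coords) (a : V.Fun) :
    V.deriv A (V.deriv B a) = ((-1 : ℝ) ^ (A.deg * B.deg)) • V.deriv B (V.deriv A a) := by
  induction a using Fun.induction with
  | hadd a a' ha ha' => rw [map_add, map_add, map_add, map_add, smul_add, ha, ha']
  | hmk f p x =>
    rcases coord_trichotomy A with h | h | h <;> rcases coord_trichotomy B with h' | h' | h'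
    · rw [h, zero_mul, pow_zero, one_smul]
      simp only [deriv_fmk_base h, deriv_fmk_base h', partialDeriv_comm V.isOpen_U ⟨A, h⟩]
    · rw [h, zero_mul, pow_zero, one_smul]
      simp only [deriv_fmk_base h, deriv_fmk_odd h']
    · rw [h, zero_mul, pow_zero, one_smul]
      simp only [deriv_fmk_base h, deriv_fmk_even h']
    · rw [h', mul_zero, pow_zero, one_smul]
      simp only [deriv_fmk_odd h, deriv_fmk_base h']
    · rw [(h.mul h').neg_one_pow, neg_one_smul]
      simp only [deriv_fmk_odd h, deriv_fmk_odd h', ← mk_neg]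
      rw [CliffordAlgebra.contractLeft_comm]
    · rw [((Nat.not_odd_iff_even.mp h'.2).mul_left _).neg_one_pow, one_smul]
      simp only [deriv_fmk_odd h, deriv_fmk_even h']
    · rw [h', mul_zero, pow_zero, one_smul]
      simp only [deriv_fmk_even h, deriv_fmk_base h']
    · rw [((Nat.not_odd_iff_even.mp h.2).mul_right _).neg_one_pow, one_smul]
      simp only [deriv_fmk_even h, deriv_fmk_odd h']
    · rw [((Nat.not_odd_iff_even.mp h.2).mul_right _).neg_one_pow, one_smul]
      simp only [deriv_fmk_even h, deriv_fmk_even h', pderiv_comm (⟨A, h⟩ : V.EvenCoord)]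

end DarbouxChart

/-! ### The grading of the algebra of functions -/

namespace DarbouxChart

variable {n : ℕ} {V : DarbouxChart n}

/-- The product of the odd coordinates in a list. -/
def oddProd (l : List V.OddCoord) : ExteriorAlgebra ℝ (V.OddCoord → ℝ) :=
  (l.map fun A => ExteriorAlgebra.ι ℝ (Pi.single A (1 : ℝ) : V.OddCoord → ℝ)).prod

theorem oddProd_cons (A : V.OddCoord) (l : List V.OddCoord) :
    oddProd (A :: l) = ExteriorAlgebra.ι ℝ (Pi.single A (1 : ℝ) : V.OddCoord → ℝ) * oddProd l := by
  simp [oddProd]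

theorem oddProd_append (l l' : List V.OddCoord) :
    oddProd (l ++ l') = oddProd l * oddProd l' := by
  simp [oddProd]

/-- The weight of a monomial. -/
def weight (s : V.EvenCoord →₀ ℕ) (l : List V.OddCoord) : ℕ :=
  (s.sum fun A e => e * A.1.deg) + (l.map fun A => A.1.deg).sum

theorem weight_cons (s : V.EvenCoord →₀ ℕ) (A : V.OddCoord) (l : List V.OddCoord) :
    weight s (A :: l) = A.1.deg + weight s l := by
  simp [weight]; omega

theorem weight_add_append (s t : V.EvenCoord →₀ ℕ) (l m : List V.OddCoord) :
    weight (s + t) (l ++ m) = weight s l + weight t m := by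
  unfold weight
  rw [Finsupp.sum_add_index' (by simp) (by intros; ring), List.map_append, List.sum_append]
  omega

theorem fmk_mem_funDeg (f : SmoothFun V.U) (s : V.EvenCoord →₀ ℕ) (l : List V.OddCoord) {k : ℤ}
    (h : (weight s l : ℤ) = k) : fmk f (MvPolynomial.monomial s 1) (oddProd l) ∈ V.funDeg k :=
  Submodule.subset_span ⟨f, s, l, h, rfl⟩

theorem funDeg_induction {k : ℤ} {p : V.Fun → Prop} {z : V.Fun} (hz : z ∈ V.funDeg k)
    (mk : ∀ f s l, (weight s l : ℤ) = k → p (fmk f (MvPolynomial.monomial s 1) (oddProd l)))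
    (zero : p 0) (add : ∀ x y, p x → p y → p (x + y)) (smul : ∀ (c : ℝ) x, p x → p (c • x)) :
    p z := by
  refine Submodule.span_induction (p := fun z _ => p z) ?_ zero (fun x y _ _ => add x y)
    (fun c x _ => smul c x) hz
  rintro _ ⟨f, s, l, h, rfl⟩
  exact mk f s l h

theorem exterior_mem_span_oddProd (x : ExteriorAlgebra ℝ (V.OddCoord → ℝ)) :
    x ∈ Submodule.span ℝ (Set.range (oddProd (V := V))) := by
  classical
  induction x using CliffordAlgebra.left_induction with
  | algebraMap r =>
    rw [Algebra.algebraMap_eq_smul_one]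
    exact Submodule.smul_mem _ _ (Submodule.subset_span ⟨[], by simp [oddProd]⟩)
  | add a b ha hb => exact Submodule.add_mem _ ha hb
  | ι_mul x v hx =>
    have hv : v = ∑ A, v A • (Pi.single A (1 : ℝ) : V.OddCoord → ℝ) := by
      funext B
      simp [Finset.sum_apply, Pi.single_apply]
    rw [hv, map_sum, Finset.sum_mul]
    refine Submodule.sum_mem _ fun A _ => ?_
    rw [map_smul, smul_mul_assoc]
    refine Submodule.smul_mem _ _ ?_
    induction hx using Submodule.span_induction with
    | mem y hy =>
      obtain ⟨l, rfl⟩ := hy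
      exact Submodule.subset_span ⟨A :: l, by
        rw [oddProd_cons]⟩
    | zero => rw [mul_zero]; exact Submodule.zero_mem _
    | add a b _ _ ha hb => rw [mul_add]; exact Submodule.add_mem _ ha hb
    | smul c a _ ha => rw [mul_smul_comm]; exact Submodule.smul_mem _ _ ha

theorem span_funDeg : Submodule.span ℝ {w : V.Fun | ∃ k, w ∈ V.funDeg k} = ⊤ := by
  refine Submodule.eq_top_iff'.mpr fun z => ?_
  induction z using Fun.induction with
  | hadd a b ha hb => exact Submodule.add_mem _ ha hb
  | hmk f p x =>
    induction p using MvPolynomial.induction_on' with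
    | add p q hp hq => rw [mk_add_mid]; exact Submodule.add_mem _ hp hq
    | monomial s c =>
      induction exterior_mem_span_oddProd x using Submodule.span_induction with
      | zero =>
        rw [show fmk f (MvPolynomial.monomial s c) 0 = 0 from TensorProduct.tmul_zero _ _]
        exact Submodule.zero_mem _
      | add a b _ _ ha hb => rw [mk_add]; exact Submodule.add_mem _ ha hb
      | smul r a _ ha => rw [mk_smul]; exact Submodule.smul_mem _ _ ha
      | mem y hy =>
        obtain ⟨l, rfl⟩ := hy
        -- The generators of `funDeg` have monomials with coefficient `1`, so the scalar is moved
        -- into the smooth factor.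
        have : fmk f (MvPolynomial.monomial s c) (oddProd l) =
            fmk (c • f) (MvPolynomial.monomial s 1) (oddProd l) := by
          have h1 : MvPolynomial.monomial s c = c • MvPolynomial.monomial s (1 : ℝ) := by
            rw [MvPolynomial.smul_monomial]; simp
          rw [h1]
          exact congrArg (· ⊗ₜ[ℝ] (oddProd l)) (TensorProduct.smul_tmul _ _ _).symm
        rw [this]
        exact Submodule.subset_span ⟨_, fmk_mem_funDeg _ s l rfl⟩

theorem one_mem_funDeg : (1 : V.Fun) ∈ V.funDeg 0 := by
  have := fmk_mem_funDeg (1 : SmoothFun V.U) 0 [] (k := 0) (by simp [weight])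
  simpa [oddProd, one_eq_fmk] using this

theorem mul_mem_funDeg {k l : ℤ} {a b : V.Fun} (ha : a ∈ V.funDeg k) (hb : b ∈ V.funDeg l) :
    a * b ∈ V.funDeg (k + l) := by
  refine funDeg_induction (p := fun a => a * b ∈ V.funDeg (k + l)) ha ?_ (by simp)
    (fun x y hx hy => by rw [add_mul]; exact Submodule.add_mem _ hx hy)
    (fun c x hx => by rw [smul_mul_assoc]; exact Submodule.smul_mem _ _ hx)
  intro f s m hk
  refine funDeg_induction (p := fun b => _ * b ∈ V.funDeg (k + l)) hb ?_ (by simp)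
    (fun x y hx hy => by rw [mul_add]; exact Submodule.add_mem _ hx hy)
    (fun c x hx => by rw [mul_smul_comm]; exact Submodule.smul_mem _ _ hx)
  intro g t m' hl
  rw [mk_mul_fmk, MvPolynomial.monomial_mul, one_mul, ← oddProd_append]
  exact fmk_mem_funDeg _ _ _ (by rw [weight_add_append]; push_cast; omega)

theorem involute_oddProd (l : List V.OddCoord) :
    CliffordAlgebra.involute (oddProd l) =
      ((-1 : ℤ) ^ (l.map fun A => A.1.deg).sum) • oddProd l := by
  induction l with
  | nil => simp [oddProd]
  | cons A l ih =>
    have : CliffordAlgebra.involute (ExteriorAlgebra.ι ℝ (Pi.single A (1 : ℝ) : V.OddCoord → ℝ)) =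
      -ExteriorAlgebra.ι ℝ (Pi.single A (1 : ℝ) : V.OddCoord → ℝ) := CliffordAlgebra.involute_ι _
    rw [oddProd_cons, map_mul, ih, this, List.map_cons, List.sum_cons, pow_add, A.2.neg_one_pow]
    rw [neg_one_mul, neg_smul, neg_mul, mul_smul_comm]

theorem parity_of_mem_funDeg {k : ℤ} {z : V.Fun} (hz : z ∈ V.funDeg k) :
    V.parity z = (k.negOnePow : ℤ) • z := by
  refine funDeg_induction (p := fun z => V.parity z = (k.negOnePow : ℤ) • z) hz ?_ (by simp)
    (fun x y hx hy => by rw [map_add, smul_add, hx, hy])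
    (fun c x hx => by rw [map_smul, hx, smul_comm])
  rintro f s l rfl
  have he : Even (s.sum fun A e => e * A.1.deg) :=
    Finset.even_sum _ fun A _ => (Nat.not_odd_iff_even.mp A.2.2).mul_left _
  rw [parity_fmk, involute_oddProd, negOnePow_natCast, weight, pow_add, he.neg_one_pow, one_mul]
  rcases neg_one_pow_eq_or ℤ (l.map fun A => A.1.deg).sum with h | h
  · rw [h, one_smul, one_smul]
  · rw [h, neg_one_smul, neg_one_smul, mk_neg]

theorem parity_pow_mem_funDeg {k : ℤ} {z : V.Fun} (hz : z ∈ V.funDeg k) (j : ℕ) :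
    (V.parity ^ j) z ∈ V.funDeg k := by
  induction j with
  | zero => exact hz
  | succ j ih =>
    rw [pow_succ', Module.End.mul_apply, parity_of_mem_funDeg ih]
    exact Submodule.smul_of_tower_mem _ _ ih

theorem deriv_mem_funDeg (A : V.Coords) {k : ℤ} {z : V.Fun} (hz : z ∈ V.funDeg k) :
    V.deriv A z ∈ V.funDeg (k - A.deg) := by
  refine funDeg_induction (p := fun z => V.deriv A z ∈ V.funDeg (k - A.deg)) hz ?_ (by simp)
    (fun x y hx hy => by rw [map_add]; exact Submodule.add_mem _ hx hy)
    (fun c x hx => by rw [map_smul]; exact Submodule.smul_mem _ _ hx)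
  rintro f s l rfl
  clear hz
  rcases coord_trichotomy A with h | h | h
  · rw [deriv_fmk_base h]
    exact fmk_mem_funDeg _ _ _ (by simp [h])
  · rw [deriv_fmk_odd h]
    induction l with
    | nil =>
      have : CliffordAlgebra.contractLeft (LinearMap.proj (⟨A, h⟩ : V.OddCoord))
          (oddProd ([] : List V.OddCoord)) = 0 := by
        simp [oddProd]
      rw [this, show ∀ p, fmk f p 0 = 0 from fun _ => TensorProduct.tmul_zero _ _]
      exact Submodule.zero_mem _
    | cons B l ih =>
      have h1 := CliffordAlgebra.contractLeft_ι_mul (Q := (0 : QuadraticForm ℝ (V.OddCoord → ℝ)))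
        (d := LinearMap.proj (⟨A, h⟩ : V.OddCoord))
        (Pi.single B (1 : ℝ)) (oddProd l)
      rw [oddProd_cons, show ∀ v, ExteriorAlgebra.ι ℝ v = CliffordAlgebra.ι _ v from fun _ => rfl,
        h1, sub_eq_add_neg (_ • _), mk_add, mk_neg, mk_smul]
      refine Submodule.add_mem _ ?_ (Submodule.neg_mem _ ?_)
      · by_cases hB : (⟨A, h⟩ : V.OddCoord) = B
        · refine Submodule.smul_mem _ _ (fmk_mem_funDeg _ _ _ ?_)
          rw [weight_cons, ← hB]; push_cast; ring
        · rw [LinearMap.proj_apply, Pi.single_eq_of_ne hB, zero_smul]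
          exact Submodule.zero_mem _
      -- This part of the contraction is the coordinate `B` times the contraction of the shorter
      -- product, so its degree follows from the induction hypothesis and multiplicativity.
      · have h2 : fmk (1 : SmoothFun V.U) 1 (CliffordAlgebra.ι _ (Pi.single B (1 : ℝ))) ∈
            V.funDeg B.1.deg := by
          have := fmk_mem_funDeg (1 : SmoothFun V.U) 0 [B] (k := B.1.deg) (by simp [weight])
          simpa [oddProd] using this
        have h3 := mul_mem_funDeg h2 ih
        rw [mk_mul_fmk, one_mul, one_mul] at h3
        convert h3 using 2
        rw [weight_cons]; push_cast; ring
  · rw [deriv_fmk_even h, MvPolynomial.pderiv_monomial, one_mul]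
    by_cases hs : s ⟨A, h⟩ = 0
    · rw [hs, Nat.cast_zero, map_zero, show ∀ f x, fmk (V := V) f 0 x = 0 from fun f x =>
        (congrArg (· ⊗ₜ[ℝ] x) (TensorProduct.tmul_zero _ f)).trans (TensorProduct.zero_tmul _ _)]
      exact Submodule.zero_mem _
    · have h1 : MvPolynomial.monomial (s - Finsupp.single ⟨A, h⟩ 1) (s ⟨A, h⟩ : ℝ) =
          (s ⟨A, h⟩ : ℝ) • MvPolynomial.monomial (s - Finsupp.single ⟨A, h⟩ 1) (1 : ℝ) := by
        rw [MvPolynomial.smul_monomial]; simp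
      have h2 : ∀ p : MvPolynomial V.EvenCoord ℝ, ∀ c : ℝ, fmk f (c • p) (oddProd l) =
          c • fmk f p (oddProd l) := fun p c =>
        (congrArg (· ⊗ₜ[ℝ] (oddProd l)) (TensorProduct.tmul_smul c f p)).trans
          (TensorProduct.smul_tmul' _ _ _).symm
      rw [h1, h2]
      refine Submodule.smul_mem _ _ (fmk_mem_funDeg _ _ _ ?_)
      have h3 : s - Finsupp.single ⟨A, h⟩ 1 + Finsupp.single ⟨A, h⟩ 1 = s :=
        tsub_add_cancel_of_le (by
          rw [Finsupp.single_le_iff]; omega)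
      have h4 := weight_add_append (s - Finsupp.single ⟨A, h⟩ 1) (Finsupp.single ⟨A, h⟩ 1) l []
      rw [h3, List.append_nil] at h4
      have h5 : weight (Finsupp.single (⟨A, h⟩ : V.EvenCoord) 1) [] = A.deg := by
        simp [weight]
      rw [h4, h5]; push_cast; ring

theorem isParityGrading_schoutenDeg : IsParityGrading V.schoutenDeg V.schoutenParity where
  parity_apply := by
    intro k w hw
    rw [schoutenParity, LinearMap.smul_apply, parity_of_mem_funDeg hw, Int.negOnePow_add]
    rcases Nat.even_or_odd n with h | h
    · rw [h.neg_one_pow, one_smul, Int.negOnePow_even (n : ℤ) (by exact_mod_cast h), mul_one]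
    · rw [h.neg_one_pow, Int.negOnePow_odd (n : ℤ) (by exact_mod_cast h)]
      simp
  span_eq_top := by
    rw [← span_funDeg]
    congr 1
    ext w
    constructor
    · rintro ⟨k, hk⟩; exact ⟨_, hk⟩
    · rintro ⟨k, hk⟩
      refine ⟨k - n, ?_⟩
      change w ∈ V.funDeg (k - n + n)
      rwa [sub_add_cancel]

end DarbouxChart

/-! ### Products of lists under permutations -/

theorem prod_ofFn_swap_succ {A : Type} [Ring A] {m : ℕ} (y : Fin (m + 1) → A) (i : Fin m) (c : ℤ)
    (h : y i.succ * y i.castSucc = c • (y i.castSucc * y i.succ)) :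
    (List.ofFn fun j => y (Equiv.swap i.castSucc i.succ j)).prod = c • (List.ofFn y).prod := by
  induction m with
  | zero => exact i.elim0
  | succ m ih =>
    induction i using Fin.cases with
    | zero =>
      have h0 : Equiv.swap (Fin.castSucc (0 : Fin (m + 1))) (Fin.succ 0) 0 = Fin.succ 0 := by
        exact Equiv.swap_apply_left _ _
      have h1 : Equiv.swap (Fin.castSucc (0 : Fin (m + 1))) (Fin.succ 0) (Fin.succ 0) = 0 :=
        Equiv.swap_apply_right _ _
      have h2 : ∀ j : Fin m, Equiv.swap (Fin.castSucc (0 : Fin (m + 1))) (Fin.succ 0) j.succ.succ =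
          j.succ.succ := fun j => Equiv.swap_apply_of_ne_of_ne (by simp [Fin.ext_iff])
            (by simp [Fin.ext_iff])
      simp only [List.ofFn_succ, List.prod_cons, h0, h1, h2, ← mul_assoc]
      rw [show y (Fin.succ 0) * y 0 = c • (y 0 * y (Fin.succ 0)) from h, smul_mul_assoc]
    | succ i =>
      have h0 : Equiv.swap i.succ.castSucc i.succ.succ 0 = 0 :=
        Equiv.swap_apply_of_ne_of_ne (by simp [Fin.ext_iff]) (by simp [Fin.ext_iff])
      have h1 : ∀ j : Fin (m + 1), Equiv.swap i.succ.castSucc i.succ.succ j.succ =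
          (Equiv.swap i.castSucc i.succ j).succ := by
        intro j
        rw [← Fin.succ_castSucc]
        exact ((Fin.succ_injective _).map_swap i.castSucc i.succ j).symm
      rw [List.ofFn_succ, List.prod_cons, h0]
      simp only [h1]
      rw [ih (fun j => y j.succ) i h, List.ofFn_succ (f := y), List.prod_cons, mul_smul_comm]

theorem prod_ofFn_perm {A : Type} [Ring A] {k : ℕ} (y : Fin k → A) (p : ℕ)
    (h : ∀ i j, y i * y j = ((-1 : ℤ) ^ p) • (y j * y i)) (τ : Equiv.Perm (Fin k)) :
    (List.ofFn fun j => y (τ j)).prod = ((Equiv.Perm.sign τ : ℤ) ^ p) • (List.ofFn y).prod := by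
  cases k with
  | zero => rw [Subsingleton.elim τ 1]; simp
  | succ k =>
    induction τ using perm_induction_swap_succ with
    | h1 => simp
    | hs σ i ih =>
      have := prod_ofFn_swap_succ (fun j => y (σ j)) i ((-1) ^ p) (h _ _)
      simp only [Equiv.Perm.mul_apply]
      rw [this, ih, smul_smul, map_mul, sign_swap_castSucc_succ, Units.val_mul, mul_pow, mul_comm]
      simp

theorem MultilinearMap.apply_eq_smul_of_eq {W M : Type} [AddCommGroup W] [Module ℝ W]
    [AddCommGroup M] [Module ℝ M] {N : ℕ} (θ : MultilinearMap ℝ (fun _ : Fin N => W) M)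
    {v v' : Fin N → W} (i : Fin N) (c : ℤ) (hi : v i = c • v' i) (h : ∀ j, j ≠ i → v j = v' j) :
    θ v = c • θ v' := by
  have : v = Function.update v' i ((c : ℝ) • v' i) := by
    funext j
    by_cases hj : j = i
    · subst hj; rw [Function.update_self, hi, Int.cast_smul_eq_zsmul]
    · rw [Function.update_of_ne hj, h j hj]
  rw [this, θ.map_update_smul, Function.update_eq_self, Int.cast_smul_eq_zsmul]

namespace DarbouxChart

variable {n : ℕ} {V : DarbouxChart n}

/-! ### Precomposition of multilinear maps with operators on tensors -/

abbrev MLMap (V : DarbouxChart n) (N : ℕ) : Type := MultilinearMap ℝ (fun _ : Fin N => V.Fun) V.Fun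

abbrev TensorEnd (V : DarbouxChart n) (N : ℕ) : Type := Module.End ℝ (⨂[ℝ] _ : Fin N, V.Fun)

/-- The multilinear map `θ ∘ X`. -/
def pre {N : ℕ} (θ : MLMap V N) (X : TensorEnd V N) : MLMap V N :=
  (PiTensorProduct.lift θ ∘ₗ X).compMultilinearMap (PiTensorProduct.tprod ℝ)

theorem pre_apply {N : ℕ} (θ : MLMap V N) (X : TensorEnd V N) (w : Fin N → V.Fun) :
    pre θ X w = PiTensorProduct.lift θ (X (PiTensorProduct.tprod ℝ w)) := rfl

theorem lift_pre {N : ℕ} (θ : MLMap V N) (X : TensorEnd V N) :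
    PiTensorProduct.lift (pre θ X) = PiTensorProduct.lift θ ∘ₗ X :=
  PiTensorProduct.ext (by ext w; simp [pre_apply])

/-- Precomposition is a right action of the operators. Products over edges can therefore be treated
one edge at a time, by induction with `θ` arbitrary. -/
theorem pre_mul {N : ℕ} (θ : MLMap V N) (X Y : TensorEnd V N) :
    pre θ (X * Y) = pre (pre θ X) Y := by
  ext w
  rw [pre_apply, pre_apply, lift_pre]
  rfl

theorem pre_one {N : ℕ} (θ : MLMap V N) : pre θ 1 = θ := by
  ext w
  rw [pre_apply]
  simp

/-- `pre` as a bilinear map. -/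
def preₗ (N : ℕ) : MLMap V N →ₗ[ℝ] TensorEnd V N →ₗ[ℝ] MLMap V N :=
  LinearMap.mk₂ ℝ pre
    (fun θ θ' X => by ext w; simp [pre_apply])
    (fun c θ X => by ext w; simp [pre_apply])
    (fun θ X Y => by ext w; simp [pre_apply])
    (fun c θ X => by ext w; simp [pre_apply])

theorem preₗ_apply {N : ℕ} (θ : MLMap V N) (X : TensorEnd V N) : preₗ N θ X = pre θ X := rfl

/-- The factors of `derivAt i A`. -/
def derivFam {N : ℕ} (i : Fin N) (A : V.Coords) (j : Fin N) : V.Fun →ₗ[ℝ] V.Fun :=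
  if j < i then V.parity ^ A.deg else if j = i then V.deriv A else LinearMap.id

theorem derivAt_eq {N : ℕ} (i : Fin N) (A : V.Coords) :
    V.derivAt i A = PiTensorProduct.map (derivFam i A) := rfl

theorem derivFam_lt {N : ℕ} {i j : Fin N} (h : j < i) (A : V.Coords) :
    derivFam i A j = V.parity ^ A.deg := if_pos h

theorem derivFam_self {N : ℕ} (i : Fin N) (A : V.Coords) : derivFam i A i = V.deriv A := by
  simp [derivFam]

theorem derivFam_gt {N : ℕ} {i j : Fin N} (h : i < j) (A : V.Coords) :
    derivFam i A j = LinearMap.id := by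
  simp [derivFam, h.ne', h.le]

theorem pre_derivAt {N : ℕ} (θ : MLMap V N) (i : Fin N) (A : V.Coords) :
    pre θ (V.derivAt i A) = θ.compLinearMap (derivFam i A) := by
  ext w
  rw [pre_apply, derivAt_eq, PiTensorProduct.map_tprod, PiTensorProduct.lift.tprod]
  rfl

theorem pre_derivAt_apply {N : ℕ} (θ : MLMap V N) (i : Fin N) (A : V.Coords)
    (w : Fin N → V.Fun) :
    pre θ (V.derivAt i A) w = θ fun j => derivFam i A j (w j) := by
  rw [pre_derivAt]; rfl

/-! ### Commutation relations -/

theorem deriv_parity_pow (A : V.Coords) (k : ℕ) (a : V.Fun) :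
    V.deriv A ((V.parity ^ k) a) = ((-1 : ℝ) ^ (A.deg * k)) • (V.parity ^ k) (V.deriv A a) := by
  induction k with
  | zero => simp
  | succ k ih =>
    rw [pow_succ', Module.End.mul_apply, deriv_parity, ih, Module.End.mul_apply, map_smul,
      smul_smul, ← pow_add]
    congr 2
    ring

theorem tensorMap_eq_smul {N : ℕ} (F G : Fin N → (V.Fun →ₗ[ℝ] V.Fun)) (i : Fin N) (c : ℝ)
    (hi : F i = c • G i) (h : ∀ j, j ≠ i → F j = G j) :
    PiTensorProduct.map F = c • PiTensorProduct.map G := by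
  have : F = Function.update G i (c • G i) := by
    funext j
    by_cases hj : j = i
    · subst hj; rw [Function.update_self, hi]
    · rw [Function.update_of_ne hj, h j hj]
  rw [this, PiTensorProduct.map_update_smul, Function.update_eq_self]

/-- The two products of tensor operators differ in slot `i` only. There `∂_A` meets `∂_B` if `i =
j`, and otherwise the parity operator that `∂_B` leaves in the slots before `j`; both exchanges cost
`(-1)^(|A||B|)`. -/
theorem derivAt_comm_of_le {N : ℕ} {i j : Fin N} (h : i ≤ j) (A B : V.Coords) :
    V.derivAt i A * V.derivAt j B =
      ((-1 : ℝ) ^ (A.deg * B.deg)) • (V.derivAt j B * V.derivAt i A) := by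
  rw [derivAt_eq, derivAt_eq, ← PiTensorProduct.map_mul, ← PiTensorProduct.map_mul]
  have hpar : (V.parity ^ A.deg) * (V.parity ^ B.deg) = (V.parity ^ B.deg) * (V.parity ^ A.deg) :=
    pow_mul_comm _ _ _
  refine tensorMap_eq_smul _ _ i _ ?_ ?_
  · rcases h.eq_or_lt with rfl | h
    · ext a
      simp only [derivFam_self, Module.End.mul_apply, LinearMap.smul_apply]
      exact deriv_comm A B a
    · ext a
      simp only [derivFam_self, derivFam_lt h, Module.End.mul_apply, LinearMap.smul_apply]
      exact deriv_parity_pow A _ a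
  · intro l hl
    rcases lt_or_gt_of_ne hl with hl | hl
    · rw [derivFam_lt hl, derivFam_lt (hl.trans_le h), hpar]
    · rw [derivFam_gt hl]
      rfl

theorem derivAt_comm {N : ℕ} (i j : Fin N) (A B : V.Coords) :
    V.derivAt i A * V.derivAt j B =
      ((-1 : ℝ) ^ (A.deg * B.deg)) • (V.derivAt j B * V.derivAt i A) := by
  rcases le_total i j with h | h
  · exact derivAt_comm_of_le h A B
  · rw [derivAt_comm_of_le h B A, smul_smul, ← pow_add, mul_comm B.deg,
      (Even.neg_one_pow (Even.add_self _) : (-1 : ℝ) ^ (_ + _) = 1), one_smul]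

theorem deg_add_deg_of_coeff_ne_zero {A B : V.Coords} (h : V.coeff A B ≠ 0) :
    A.deg + B.deg = n := by
  cases A <;> cases B <;> simp only [coeff, ne_eq, not_true_eq_false] at h <;> simp only [Coord.deg]
  · omega
  · omega
  · rename_i i α j β
    have hij : (⟨i, α⟩ : Σ i, Fin (V.r i)) = ⟨j, β⟩ := by
      by_contra hc; exact h (if_neg hc)
    have := congrArg Sigma.fst hij
    simp only at this
    subst this
    have := i.2
    omega
  · rename_i i α j β
    have hij : (⟨i, α⟩ : Σ i, Fin (V.r i)) = ⟨j, β⟩ := by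
      by_contra hc; exact h (if_neg hc)
    have := congrArg Sigma.fst hij
    simp only at this
    subst this
    have := i.2
    omega
  · rename_i a b
    rcases Nat.even_or_odd n with hn | hn
    · obtain ⟨m, rfl⟩ := hn; omega
    · have ha := a.2
      have hq := V.q_odd hn
      omega

theorem κ_inv_symm (a b : Fin V.q) : V.κ⁻¹ b a = -(-1) ^ (n / 2) * V.κ⁻¹ a b := by
  have h1 : V.κ.transpose = (-(-1) ^ (n / 2) : ℝ) • V.κ := by
    ext i j
    rw [Matrix.transpose_apply, Matrix.smul_apply, smul_eq_mul]
    exact V.κ_symm j i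
  have h2 : ((-(-1) ^ (n / 2) : ℝ)) * (-(-1) ^ (n / 2)) = 1 := by
    rw [neg_mul_neg, ← mul_pow]; simp
  have h3 : V.κ⁻¹.transpose = (-(-1) ^ (n / 2) : ℝ) • V.κ⁻¹ := by
    rw [Matrix.transpose_nonsing_inv, h1]
    refine Matrix.inv_eq_left_inv ?_
    rw [Matrix.smul_mul, Matrix.mul_smul, smul_smul, h2, one_smul,
      Matrix.nonsing_inv_mul _ V.κ_nondeg]
  exact congrFun (congrFun h3 a) b

/-- The graded symmetry of the bivector. The signs `ε_k`, the sign in front of `∂_p ∂_x` and the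
symmetry of `κ` are chosen so that every family of coordinates yields the same factor `(-1)^(n+1) =
(-1)^d`. -/
theorem coeff_swap (A B : V.Coords) :
    V.coeff B A * (-1) ^ (A.deg * B.deg) = (-1) ^ (n + 1) * V.coeff A B := by
  have hodd : ∀ i : Fin ((n - 1) / 2), (if Even n then -(-1 : ℝ) ^ (i.val + 1) else 1) *
      (-1) ^ ((i.val + 1) * (n - (i.val + 1))) = (-1) ^ (n + 1) := by
    intro i
    have hi := i.2
    split_ifs with hn
    · have h1 : Odd (n + 1) := hn.add_one
      rw [h1.neg_one_pow]
      rcases Nat.even_or_odd (i.val + 1) with h | h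
      · rw [h.neg_one_pow, (h.mul_right _).neg_one_pow]; norm_num
      · have h2 : Odd (n - (i.val + 1)) := Nat.Even.sub_odd (by omega) hn h
        rw [h.neg_one_pow, (h.mul h2).neg_one_pow]; norm_num
    · rw [Nat.not_even_iff_odd] at hn
      have h1 : Even (n + 1) := hn.add_one
      rw [h1.neg_one_pow]
      rcases Nat.even_or_odd (i.val + 1) with h | h
      · rw [(h.mul_right _).neg_one_pow]; norm_num
      · have h2 : Even (n - (i.val + 1)) := Nat.Odd.sub_odd hn h
        rw [(h2.mul_left _).neg_one_pow]; norm_num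
  have hsq : ((-1 : ℝ) ^ (n + 1)) * (-1) ^ (n + 1) = 1 := by rw [← mul_pow]; simp
  have hif : (if Even n then (-1 : ℝ) else 1) = (-1) ^ (n + 1) := by
    split_ifs with hn
    · exact (hn.add_one.neg_one_pow).symm
    · exact ((Nat.not_even_iff_odd.mp hn).add_one.neg_one_pow).symm
  cases A <;> cases B <;> simp only [coeff, zero_mul, mul_zero, Coord.deg, hif]
  · rename_i μ ν
    by_cases h : μ = ν
    · simp [h]
    · rw [if_neg h, if_neg (Ne.symm h)]; simp
  · rename_i μ ν
    by_cases h : μ = ν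
    · simp [h, hsq]
    · rw [if_neg h, if_neg (Ne.symm h)]; simp
  · rename_i i α j β
    by_cases h : (⟨i, α⟩ : Σ i, Fin (V.r i)) = ⟨j, β⟩
    · rw [if_pos h, if_pos h.symm]
      have := congrArg Sigma.fst h
      simp only at this
      subst this
      rw [hodd, mul_one]
    · rw [if_neg h, if_neg (Ne.symm h)]; simp
  · rename_i i α j β
    by_cases h : (⟨i, α⟩ : Σ i, Fin (V.r i)) = ⟨j, β⟩
    · rw [if_pos h, if_pos h.symm]
      have := congrArg Sigma.fst h
      simp only at this
      subst this
      rw [← hodd i, mul_comm (n - (i.val + 1))]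
      split_ifs
      · rw [mul_right_comm, neg_mul_neg, ← pow_add, Even.neg_one_pow (Even.add_self _), one_mul]
      · simp
    · rw [if_neg h, if_neg (Ne.symm h)]; simp
  · rename_i a b
    rcases Nat.even_or_odd n with hn | hn
    · rw [κ_inv_symm, hn.add_one.neg_one_pow]
      rcases Nat.even_or_odd (n / 2) with h | h
      · rw [h.neg_one_pow, (h.mul_right _).neg_one_pow]; ring
      · rw [h.neg_one_pow, (h.mul h).neg_one_pow]; ring
    · have ha := a.2
      have hq := V.q_odd hn
      omega

theorem edgeOp_swap {N : ℕ} (i j : Fin N) :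
    V.edgeOp j i = ((-1 : ℤ) ^ (n + 1)) • V.edgeOp i j := by
  rw [← Int.cast_smul_eq_zsmul ℝ]
  unfold edgeOp
  rw [Finset.sum_comm, Finset.smul_sum]
  refine Finset.sum_congr rfl fun A _ => ?_
  rw [Finset.smul_sum]
  refine Finset.sum_congr rfl fun B _ => ?_
  rw [derivAt_comm j i, smul_smul, mul_comm B.deg, coeff_swap, ← smul_smul]
  push_cast
  rfl

/-- Each term of `Δ_ij` has derivatives of total degree `n`, so exchanging two of them costs
`(-1)^(n·n) = (-1)^n`. As `d + 1 = n + 2`, this is the sign for exchanging two edges in `Gra_d`. -/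
theorem edgeOp_comm {N : ℕ} (i j k l : Fin N) :
    V.edgeOp i j * V.edgeOp k l = ((-1 : ℤ) ^ n) • (V.edgeOp k l * V.edgeOp i j) := by
  have h : ∀ A B C D : V.Coords,
      (V.coeff A B • (V.derivAt i A * V.derivAt j B)) *
        (V.coeff C D • (V.derivAt k C * V.derivAt l D)) =
      ((-1 : ℝ) ^ n) • ((V.coeff C D • (V.derivAt k C * V.derivAt l D)) *
        (V.coeff A B • (V.derivAt i A * V.derivAt j B))) := by
    intro A B C D
    by_cases h1 : V.coeff A B = 0
    · simp [h1]
    by_cases h2 : V.coeff C D = 0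
    · simp [h2]
    have e1 := deg_add_deg_of_coeff_ne_zero h1
    have e2 := deg_add_deg_of_coeff_ne_zero h2
    have e3 : (V.derivAt i A * V.derivAt j B) * (V.derivAt k C * V.derivAt l D) =
        ((-1 : ℝ) ^ n) • ((V.derivAt k C * V.derivAt l D) * (V.derivAt i A * V.derivAt j B)) := by
      calc (V.derivAt i A * V.derivAt j B) * (V.derivAt k C * V.derivAt l D)
          = V.derivAt i A * (V.derivAt j B * V.derivAt k C) * V.derivAt l D := by
            simp only [mul_assoc]
        _ = ((-1 : ℝ) ^ (B.deg * C.deg)) •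
            ((V.derivAt i A * V.derivAt k C) * (V.derivAt j B * V.derivAt l D)) := by
            rw [derivAt_comm j k]
            simp only [mul_assoc, mul_smul_comm, smul_mul_assoc]
        _ = ((-1 : ℝ) ^ (B.deg * C.deg + A.deg * C.deg + B.deg * D.deg)) •
            (V.derivAt k C * (V.derivAt i A * V.derivAt l D) * V.derivAt j B) := by
            rw [derivAt_comm i k, derivAt_comm j l]
            simp only [mul_assoc, mul_smul_comm, smul_mul_assoc, smul_smul, pow_add]
            congr 1
            ring
        _ = ((-1 : ℝ) ^ (B.deg * C.deg + A.deg * C.deg + B.deg * D.deg + A.deg * D.deg)) •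
            ((V.derivAt k C * V.derivAt l D) * (V.derivAt i A * V.derivAt j B)) := by
            rw [derivAt_comm i l]
            simp only [mul_assoc, mul_smul_comm, smul_mul_assoc, smul_smul, pow_add]
        _ = _ := by
            have : B.deg * C.deg + A.deg * C.deg + B.deg * D.deg + A.deg * D.deg = n * n := by
              calc _ = (A.deg + B.deg) * (C.deg + D.deg) := by ring
                _ = n * n := by rw [e1, e2]
            rw [this]
            congr 1
            rcases Nat.even_or_odd n with hn | hn
            · rw [hn.neg_one_pow, (hn.mul_left n).neg_one_pow]
            · rw [hn.neg_one_pow, (hn.mul hn).neg_one_pow]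
    rw [smul_mul_smul_comm, smul_mul_smul_comm, e3, smul_comm, mul_comm (V.coeff A B)]
  rw [← Int.cast_smul_eq_zsmul ℝ]
  push_cast
  unfold edgeOp
  rw [Finset.sum_mul, Finset.mul_sum, Finset.smul_sum]
  refine Finset.sum_congr rfl fun A _ => ?_
  rw [Finset.sum_mul, Finset.mul_sum, Finset.smul_sum]
  refine Finset.sum_congr rfl fun B _ => ?_
  rw [Finset.sum_mul, Finset.mul_sum, Finset.smul_sum]
  refine Finset.sum_congr rfl fun C _ => ?_
  rw [Finset.sum_mul, Finset.mul_sum, Finset.smul_sum]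
  exact Finset.sum_congr rfl fun D _ => h A B C D

/-- The product of the operators attached to the edges. -/
def edgesOp {N k : ℕ} (Γ : Multidigraph N k) : TensorEnd V N :=
  (List.ofFn fun e => V.edgeOp (Γ e).1 (Γ e).2).prod

theorem edgesOp_perm {N k : ℕ} (Γ : Multidigraph N k) (τ : Equiv.Perm (Fin k)) :
    edgesOp (V := V) (Γ ∘ τ) = ((Equiv.Perm.sign τ : ℤ) ^ n) • edgesOp Γ :=
  prod_ofFn_perm (fun e => V.edgeOp (Γ e).1 (Γ e).2) n (fun _ _ => edgeOp_comm _ _ _ _) τ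

theorem prod_ofFn_update_smul {A : Type} [Ring A] {k : ℕ} (y y' : Fin k → A) (e : Fin k) (c : ℤ)
    (he : y' e = c • y e) (h : ∀ j, j ≠ e → y' j = y j) :
    (List.ofFn y').prod = c • (List.ofFn y).prod := by
  induction k with
  | zero => exact e.elim0
  | succ k ih =>
    rw [List.ofFn_succ, List.ofFn_succ, List.prod_cons, List.prod_cons]
    induction e using Fin.cases with
    | zero =>
      rw [he, smul_mul_assoc]
      congr 4
      funext j
      exact h _ (Fin.succ_ne_zero j)
    | succ e =>
      rw [h 0 (Fin.succ_ne_zero e).symm, ih (fun j => y j.succ) (fun j => y' j.succ) e he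
        (fun j hj => h _ fun hc => hj (Fin.succ_injective _ hc)), mul_smul_comm]

theorem edgesOp_flip {N k : ℕ} (Γ : Multidigraph N k) (e : Fin k) :
    edgesOp (V := V) (Γ.flip e) = ((-1 : ℤ) ^ (n + 1)) • edgesOp Γ := by
  refine prod_ofFn_update_smul _ _ e _ ?_ ?_
  · simp [Multidigraph.flip, edgeOp_swap (Γ e).1]
  · intro j hj
    simp [Multidigraph.flip, Function.update_of_ne hj]

/-- Multiplication of `N` functions. -/
abbrev mulN (V : DarbouxChart n) (N : ℕ) : MLMap V N := MultilinearMap.mkPiAlgebraFin ℝ N V.Fun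

theorem rep_eq {N k : ℕ} (Γ : Multidigraph N k) : V.rep Γ = pre (mulN V N) (edgesOp Γ) := rfl

variable (V) in
/-- The operations on functions given by the elements of `Gra`. -/
def graRep (a : ℕ) : Gra (n + 1) (a + 1) →ₗ[ℝ] MLMap V (a + 1) :=
  Gra.lift (fun _ Γ => V.rep Γ)
    (fun _ Γ τ => by
      rw [rep_eq, edgesOp_perm, ← preₗ_apply, map_zsmul, preₗ_apply, rep_eq]
      congr 1
      -- Here `d + 1 = n + 2`, and the square of a sign is `1`.
      rw [pow_add, pow_add, pow_one, mul_assoc, ← Units.val_mul, ← sq, Int.units_sq]; simp)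
    (fun _ Γ e => by
      rw [rep_eq, edgesOp_flip, ← preₗ_apply, map_zsmul, preₗ_apply, rep_eq])

theorem graRep_mk {a k : ℕ} (Γ : Multidigraph (a + 1) k) :
    graRep V a (Gra.mk (n + 1) Γ) = V.rep Γ := Gra.lift_mk _ _ _ Γ

end DarbouxChart

theorem Gra.relabel_mk (d : ℕ) {N k : ℕ} (σ : Equiv.Perm (Fin N)) (Γ : Multidigraph N k) :
    Gra.relabel d σ (Gra.mk d Γ) = Gra.mk d (Γ.mapVertices ⇑σ⁻¹) := Gra.lift_mk _ _ _ Γ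

theorem Gra.compFirst_mk (d : ℕ) {a b c : ℕ} (h : a + b = c) {j k : ℕ}
    (Γ : Multidigraph (a + 1) j) (Γ' : Multidigraph (b + 1) k) :
    Gra.compFirst d h (Gra.mk d Γ) (Gra.mk d Γ') = graInsert d h Γ Γ' :=
  (LinearMap.congr_fun (Gra.lift_mk _ _ _ Γ) (Gra.mk d Γ')).trans (Gra.lift_mk _ _ _ Γ')

namespace DarbouxChart

variable {n : ℕ} {V : DarbouxChart n}

theorem pre_sum_left {N : ℕ} {ι : Type} (s : Finset ι) (θ : ι → MLMap V N) (X : TensorEnd V N) :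
    pre (∑ i ∈ s, θ i) X = ∑ i ∈ s, pre (θ i) X :=
  map_sum ((preₗ N).flip X) θ s

theorem pre_zero_left {N : ℕ} (X : TensorEnd V N) : pre (0 : MLMap V N) X = 0 :=
  map_zero ((preₗ N).flip X)

/-! ### Equivariance -/

theorem parity_parity_pow (k : ℕ) (a : V.Fun) :
    V.parity ((V.parity ^ k) a) = (V.parity ^ k) (V.parity a) := by
  rw [← Module.End.mul_apply, ← Module.End.mul_apply, ← pow_succ', pow_succ]

theorem parity_deriv (A : V.Coords) {a : V.Fun} {e : Fin 2}
    (ha : V.parity a = ((-1 : ℤ) ^ e.val) • a) :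
    V.parity (V.deriv A a) = ((-1 : ℤ) ^ (parityFin (e.val + A.deg)).val) • V.deriv A a := by
  have h := deriv_parity A a
  rw [ha, map_zsmul] at h
  have h2 : V.parity (V.deriv A a) = ((-1 : ℝ) ^ A.deg) • ((-1 : ℤ) ^ e.val) • V.deriv A a := by
    rw [h, smul_smul, ← pow_add, Even.neg_one_pow (Even.add_self _), one_smul]
  rw [h2, neg_one_pow_parityFin, ← Nat.cast_add, negOnePow_natCast, pow_add, mul_comm, mul_smul,
    ← Int.cast_smul_eq_zsmul ℝ ((-1) ^ A.deg)]
  push_cast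
  rfl

theorem parity_pow_of_parity (k : ℕ) {a : V.Fun} {e : Fin 2}
    (ha : V.parity a = ((-1 : ℤ) ^ e.val) • a) :
    (V.parity ^ k) a = ((-1 : ℤ) ^ (e.val * k)) • a := by
  induction k with
  | zero => simp
  | succ k ih =>
    rw [pow_succ', Module.End.mul_apply, ih, map_zsmul, ha, smul_smul, ← pow_add]
    rfl

theorem hasParity_derivFam {N : ℕ} (i : Fin N) (A : V.Coords) {e : Fin N → Fin 2}
    {w : Fin N → V.Fun} (hw : HasParity V.parity e w) :
    HasParity V.parity (Function.update e i (parityFin ((e i).val + A.deg)))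
      fun j => derivFam i A j (w j) := by
  intro j
  change V.parity (derivFam i A j (w j)) = _ • derivFam i A j (w j)
  rcases lt_trichotomy j i with h | h | h
  · rw [Function.update_of_ne h.ne, derivFam_lt h, parity_parity_pow, hw j, map_zsmul]
  · subst h
    rw [Function.update_self, derivFam_self]
    exact parity_deriv A (hw j)
  · rw [Function.update_of_ne h.ne', derivFam_gt h]
    exact hw j

theorem neg_one_pow_parityFin_mul (m k : ℕ) (l : ℕ) :
    (-1 : ℤ) ^ ((parityFin ((m : ℤ) + k)).val * l) = (-1) ^ (m * l) * (-1) ^ (k * l) := by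
  rw [pow_mul, neg_one_pow_parityFin, ← Nat.cast_add, negOnePow_natCast, ← pow_mul, ← pow_add,
    add_mul]

theorem swap_succ_lt_iff {N : ℕ} (i : Fin N) {j l : Fin (N + 1)}
    (h : ¬ (j = i.castSucc ∧ l = i.succ)) (h' : ¬ (j = i.succ ∧ l = i.castSucc)) :
    Equiv.swap i.castSucc i.succ l < Equiv.swap i.castSucc i.succ j ↔ l < j := by
  simp only [Equiv.swap_apply_def]
  simp only [Fin.ext_iff, Fin.val_castSucc, Fin.val_succ] at h h' ⊢
  split_ifs <;> simp only [← Fin.val_fin_lt, Fin.val_castSucc, Fin.val_succ] <;> omega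

/-- The delicate case is that `j` is one of the exchanged slots. Then the derivative puts a parity
operator on the neighbouring factor on one side of the equation only, and this compensates the
Koszul sign, which changes because `∂_A` has altered the parity in slot `j`. -/
theorem permAct_pre_derivAt_swap {N : ℕ} (θ : MLMap V (N + 1)) (i : Fin N) (j : Fin (N + 1))
    (A : V.Coords) :
    permAct V.parity (pre θ (V.derivAt j A)) (Equiv.swap i.castSucc i.succ) =
      pre (permAct V.parity θ (Equiv.swap i.castSucc i.succ))
        (V.derivAt (Equiv.swap i.castSucc i.succ j) A) := by
  refine multilinear_ext_parity parity_parity fun e w hw => ?_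
  set s := Equiv.swap i.castSucc i.succ with hs
  have hinv : s⁻¹ = s := swap_castSucc_succ_inv i
  rw [pre_derivAt_apply, permAct_apply _ _ hw,
    permAct_apply _ _ (hasParity_derivFam (s j) A hw), koszulSign_swap_succ, koszulSign_swap_succ,
    pre_derivAt_apply, hinv]
  have hne : i.castSucc ≠ i.succ := by simp [Fin.ext_iff]
  have hlt : i.castSucc < i.succ := by simp [Fin.lt_def]
  have hfam : ∀ l, ¬ (j = i.castSucc ∧ l = i.succ) → ¬ (j = i.succ ∧ l = i.castSucc) →
      derivFam j A l = derivFam (s j) A (s l) := by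
    intro l h h'
    unfold derivFam
    rw [hs]
    simp only [swap_succ_lt_iff i h h', EmbeddingLike.apply_eq_iff_eq]
  by_cases h1 : j = i.castSucc
  · subst h1
    have hsj : s i.castSucc = i.succ := Equiv.swap_apply_left _ _
    have hsi : s i.succ = i.castSucc := Equiv.swap_apply_right _ _
    rw [hsj, Function.update_self, Function.update_of_ne hne, mul_comm (e i.castSucc).val,
      mul_comm (e i.castSucc).val, neg_one_pow_parityFin_mul, mul_smul]
    congr 1
    refine MultilinearMap.apply_eq_smul_of_eq θ i.succ _ ?_ ?_
    · rw [hsi, derivFam_lt hlt, derivFam_gt hlt, parity_pow_of_parity _ (hw _), smul_smul,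
        mul_comm A.deg, ← pow_add, Even.neg_one_pow (Even.add_self _), one_smul]
      rfl
    · intro l hl
      rw [hfam l (by simp [hl]) (by simp [hne]), hsj]
  · by_cases h2 : j = i.succ
    · subst h2
      have hsj : s i.succ = i.castSucc := Equiv.swap_apply_right _ _
      have hsi : s i.castSucc = i.succ := Equiv.swap_apply_left _ _
      rw [hsj, Function.update_self, Function.update_of_ne hne.symm, neg_one_pow_parityFin_mul,
        mul_smul]
      congr 1
      rw [MultilinearMap.apply_eq_smul_of_eq θ
        (v' := fun l => derivFam i.castSucc A (s l) (w (s l)))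
        i.castSucc ((-1) ^ ((e i.succ).val * A.deg)), mul_comm A.deg]
      · rw [hsi, derivFam_lt hlt, derivFam_gt hlt]
        exact parity_pow_of_parity _ (hw _)
      · intro l hl
        rw [hfam l (by simp [hne.symm]) (by simp [hl]), hsj]
    · have hsj : s j = j := Equiv.swap_apply_of_ne_of_ne h1 h2
      rw [hsj, Function.update_of_ne (Ne.symm h1), Function.update_of_ne (Ne.symm h2)]
      congr 2
      funext l
      rw [hfam l (by simp [h1]) (by simp [h2]), hsj]

theorem permAct_pre_derivAt {N : ℕ} (θ : MLMap V (N + 1)) (σ : Equiv.Perm (Fin (N + 1)))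
    (j : Fin (N + 1)) (A : V.Coords) :
    permAct V.parity (pre θ (V.derivAt j A)) σ =
      pre (permAct V.parity θ σ) (V.derivAt (σ⁻¹ j) A) := by
  induction σ using perm_induction_swap_succ with
  | h1 => rw [permAct_one parity_parity, permAct_one parity_parity]; simp
  | hs σ i ih =>
    rw [permAct_mul parity_parity, permAct_mul parity_parity, ih, permAct_pre_derivAt_swap,
      mul_inv_rev, swap_castSucc_succ_inv, Equiv.Perm.mul_apply]

theorem permAct_pre_edgeOp {N : ℕ} (θ : MLMap V (N + 1)) (σ : Equiv.Perm (Fin (N + 1)))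
    (i j : Fin (N + 1)) :
    permAct V.parity (pre θ (V.edgeOp i j)) σ =
      pre (permAct V.parity θ σ) (V.edgeOp (σ⁻¹ i) (σ⁻¹ j)) := by
  unfold edgeOp
  simp only [← preₗ_apply, map_sum, map_smul, permAct_sum, permAct_smul]
  refine Finset.sum_congr rfl fun A _ => Finset.sum_congr rfl fun B _ => ?_
  rw [preₗ_apply, pre_mul, permAct_pre_derivAt, permAct_pre_derivAt, ← pre_mul, preₗ_apply]

theorem edgesOp_succ {N k : ℕ} (Γ : Multidigraph N (k + 1)) :
    edgesOp (V := V) Γ = V.edgeOp (Γ 0).1 (Γ 0).2 * edgesOp fun e : Fin k => Γ e.succ := by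
  unfold edgesOp
  rw [List.ofFn_succ, List.prod_cons]

theorem edgesOp_zero {N : ℕ} (Γ : Multidigraph N 0) : edgesOp (V := V) Γ = 1 := by
  simp [edgesOp]

theorem permAct_pre_edgesOp {N k : ℕ} (θ : MLMap V (N + 1)) (σ : Equiv.Perm (Fin (N + 1)))
    (Γ : Multidigraph (N + 1) k) :
    permAct V.parity (pre θ (edgesOp Γ)) σ =
      pre (permAct V.parity θ σ) (edgesOp (Γ.mapVertices ⇑σ⁻¹)) := by
  induction k generalizing θ with
  | zero => rw [edgesOp_zero, edgesOp_zero, pre_one, pre_one]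
  | succ k ih =>
    rw [edgesOp_succ, edgesOp_succ, pre_mul, pre_mul, ih, permAct_pre_edgeOp]
    rfl

theorem permAct_mulN {N : ℕ} (σ : Equiv.Perm (Fin (N + 1))) :
    permAct V.parity (mulN V (N + 1)) σ = mulN V (N + 1) := by
  induction σ using perm_induction_swap_succ with
  | h1 => rw [permAct_one parity_parity]
  | hs σ i ih =>
    rw [permAct_mul parity_parity, ih]
    refine multilinear_ext_parity parity_parity fun e w hw => ?_
    rw [permAct_apply _ _ hw, koszulSign_swap_succ, swap_castSucc_succ_inv,
      MultilinearMap.mkPiAlgebraFin_apply, MultilinearMap.mkPiAlgebraFin_apply,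
      prod_ofFn_swap_succ w i ((-1) ^ ((e i.castSucc).val * (e i.succ).val)), smul_smul, ← pow_add,
      Even.neg_one_pow (Even.add_self _), one_smul]
    rw [mul_comm_of_parity _ (hw i.castSucc), parity_pow_of_parity _ (hw i.succ), mul_smul_comm,
      mul_comm (e i.succ).val]

theorem graRep_relabel {a : ℕ} (σ : Equiv.Perm (Fin (a + 1))) (z : Gra (n + 1) (a + 1)) :
    graRep V a (Gra.relabel (n + 1) σ z) = permAct V.parity (graRep V a z) σ := by
  have : graRep V a ∘ₗ Gra.relabel (n + 1) σ = permActₗ V.parity σ ∘ₗ graRep V a := by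
    refine Gra.hom_ext fun k Γ => ?_
    rw [LinearMap.comp_apply, LinearMap.comp_apply, permActₗ_apply, graRep_mk,
      Gra.relabel_mk, graRep_mk, rep_eq, rep_eq, permAct_pre_edgesOp, permAct_mulN]
  exact LinearMap.congr_fun this z

/-! ### Compositions -/

theorem mulN_apply {N : ℕ} (w : Fin N → V.Fun) : mulN V N w = (List.ofFn w).prod :=
  MultilinearMap.mkPiAlgebraFin_apply w

theorem parity_pow_mulN (k : ℕ) {N : ℕ} (w : Fin N → V.Fun) :
    (V.parity ^ k) (mulN V N w) = mulN V N fun j => (V.parity ^ k) (w j) := by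
  have h1 : (V.parity ^ k) 1 = 1 := by
    induction k with
    | zero => rfl
    | succ k ih => rw [pow_succ', Module.End.mul_apply, ih, parity_one]
  rw [mulN_apply, mulN_apply]
  induction N with
  | zero => simpa using h1
  | succ N ih =>
    rw [List.ofFn_succ, List.ofFn_succ, List.prod_cons, List.prod_cons, parity_pow_mul, ih]

/-- The iterated Leibniz rule, with the parity operators left on the factors passed over. It is the
algebraic source of the sum over reconnections in `graInsert`. -/
theorem deriv_mulN (A : V.Coords) {N : ℕ} (w : Fin N → V.Fun) :
    V.deriv A (mulN V N w) = ∑ i, mulN V N fun j => derivFam i A j (w j) := by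
  have h1 : V.deriv A 1 = 0 := by
    have := deriv_mul A (1 : V.Fun) 1
    have h1 := parity_pow_mulN (V := V) A.deg (N := 0) Fin.elim0
    simp only [mulN_apply, List.ofFn_zero, List.prod_nil] at h1
    rw [h1, one_mul, mul_one, one_mul] at this
    exact left_eq_add.mp this
  simp only [mulN_apply]
  induction N with
  | zero => simpa using h1
  | succ N ih =>
    rw [List.ofFn_succ, List.prod_cons, deriv_mul, ih, Fin.sum_univ_succ, Finset.mul_sum]
    congr 1
    · rw [List.ofFn_succ, List.prod_cons, derivFam_self]
      congr 3
    · refine Finset.sum_congr rfl fun i _ => ?_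
      rw [List.ofFn_succ, List.prod_cons, derivFam_lt (Fin.succ_pos i)]
      congr 3
      funext j
      simp [derivFam]

theorem mlCompFirst_cons {a b c : ℕ} (h : a + b = c) (f : MLMap V (a + 1)) (g : MLMap V (b + 1))
    (w : Fin (c + 1) → V.Fun) : mlCompFirst h f g w =
      f (Fin.cons (g fun i => w (insertVertex h i)) fun i => w (restVertex h i)) := by
  rw [mlCompFirst_apply, MultilinearMap.curryLeft_apply]

theorem mlCompFirst_mulN {a b c : ℕ} (h : a + b = c) :
    mlCompFirst h (mulN V (a + 1)) (mulN V (b + 1)) = mulN V (c + 1) := by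
  ext w
  rw [mlCompFirst_cons, mulN_apply, mulN_apply, mulN_apply, List.ofFn_succ, List.prod_cons]
  simp only [Fin.cons_zero, Fin.cons_succ]
  rw [← List.prod_append]
  congr 1
  subst h
  have := List.ofFn_fin_append (fun i => w (insertVertex (a := a) rfl i))
    (fun i => w (restVertex (b := b) rfl i))
  rw [← this]
  have hc : a + b + 1 = b + 1 + a := by omega
  rw [List.ofFn_congr hc]
  congr 1
  funext i
  refine Fin.addCases (fun i => ?_) (fun i => ?_) i
  · rw [Fin.append_left]; rfl
  · rw [Fin.append_right]; rfl

/-- The inserted arguments come first, so a derivative on one of them acquires no further parity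
operators in the composite. -/
theorem mlCompFirst_pre_derivAt_right {a b c : ℕ} (h : a + b = c) (f : MLMap V (a + 1))
    (g : MLMap V (b + 1)) (i : Fin (b + 1)) (A : V.Coords) :
    mlCompFirst h f (pre g (V.derivAt i A)) =
      pre (mlCompFirst h f g) (V.derivAt (insertVertex h i) A) := by
  ext w
  rw [pre_derivAt_apply, mlCompFirst_cons, mlCompFirst_cons, pre_derivAt_apply]
  have : ∀ l, insertVertex h i < restVertex h l := fun l => by
    simp only [insertVertex, restVertex, Fin.lt_def]; omega
  simp only [fun l => derivFam_gt (this l) A]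
  have h2 : ∀ l, derivFam (insertVertex h i) A (insertVertex h l) = derivFam i A l := fun l => by
    have hl : insertVertex h l < insertVertex h i ↔ l < i := Iff.rfl
    simp only [derivFam, hl, (insertVertex_injective h).eq_iff]
  simp only [h2]
  rfl

theorem collapse_insertVertex {a b c : ℕ} (h : a + b = c) (i : Fin (b + 1)) :
    collapse h (insertVertex h i) = 0 := by
  simp only [collapse, insertVertex, Fin.ext_iff, Fin.val_zero]; omega

theorem collapse_restVertex {a b c : ℕ} (h : a + b = c) (i : Fin a) :
    collapse h (restVertex h i) = i.succ := by
  simp only [collapse, restVertex, Fin.ext_iff, Fin.val_succ]; omega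

/-- A half-edge at a vertex other than the first is merely relabelled; one at the first vertex acts
on a product and is distributed over its factors by `deriv_mulN`. In both cases the result is the
sum over the preimages of the vertex under `collapse`. -/
theorem mlCompFirst_pre_derivAt_left {a b c : ℕ} (h : a + b = c) (f : MLMap V (a + 1))
    (i : Fin (a + 1)) (A : V.Coords) :
    mlCompFirst h (pre f (V.derivAt i A)) (mulN V (b + 1)) =
      ∑ i' : Fin (c + 1), if collapse h i' = i then
        pre (mlCompFirst h f (mulN V (b + 1))) (V.derivAt i' A) else 0 := by
  rw [← Equiv.sum_comp (blockEquiv h), Fintype.sum_sum_type]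
  simp only [blockEquiv_inl, blockEquiv_inr, collapse_insertVertex, collapse_restVertex]
  simp only [← mlCompFirst_pre_derivAt_right]
  ext w
  induction i using Fin.cases with
  | zero =>
    simp only [if_true, Fin.succ_ne_zero, if_false, Finset.sum_const_zero, add_zero]
    rw [sum_apply, mlCompFirst_cons, pre_derivAt_apply]
    have h1 : (fun j => derivFam 0 A j (Fin.cons (α := fun _ : Fin (a + 1) => V.Fun)
        (mulN V (b + 1) fun i => w (insertVertex h i)) (fun i => w (restVertex h i)) j)) =
        Fin.cons (α := fun _ : Fin (a + 1) => V.Fun)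
          (V.deriv A (mulN V (b + 1) fun i => w (insertVertex h i)))
          (fun i => w (restVertex h i)) := by
      funext j
      induction j using Fin.cases with
      | zero => rw [Fin.cons_zero, Fin.cons_zero, derivFam_self]
      | succ j => rw [Fin.cons_succ, Fin.cons_succ, derivFam_gt (Fin.succ_pos j)]; rfl
    rw [h1, deriv_mulN, ← MultilinearMap.curryLeft_apply, map_sum, sum_apply]
    refine Finset.sum_congr rfl fun j _ => ?_
    rw [mlCompFirst_apply, pre_derivAt_apply]
  | succ i =>
    simp only [if_neg (Fin.succ_ne_zero i).symm, Finset.sum_const_zero, zero_add, Fin.succ_inj,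
      Finset.sum_ite_eq', Finset.mem_univ, if_true]
    rw [mlCompFirst_cons, pre_derivAt_apply, pre_derivAt_apply, mlCompFirst_cons]
    congr 1
    funext j
    have hlt : ∀ l, insertVertex h l < restVertex h i := fun l => by
      simp only [insertVertex, restVertex, Fin.lt_def]; omega
    induction j using Fin.cases with
    | zero =>
      rw [Fin.cons_zero, Fin.cons_zero, derivFam_lt (Fin.succ_pos i), parity_pow_mulN]
      simp only [fun l => derivFam_lt (hlt l) A]
    | succ j =>
      rw [Fin.cons_succ, Fin.cons_succ]
      have : derivFam (V := V) i.succ A j.succ =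
          derivFam (restVertex h i) A (restVertex h j) := by
        have hl : restVertex h j < restVertex h i ↔ j.succ < i.succ := by
          simp only [restVertex, Fin.lt_def, Fin.val_succ]; omega
        simp only [derivFam, hl, (restVertex_injective h).eq_iff, Fin.succ_inj]
      rw [this]

theorem mlCompFirst_pre_edgeOp_right {a b c : ℕ} (h : a + b = c) (f : MLMap V (a + 1))
    (g : MLMap V (b + 1)) (i j : Fin (b + 1)) :
    mlCompFirst h f (pre g (V.edgeOp i j)) =
      pre (mlCompFirst h f g) (V.edgeOp (insertVertex h i) (insertVertex h j)) := by
  unfold edgeOp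
  simp only [← preₗ_apply, ← mlCompFirstₗ_apply, map_sum, map_smul]
  refine Finset.sum_congr rfl fun A _ => Finset.sum_congr rfl fun B _ => ?_
  simp only [preₗ_apply, mlCompFirstₗ_apply, pre_mul, mlCompFirst_pre_derivAt_right]

theorem mlCompFirst_pre_edgesOp_right {a b c k : ℕ} (h : a + b = c) (f : MLMap V (a + 1))
    (g : MLMap V (b + 1)) (Γ : Multidigraph (b + 1) k) :
    mlCompFirst h f (pre g (edgesOp Γ)) =
      pre (mlCompFirst h f g) (edgesOp (Γ.mapVertices (insertVertex h))) := by
  induction k generalizing g with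
  | zero => rw [edgesOp_zero, edgesOp_zero, pre_one, pre_one]
  | succ k ih =>
    rw [edgesOp_succ, edgesOp_succ, pre_mul, pre_mul, ih, mlCompFirst_pre_edgeOp_right]
    rfl

theorem mlCompFirst_pre_edgeOp_left {a b c : ℕ} (h : a + b = c) (f : MLMap V (a + 1))
    (p : Fin (a + 1) × Fin (a + 1)) :
    mlCompFirst h (pre f (V.edgeOp p.1 p.2)) (mulN V (b + 1)) =
      ∑ p' : Fin (c + 1) × Fin (c + 1), if (collapse h p'.1, collapse h p'.2) = p then
        pre (mlCompFirst h f (mulN V (b + 1))) (V.edgeOp p'.1 p'.2) else 0 := by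
  have hD : ∀ (A B : V.Coords),
      mlCompFirst h (pre f (V.derivAt p.1 A * V.derivAt p.2 B)) (mulN V (b + 1)) =
      ∑ p' : Fin (c + 1) × Fin (c + 1), if (collapse h p'.1, collapse h p'.2) = p then
        pre (mlCompFirst h f (mulN V (b + 1))) (V.derivAt p'.1 A * V.derivAt p'.2 B) else 0 := by
    intro A B
    rw [pre_mul, mlCompFirst_pre_derivAt_left, mlCompFirst_pre_derivAt_left,
      Fintype.sum_prod_type_right]
    refine Finset.sum_congr rfl fun j _ => ?_
    by_cases hj : collapse h j = p.2
    · rw [if_pos hj, pre_sum_left]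
      refine Finset.sum_congr rfl fun i _ => ?_
      by_cases hi : collapse h i = p.1
      · rw [if_pos hi, if_pos (by rw [hi, hj]), pre_mul]
      · rw [if_neg hi, if_neg (fun hc => hi (congrArg Prod.fst hc)), pre_zero_left]
    · rw [if_neg hj]
      refine (Finset.sum_eq_zero fun i _ => ?_).symm
      rw [if_neg (fun hc => hj (congrArg Prod.snd hc))]
  have h1 : mlCompFirst h (pre f (V.edgeOp p.1 p.2)) (mulN V (b + 1)) =
      ∑ A : V.Coords, ∑ B : V.Coords, V.coeff A B •
        mlCompFirst h (pre f (V.derivAt p.1 A * V.derivAt p.2 B)) (mulN V (b + 1)) := by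
    unfold edgeOp
    let Φ : TensorEnd V (a + 1) →ₗ[ℝ] MLMap V (c + 1) :=
      (mlCompFirstₗ V.Fun h).flip (mulN V (b + 1)) ∘ₗ preₗ (a + 1) f
    change Φ (∑ A : V.Coords, ∑ B : V.Coords, V.coeff A B • (V.derivAt p.1 A * V.derivAt p.2 B)) =
      ∑ A : V.Coords, ∑ B : V.Coords, V.coeff A B • Φ (V.derivAt p.1 A * V.derivAt p.2 B)
    simp only [map_sum, map_smul]
  have h2 : ∀ p' : Fin (c + 1) × Fin (c + 1),
      pre (mlCompFirst h f (mulN V (b + 1))) (V.edgeOp p'.1 p'.2) =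
      ∑ A : V.Coords, ∑ B : V.Coords, V.coeff A B •
        pre (mlCompFirst h f (mulN V (b + 1))) (V.derivAt p'.1 A * V.derivAt p'.2 B) := by
    intro p'
    unfold edgeOp
    simp only [← preₗ_apply, map_sum, map_smul]
  simp only [h1, hD, h2]
  simp only [Finset.smul_sum]
  have h3 : ∀ p' : Fin (c + 1) × Fin (c + 1), ∀ F : V.Coords → V.Coords → MLMap V (c + 1),
      (if (collapse h p'.1, collapse h p'.2) = p then ∑ A, ∑ B, F A B else 0) =
      ∑ A, ∑ B, if (collapse h p'.1, collapse h p'.2) = p then F A B else 0 := by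
    intro p' F
    split_ifs <;> simp
  simp only [h3]
  rw [Finset.sum_comm (s := (Finset.univ : Finset (Fin (c + 1) × Fin (c + 1))))]
  refine Finset.sum_congr rfl fun A _ => ?_
  rw [Finset.sum_comm (s := (Finset.univ : Finset (Fin (c + 1) × Fin (c + 1))))]
  refine Finset.sum_congr rfl fun B _ => Finset.sum_congr rfl fun p' _ => ?_
  rw [smul_ite, smul_zero]

/-- A graph that collapses to `Γ` amounts to an independent choice of a preimage for each end of
each edge, so the edges can be distributed one after the other. -/
theorem mlCompFirst_pre_edgesOp_left {a b c k : ℕ} (h : a + b = c) (f : MLMap V (a + 1))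
    (Γ : Multidigraph (a + 1) k) :
    mlCompFirst h (pre f (edgesOp Γ)) (mulN V (b + 1)) =
      ∑ G : Multidigraph (c + 1) k, if G.mapVertices (collapse h) = Γ then
        pre (mlCompFirst h f (mulN V (b + 1))) (edgesOp G) else 0 := by
  induction k generalizing f with
  | zero =>
    rw [Finset.univ_unique, Finset.sum_singleton, if_pos (Subsingleton.elim _ _), edgesOp_zero,
      edgesOp_zero, pre_one, pre_one]
  | succ k ih =>
    rw [edgesOp_succ, pre_mul, ih, mlCompFirst_pre_edgeOp_left]
    refine Eq.trans ?_ (Equiv.sum_comp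
      (Fin.consEquiv fun _ : Fin (k + 1) => Fin (c + 1) × Fin (c + 1)) _)
    refine Eq.trans ?_ (Fintype.sum_prod_type_right _).symm
    refine Finset.sum_congr (M := MLMap V (c + 1)) rfl fun G _ => ?_
    have hiff : ∀ p : Fin (c + 1) × Fin (c + 1),
        Multidigraph.mapVertices (collapse h)
          (Fin.consEquiv (fun _ : Fin (k + 1) => Fin (c + 1) × Fin (c + 1)) (p, G)) = Γ ↔
        (collapse h p.1, collapse h p.2) = Γ 0 ∧
          G.mapVertices (collapse h) = fun e => Γ e.succ := by
      intro p
      constructor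
      · rintro rfl
        exact ⟨rfl, rfl⟩
      · rintro ⟨h1, h2⟩
        funext e
        induction e using Fin.cases with
        | zero => exact h1
        | succ e => exact congrFun h2 e
    by_cases hG : G.mapVertices (collapse h) = fun e => Γ e.succ
    · rw [if_pos hG, pre_sum_left]
      refine Finset.sum_congr rfl fun p _ => ?_
      by_cases hp : (collapse h p.1, collapse h p.2) = Γ 0
      · rw [if_pos hp, if_pos ((hiff p).mpr ⟨hp, hG⟩), edgesOp_succ, pre_mul]
        rfl
      · rw [if_neg hp, if_neg (fun hc => hp ((hiff p).mp hc).1), pre_zero_left]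
    · rw [if_neg hG]
      refine (Finset.sum_eq_zero fun p _ => ?_).symm
      rw [if_neg (fun hc => hG ((hiff p).mp hc).2)]

theorem edgesOp_append {N j k : ℕ} (G : Multidigraph N j) (S : Multidigraph N k) :
    edgesOp (V := V) (Fin.append G S) = edgesOp G * edgesOp S := by
  unfold edgesOp
  rw [← List.prod_append, ← List.ofFn_fin_append]
  congr 2
  funext e
  refine Fin.addCases (fun i => ?_) (fun i => ?_) e
  · rw [Fin.append_left, Fin.append_left]
  · rw [Fin.append_right, Fin.append_right]

/-- Compatibility with operadic composition. The edges of `Γ'` are pulled out of the composite, so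
that plain multiplication is inserted and the edges of `Γ` can be distributed by Leibniz. The
operators then appear with the edges of `Γ` on the left, the edge order of `graInsert`. -/
theorem graRep_compFirst {a b c : ℕ} (h : a + b = c) (z : Gra (n + 1) (a + 1))
    (z' : Gra (n + 1) (b + 1)) :
    graRep V c (Gra.compFirst (n + 1) h z z') = mlCompFirst h (graRep V a z) (graRep V b z') := by
  have key : (Gra.compFirst (n + 1) h).compr₂ (graRep V c) =
      (mlCompFirstₗ V.Fun h).compl₁₂ (graRep V a) (graRep V b) := by
    refine Gra.hom_ext fun j Γ => Gra.hom_ext fun k Γ' => ?_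
    rw [LinearMap.compr₂_apply, LinearMap.compl₁₂_apply, mlCompFirstₗ_apply, graRep_mk, graRep_mk,
      Gra.compFirst_mk, graInsert, map_sum, rep_eq, rep_eq, mlCompFirst_pre_edgesOp_right,
      mlCompFirst_pre_edgesOp_left, mlCompFirst_mulN, pre_sum_left,
      Finset.sum_filter]
    refine Finset.sum_congr rfl fun G _ => ?_
    split_ifs with hG
    · rw [graRep_mk, rep_eq, edgesOp_append, pre_mul]
    · rw [pre_zero_left]
  exact LinearMap.congr_fun₂ key z z'

/-! ### Degrees -/

theorem hasDeg_mulN (N : ℕ) : HasDeg V.funDeg 0 (mulN V N) := by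
  intro l w hw
  rw [mulN_apply, add_zero]
  induction N with
  | zero => simpa using one_mem_funDeg
  | succ N ih =>
    rw [List.ofFn_succ, List.prod_cons, Fin.sum_univ_succ]
    exact mul_mem_funDeg (hw 0) (ih _ _ fun t => hw t.succ)

theorem HasDeg.pre_derivAt {N : ℕ} {m : ℤ} {θ : MLMap V N} (hθ : HasDeg V.funDeg m θ) (i : Fin N)
    (A : V.Coords) : HasDeg V.funDeg (m - A.deg) (pre θ (V.derivAt i A)) := by
  intro l w hw
  rw [pre_derivAt_apply]
  have := hθ (fun t => l t - if t = i then (A.deg : ℤ) else 0) (fun j => derivFam i A j (w j)) ?_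
  · rw [Finset.sum_sub_distrib, Finset.sum_ite_eq' Finset.univ i, if_pos (Finset.mem_univ i)] at this
    convert this using 2
    ring
  · intro t
    rcases lt_trichotomy t i with h | h | h
    · rw [derivFam_lt h, if_neg h.ne, sub_zero]
      exact parity_pow_mem_funDeg (hw t) _
    · subst h
      rw [derivFam_self, if_pos rfl]
      exact deriv_mem_funDeg A (hw t)
    · rw [derivFam_gt h, if_neg h.ne', sub_zero]
      exact hw t

theorem HasDeg.pre_edgeOp {N : ℕ} {m : ℤ} {θ : MLMap V N} (hθ : HasDeg V.funDeg m θ)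
    (i j : Fin N) : HasDeg V.funDeg (m - n) (pre θ (V.edgeOp i j)) := by
  intro l w hw
  unfold edgeOp
  simp only [← preₗ_apply, map_sum, map_smul, sum_apply]
  refine Submodule.sum_mem _ fun A _ => Submodule.sum_mem _ fun B _ => ?_
  rw [preₗ_apply, smul_apply]
  by_cases h : V.coeff A B = 0
  · rw [h, zero_smul]; exact Submodule.zero_mem _
  · refine Submodule.smul_mem _ _ ?_
    have h1 := HasDeg.pre_derivAt (HasDeg.pre_derivAt hθ i A) j B l w hw
    rw [pre_mul]
    have hn : (A.deg : ℤ) + B.deg = n := by exact_mod_cast deg_add_deg_of_coeff_ne_zero h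
    rwa [sub_sub, hn] at h1

theorem hasDeg_rep {N k : ℕ} (Γ : Multidigraph N k) : HasDeg V.funDeg (-(k * n)) (V.rep Γ) := by
  have key : ∀ {k : ℕ} (Γ : Multidigraph N k) {m : ℤ} {θ : MLMap V N},
      HasDeg V.funDeg m θ → HasDeg V.funDeg (m - k * n) (pre θ (edgesOp Γ)) := by
    intro k
    induction k with
    | zero => intro Γ m θ hθ; rw [edgesOp_zero, pre_one]; simpa using hθ
    | succ k ih =>
      intro Γ m θ hθ
      rw [edgesOp_succ, pre_mul]
      have := ih (fun e => Γ e.succ) (HasDeg.pre_edgeOp hθ (Γ 0).1 (Γ 0).2)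
      convert this using 1
      push_cast; ring
  have := key Γ (hasDeg_mulN (V := V) N)
  rwa [zero_sub] at this

end DarbouxChart

/-! ### The graph with one edge -/

theorem Gra.mk_pair_swap (d : ℕ) {N : ℕ} (e f : Fin N × Fin N) :
    Gra.mk d (![f, e] : Multidigraph N 2) =
      ((-1 : ℤ) ^ (d + 1)) • Gra.mk d (![e, f] : Multidigraph N 2) := by
  have := Gra.mk_perm d (![e, f] : Multidigraph N 2) (Equiv.swap 0 1)
  rw [Equiv.Perm.sign_swap (by decide)] at this
  rw [show (![f, e] : Multidigraph N 2) = ![e, f] ∘ Equiv.swap (0 : Fin 2) 1 by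
    funext i; fin_cases i <;> rfl]
  simpa using this

theorem Gra.mk_pair_flip_left (d : ℕ) {N : ℕ} (e f : Fin N × Fin N) :
    Gra.mk d (![e.swap, f] : Multidigraph N 2) =
      ((-1 : ℤ) ^ d) • Gra.mk d (![e, f] : Multidigraph N 2) := by
  rw [← Gra.mk_flip d _ 0]
  congr 1
  funext i; fin_cases i <;> rfl

theorem Gra.mk_pair_flip_right (d : ℕ) {N : ℕ} (e f : Fin N × Fin N) :
    Gra.mk d (![e, f.swap] : Multidigraph N 2) =
      ((-1 : ℤ) ^ d) • Gra.mk d (![e, f] : Multidigraph N 2) := by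
  rw [← Gra.mk_flip d _ 1]
  congr 1
  funext i; fin_cases i <;> rfl

theorem graInsert_edge (d : ℕ) :
    graInsert d (show 1 + 1 = 2 from rfl) (fun _ => (0, 1) : Multidigraph 2 1)
      (fun _ => (0, 1) : Multidigraph 2 1) =
      Gra.mk d (![(0, 2), (0, 1)] : Multidigraph 3 2) +
        Gra.mk d (![(1, 2), (0, 1)] : Multidigraph 3 2) := by
  have h : Finset.univ.filter (fun G : Multidigraph 3 1 =>
      G.mapVertices (collapse (show 1 + 1 = 2 from rfl)) = fun _ => (0, 1)) =
      {fun _ => (0, 2), fun _ => (1, 2)} := by decide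
  rw [graInsert, h, Finset.sum_pair (by decide)]
  congr 2 <;> (funext i; fin_cases i <;> rfl)

theorem sum_unshuffles_two_three {M : Type} [AddCommGroup M] (F : Equiv.Perm (Fin 3) → M) :
    ∑ σ ∈ unshuffles 2 3, F σ =
      F 1 + F (Equiv.swap 1 2) + F (Equiv.swap 0 1 * Equiv.swap 0 2) := by
  have h : unshuffles 2 3 = {1, Equiv.swap 1 2, Equiv.swap 0 1 * Equiv.swap 0 2} := by decide
  rw [h, Finset.sum_insert (by decide), Finset.sum_pair (by decide), add_assoc]

theorem Gra.relabel_pair (d : ℕ) {N : ℕ} (σ : Equiv.Perm (Fin N)) (e f : Fin N × Fin N) :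
    Gra.relabel d σ (Gra.mk d (![e, f] : Multidigraph N 2)) =
      Gra.mk d (![(σ⁻¹ e.1, σ⁻¹ e.2), (σ⁻¹ f.1, σ⁻¹ f.2)] : Multidigraph N 2) := by
  rw [Gra.relabel_mk]
  congr 1
  funext i; fin_cases i <;> rfl

/-- Only the component with three vertices matters. Three unshuffles and two reconnections give six
paths with two edges; those with the same middle vertex cancel in pairs, by exchanging the edges and
reversing them where necessary. -/
theorem fGCcomp_edgeGraph (d : ℕ) : fGCcomp d (edgeGraph d) (edgeGraph d) = 0 := by
  funext c
  rw [fGCcomp, Pi.zero_apply]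
  refine Finset.sum_eq_zero ?_
  rintro ⟨⟨a, b⟩, hab⟩ -
  have hc := Finset.HasAntidiagonal.mem_antidiagonal.mp hab
  by_cases ha : a = 1
  · by_cases hb : b = 1
    · subst ha hb
      simp only at hc
      subst hc
      have h1 : edgeGraph d 1 = Gra.mk d (fun _ => (0, 1) : Multidigraph 2 1) := Pi.single_eq_same _ _
      simp only [h1, Gra.compFirst_mk]
      change ∑ σ ∈ unshuffles 2 3, _ = _
      rw [sum_unshuffles_two_three, graInsert_edge]
      simp only [map_add, Gra.relabel_pair]
      have e1 : (Equiv.swap 1 2 : Equiv.Perm (Fin 3))⁻¹ = Equiv.swap 1 2 := by decide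
      have e2 : (Equiv.swap 0 1 * Equiv.swap 0 2 : Equiv.Perm (Fin 3))⁻¹ =
        Equiv.swap 0 2 * Equiv.swap 0 1 := by decide
      have s1 : Equiv.Perm.sign (Equiv.swap 1 2 : Equiv.Perm (Fin 3)) = -1 := by decide
      have s2 : Equiv.Perm.sign (Equiv.swap 0 1 * Equiv.swap 0 2 : Equiv.Perm (Fin 3)) = 1 := by
        decide
      have v0 : (Equiv.swap 1 2 : Equiv.Perm (Fin 3)) 0 = 0 := by decide
      have v1 : (Equiv.swap 1 2 : Equiv.Perm (Fin 3)) 1 = 2 := by decide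
      have v2 : (Equiv.swap 1 2 : Equiv.Perm (Fin 3)) 2 = 1 := by decide
      have u0 : (Equiv.swap 0 2 * Equiv.swap 0 1 : Equiv.Perm (Fin 3)) 0 = 1 := by decide
      have u1 : (Equiv.swap 0 2 * Equiv.swap 0 1 : Equiv.Perm (Fin 3)) 1 = 2 := by decide
      have u2 : (Equiv.swap 0 2 * Equiv.swap 0 1 : Equiv.Perm (Fin 3)) 2 = 0 := by decide
      simp only [e1, e2, s1, s2, v0, v1, v2, u0, u1, u2, inv_one, Equiv.Perm.one_apply,
        map_one, Units.val_one, Units.val_neg, one_pow, one_smul]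
      rw [Gra.mk_pair_swap d (0, 2) (0, 1), Gra.mk_pair_swap d (1, 2) (1, 0),
        Gra.mk_pair_swap d (1, 2) (2, 0),
        show ((1 : Fin 3), (0 : Fin 3)) = Prod.swap (0, 1) from rfl,
        show ((2 : Fin 3), (1 : Fin 3)) = Prod.swap (1, 2) from rfl,
        show ((2 : Fin 3), (0 : Fin 3)) = Prod.swap (0, 2) from rfl,
        Gra.mk_pair_flip_right, Gra.mk_pair_flip_left, Gra.mk_pair_flip_right]
      rcases neg_one_pow_eq_or ℤ d with h | h <;> simp only [pow_succ, h] <;> module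
    · have : edgeGraph d b = 0 := Pi.single_eq_of_ne hb _
      simp [this]
  · have : edgeGraph d a = 0 := Pi.single_eq_of_ne ha _
    simp [this]

theorem edgeGraph_mem (d : ℕ) : edgeGraph d ∈ fGC d 1 := by
  intro a
  by_cases ha : a = 1
  · subst ha
    have h1 : edgeGraph d 1 = Gra.mk d (fun _ => (0, 1) : Multidigraph 2 1) := Pi.single_eq_same _ _
    rw [h1]
    refine ⟨Submodule.subset_span ⟨1, _, by push_cast; ring, rfl⟩, fun σ => ?_⟩
    rw [Gra.relabel_mk]
    have hσ : σ = 1 ∨ σ = Equiv.swap 0 1 := by revert σ; decide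
    rcases hσ with rfl | rfl
    · simp; rfl
    · rw [Equiv.Perm.sign_swap (by decide), Units.val_neg, Units.val_one, ← Gra.mk_flip d _ 0]
      congr 1
      funext i; fin_cases i; rfl
  · have : edgeGraph d a = 0 := Pi.single_eq_of_ne ha _
    rw [this]
    exact ⟨Submodule.zero_mem _, fun σ => by simp⟩

theorem fGCbracket_edgeGraph (d : ℕ) : fGCbracket d 1 1 (edgeGraph d) (edgeGraph d) = 0 := by
  rw [fGCbracket, fGCcomp_edgeGraph]; simp

/-! ### The morphism to cochains -/

namespace DarbouxChart

variable {n : ℕ} {V : DarbouxChart n}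

theorem hasDeg_graRep {a : ℕ} {m : ℤ} {z : Gra (n + 1) (a + 1)}
    (hz : z ∈ Gra.deg (n + 1) (a + 1) m) : HasDeg V.funDeg m (graRep V a z) := by
  induction hz using Submodule.span_induction with
  | mem z hz =>
    obtain ⟨k, Γ, hk, rfl⟩ := hz
    rw [graRep_mk, ← hk]
    convert hasDeg_rep Γ using 1
    push_cast; ring
  | zero => intro l w hw; rw [map_zero]; exact Submodule.zero_mem _
  | add x y _ _ hx hy =>
    intro l w hw
    rw [map_add]
    exact Submodule.add_mem _ (hx l w hw) (hy l w hw)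
  | smul c x _ hx =>
    intro l w hw
    rw [map_smul]
    exact Submodule.smul_mem _ _ (hx l w hw)

theorem schoutenParity_pow_mem {k : ℤ} {z : V.Fun} (hz : z ∈ V.funDeg k) (j : ℕ) :
    (V.schoutenParity ^ j) z ∈ V.funDeg k := by
  have : V.schoutenParity ^ j = (((-1 : ℝ) ^ n) ^ j) • V.parity ^ j := smul_pow _ _ _
  rw [this]
  exact Submodule.smul_mem _ _ (parity_pow_mem_funDeg hz j)

/-- Lowering all degrees by `n` raises the degree of a map with `a + 1` arguments by `n a`. This
converts the shift by `d a` of the graph complex into the shift by `a` of the cochain complex. -/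
theorem hasDeg_susp {a : ℕ} {i : ℤ} {θ : MLMap V (a + 1)}
    (hθ : HasDeg V.funDeg (i - ((n + 1 : ℕ) : ℤ) * a) θ) :
    HasDeg V.schoutenDeg (i - a) (susp n V.schoutenParity θ) := by
  intro l w hw
  have := hθ (fun t => l t + n) (fun t => (V.schoutenParity ^ (n * (a - t.val))) (w t))
    fun t => schoutenParity_pow_mem (hw t) _
  change (θ fun t => (V.schoutenParity ^ (n * (a - t.val))) (w t)) ∈ V.funDeg _
  convert this using 2
  rw [Finset.sum_add_distrib, Finset.sum_const, Finset.card_univ, Fintype.card_fin]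
  simp only [nsmul_eq_mul]
  push_cast; ring

theorem neg_one_pow_smul_schoutenParity : ((-1 : ℝ) ^ n) • V.schoutenParity = V.parity := by
  rw [schoutenParity, smul_smul, ← mul_pow]; simp

theorem schoutenParity_schoutenParity (w : V.Fun) : V.schoutenParity (V.schoutenParity w) = w :=
  isParityGrading_schoutenDeg.involutive w

theorem inducedMap_apply (γ : GraSeq (n + 1)) (a : ℕ) :
    V.inducedMap (graRep V) γ a = susp n V.schoutenParity (graRep V a (γ a)) := rfl

theorem permAct_susp_graRep {a : ℕ} (z : Gra (n + 1) (a + 1)) (σ : Equiv.Perm (Fin (a + 1))) :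
    permAct V.schoutenParity (susp n V.schoutenParity (graRep V a z)) σ =
      ((Equiv.Perm.sign σ : ℤ) ^ n) •
        susp n V.schoutenParity (graRep V a (Gra.relabel (n + 1) σ z)) := by
  rw [permAct_susp schoutenParity_schoutenParity, neg_one_pow_smul_schoutenParity, graRep_relabel]

/-- The twist `sgn^n` of the suspension and the invariance up to `sgn^d`, with `d = n + 1`, combine
to `sgn`. -/
theorem inducedMap_mem {i : ℤ} {γ : GraSeq (n + 1)} (hγ : γ ∈ fGC (n + 1) i) :
    V.inducedMap (graRep V) γ ∈ CE V.schoutenDeg V.schoutenParity i := by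
  intro a
  refine ⟨hasDeg_susp (hasDeg_graRep (hγ a).1), fun σ => ?_⟩
  rw [inducedMap_apply, permAct_susp_graRep, (hγ a).2, map_zsmul, ← suspₗ_apply, map_zsmul,
    smul_smul, ← pow_add, suspₗ_apply]
  rcases Int.units_eq_one_or (Equiv.Perm.sign σ) with h | h
  · simp [h]
  · rw [h, show n + (n + 1) = 2 * n + 1 by ring, Units.val_neg, Units.val_one,
      (odd_two_mul_add_one n).neg_one_pow]

theorem inducedMap_add (γ γ' : GraSeq (n + 1)) : V.inducedMap (graRep V) (γ + γ') =
    V.inducedMap (graRep V) γ + V.inducedMap (graRep V) γ' := by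
  funext a
  rw [Pi.add_apply, inducedMap_apply, Pi.add_apply, map_add, ← suspₗ_apply, map_add]
  rfl

theorem inducedMap_smul (c : ℝ) (γ : GraSeq (n + 1)) : V.inducedMap (graRep V) (c • γ) =
    c • V.inducedMap (graRep V) γ := by
  funext a
  rw [Pi.smul_apply, inducedMap_apply, Pi.smul_apply, map_smul, ← suspₗ_apply, map_smul]
  rfl

variable (V) in
/-- The induced map as a linear map. -/
def inducedₗ : GraSeq (n + 1) →ₗ[ℝ] MLSeq V.Fun where
  toFun := V.inducedMap (graRep V)
  map_add' := inducedMap_add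
  map_smul' := inducedMap_smul

/-- A nonzero element of this degree has graphs with `k` edges for some `k` with `j - b = n (b -
k)`. So the exponents `a (j - b)` of the Nijenhuis–Richardson product and `n a (j - b)` of the
suspension add up to a multiple of the even number `n (n + 1)`. -/
theorem negOnePow_mul_of_mem {b : ℕ} {j : ℤ} {z : Gra (n + 1) (b + 1)}
    (hz : z ∈ Gra.deg (n + 1) (b + 1) (j - ((n + 1 : ℕ) : ℤ) * b)) (hz0 : z ≠ 0) (a : ℤ) :
    ((a * (j - b)).negOnePow : ℤ) * ((n * a * (j - b)).negOnePow : ℤ) = 1 := by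
  have hk : ∃ k : ℕ, (k : ℤ) * (1 - (n + 1 : ℕ)) = j - ((n + 1 : ℕ) : ℤ) * b := by
    by_contra hc
    push Not at hc
    refine hz0 ?_
    have : Gra.deg (n + 1) (b + 1) (j - ((n + 1 : ℕ) : ℤ) * b) = ⊥ := by
      rw [Gra.deg, Submodule.span_eq_bot]
      rintro x ⟨k, _, hk, _⟩
      exact absurd hk (hc k)
    rw [this] at hz
    exact (Submodule.mem_bot ℝ).mp hz
  obtain ⟨k, hk⟩ := hk
  rw [← negOnePow_cast_mul]
  have : a * (j - b) + n * a * (j - b) = (n * (n + 1)) * (a * (b - k)) := by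
    push_cast at hk
    linear_combination (-(a * (n + 1)) : ℤ) * hk
  rw [this, Int.negOnePow_even _ ((Int.even_mul_succ_self _).mul_right _)]
  rfl

/-- Compatibility of the pre-Lie products: the degree signs cancel by `negOnePow_mul_of_mem`, and
`sgn σ` times the suspension twist `sgn^n` is the sign `sgn^d` of the graph complex. -/
theorem nrComp_inducedMap {j : ℤ} (γ : GraSeq (n + 1)) {γ' : GraSeq (n + 1)}
    (hγ' : γ' ∈ fGC (n + 1) j) :
    nrComp V.schoutenParity j (V.inducedMap (graRep V) γ) (V.inducedMap (graRep V) γ') =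
      V.inducedMap (graRep V) (fGCcomp (n + 1) γ γ') := by
  funext c
  rw [inducedMap_apply, fGCcomp, nrComp, map_sum, ← suspₗ_apply, map_sum]
  refine Finset.sum_congr rfl fun ab _ => ?_
  rw [map_sum, map_sum]
  refine Finset.sum_congr rfl fun σ _ => ?_
  have h := Finset.HasAntidiagonal.mem_antidiagonal.mp ab.2
  obtain ⟨⟨a, b⟩, hab⟩ := ab
  simp only at h ⊢
  -- A zero component determines no number of edges, so the sign identity may fail, but then both
  -- sides vanish.
  by_cases h0 : γ' b = 0
  · have h1 : ∀ f : MLMap V (a + 1), mlCompFirst h f (0 : MLMap V (b + 1)) = 0 :=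
      fun f => map_zero (mlCompFirstₗ V.Fun h f)
    have h2 : permAct V.schoutenParity (0 : MLMap V (c + 1)) σ = 0 :=
      map_zero (permActₗ V.schoutenParity σ)
    rw [inducedMap_apply, inducedMap_apply, h0, map_zero, map_zero, ← suspₗ_apply, ← suspₗ_apply,
      map_zero, h1, h2]
    simp
  · have hpar : MapParity V.schoutenParity (j - b)
        (susp n V.schoutenParity (graRep V b (γ' b))) :=
      (hasDeg_susp (hasDeg_graRep (hγ' b).1)).mapParity isParityGrading_schoutenDeg
    rw [inducedMap_apply, inducedMap_apply, mlCompFirst_susp n h _ _ hpar, permAct_zsmul,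
      ← graRep_compFirst, permAct_susp_graRep, map_zsmul, map_zsmul, suspₗ_apply, smul_smul,
      smul_smul]
    congr 1
    rw [pow_succ', mul_assoc (Equiv.Perm.sign σ : ℤ), negOnePow_mul_of_mem (hγ' b).1 h0, mul_one]

theorem inducedMap_bracket {i j : ℤ} {γ γ' : GraSeq (n + 1)} (hγ : γ ∈ fGC (n + 1) i)
    (hγ' : γ' ∈ fGC (n + 1) j) :
    V.inducedMap (graRep V) (fGCbracket (n + 1) i j γ γ') =
      nrBracket V.schoutenParity i j (V.inducedMap (graRep V) γ) (V.inducedMap (graRep V) γ') := by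
  rw [nrBracket, nrComp_inducedMap γ hγ', nrComp_inducedMap γ' hγ, fGCbracket]
  exact (map_sub (inducedₗ V) _ _).trans (congrArg _ (map_zsmul (inducedₗ V) _ _))

/-- The parity operator that `∂_B` leaves on the first factor is the sign `(-1)^(|f||B|)` of the
Poisson bracket. -/
theorem rep_edge : V.rep (fun _ => (0, 1) : Multidigraph 2 1) = V.poisson := by
  rw [rep_eq, edgesOp_succ, edgesOp_zero, mul_one, poisson]
  unfold edgeOp
  simp only [← preₗ_apply, map_sum, map_smul]
  refine Finset.sum_congr rfl fun A _ => Finset.sum_congr rfl fun B _ => ?_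
  congr 1
  rw [preₗ_apply, pre_mul]
  ext w
  rw [pre_derivAt_apply, pre_derivAt_apply, MultilinearMap.compLinearMap_apply]
  congr 1
  funext i
  fin_cases i
  · simp [derivFam]
  · simp [derivFam]

theorem inducedMap_edgeGraph :
    V.inducedMap (graRep V) (edgeGraph (n + 1)) = V.schoutenBracket := by
  funext a
  by_cases ha : a = 1
  · subst ha
    have h1 : edgeGraph (n + 1) 1 = Gra.mk (n + 1) (fun _ => (0, 1) : Multidigraph 2 1) :=
      Pi.single_eq_same _ _
    have h2 : V.schoutenBracket 1 = V.suspPull (a := 1) V.poisson := Pi.single_eq_same _ _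
    rw [h2, inducedMap_apply, h1, graRep_mk, rep_edge]
    rfl
  · have h1 : edgeGraph (n + 1) a = 0 := Pi.single_eq_of_ne ha _
    have h2 : V.schoutenBracket a = 0 := Pi.single_eq_of_ne ha _
    rw [h2, inducedMap_apply, h1, map_zero, ← suspₗ_apply, map_zero]

variable (V) in
-- The Schouten bracket is the image of the one-edge graph, so its Nijenhuis–Richardson square
-- vanishes because that graph squares to zero; this replaces a direct proof of the Jacobi identity
-- for the Poisson bracket.
theorem isDGLieAlgebra_CE :
    IsDGLieAlgebra (CE V.schoutenDeg V.schoutenParity) (nrBracket V.schoutenParity) V.deltaS := by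
  refine CE_isDGLieAlgebra (m := V.schoutenBracket) isParityGrading_schoutenDeg ?_ ?_
  · rw [← inducedMap_edgeGraph]
    exact inducedMap_mem (edgeGraph_mem _)
  · rw [← inducedMap_edgeGraph, ← inducedMap_bracket (edgeGraph_mem _) (edgeGraph_mem _),
      fGCbracket_edgeGraph]
    exact map_zero (inducedₗ V)

variable (V) in
theorem isDGLieHom_inducedMap :
    IsDGLieHom (fGC (n + 1)) (fGCbracket (n + 1)) (fGCdelta (n + 1))
      (CE V.schoutenDeg V.schoutenParity) (nrBracket V.schoutenParity) V.deltaS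
      (V.inducedMap (graRep V)) where
  map_mem := fun _ _ h => inducedMap_mem h
  map_add := fun _ _ _ _ _ => inducedMap_add _ _
  map_smul := fun _ _ _ _ => inducedMap_smul _ _
  map_br := fun _ _ _ hx _ hy => inducedMap_bracket hx hy
  map_d := fun i x hx => by
    rw [fGCdelta, inducedMap_bracket (edgeGraph_mem _) hx, inducedMap_edgeGraph]
    rfl

end DarbouxChart

/-! ### Joint faithfulness: coordinate functions and evaluation at the origin -/

/-- A coordinate as a smooth function. -/
def SmoothFun.coord {ι : Type} [Fintype ι] (U : Set (ι → ℝ)) (t : ι) : SmoothFun U :=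
  ⟨fun u => u.1 t, by
    refine (contDiff_apply ℝ ℝ t).contDiffOn.congr fun x hx => ?_
    exact extendZero_coe U _ ⟨x, hx⟩⟩

open Classical in
theorem partialDeriv_coord {ι : Type} [Fintype ι] {U : Set (ι → ℝ)}
    (hU : IsOpen U) (s t : ι) :
    partialDeriv hU s (SmoothFun.coord U t) = if s = t then 1 else 0 := by
  have key : ∀ u : U, (partialDeriv hU s (SmoothFun.coord U t)).1 u = if s = t then 1 else 0 := by
    intro u
    rw [partialDeriv_apply]
    have h1 : extendZero U (SmoothFun.coord U t).1 =ᶠ[nhds u.1]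
        (ContinuousLinearMap.proj t : (ι → ℝ) →L[ℝ] ℝ) := by
      filter_upwards [hU.mem_nhds u.2] with x hx
      exact extendZero_coe U _ ⟨x, hx⟩
    rw [h1.fderiv_eq, ContinuousLinearMap.fderiv, ContinuousLinearMap.proj_apply, Pi.single_apply]
    simp only [eq_comm]
  apply Subtype.ext
  funext u
  rw [key]
  split_ifs <;> rfl

/-- Evaluation of a smooth function. -/
def SmoothFun.eval {ι : Type} [Fintype ι] {U : Set (ι → ℝ)} (u : U) : SmoothFun U →ₐ[ℝ] ℝ :=
  (Pi.evalAlgHom ℝ (fun _ : U => ℝ) u).comp (smoothSubalgebra U).val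

namespace DarbouxChart

variable {n : ℕ} {V : DarbouxChart n}

/-! ### Coordinates as functions -/

variable (V) in
/-- A coordinate as a function. -/
def coordFun (A : V.Coords) : V.Fun :=
  if h0 : A.deg = 0 then fmk (SmoothFun.coord V.U ⟨A, h0⟩) 1 1
  else if h1 : Odd A.deg then fmk 1 1 (ExteriorAlgebra.ι ℝ (Pi.single (⟨A, h1⟩ : V.OddCoord) 1))
  else fmk 1 (MvPolynomial.X ⟨A, h0, h1⟩) 1

theorem coordFun_base {A : V.Coords} (h : A.deg = 0) :
    V.coordFun A = fmk (SmoothFun.coord V.U ⟨A, h⟩) 1 1 := dif_pos h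

theorem coordFun_odd {A : V.Coords} (h : Odd A.deg) :
    V.coordFun A = fmk 1 1 (ExteriorAlgebra.ι ℝ (Pi.single (⟨A, h⟩ : V.OddCoord) 1)) := by
  have h0 : ¬ A.deg = 0 := by rintro h0; rw [h0] at h; exact absurd h (by decide)
  exact (dif_neg h0).trans (dif_pos h)

theorem coordFun_even {A : V.Coords} (h : A.deg ≠ 0 ∧ ¬ Odd A.deg) :
    V.coordFun A = fmk 1 (MvPolynomial.X (⟨A, h⟩ : V.EvenCoord)) 1 :=
  (dif_neg h.1).trans (dif_neg h.2)

theorem fmk_zero_left (p : MvPolynomial V.EvenCoord ℝ) (x : ExteriorAlgebra ℝ (V.OddCoord → ℝ)) :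
    fmk 0 p x = 0 :=
  (congrArg (· ⊗ₜ[ℝ] x) (TensorProduct.zero_tmul _ p)).trans (TensorProduct.zero_tmul _ _)

theorem fmk_zero_mid (f : SmoothFun V.U) (x : ExteriorAlgebra ℝ (V.OddCoord → ℝ)) :
    fmk f 0 x = 0 :=
  (congrArg (· ⊗ₜ[ℝ] x) (TensorProduct.tmul_zero _ f)).trans (TensorProduct.zero_tmul _ _)

theorem fmk_zero_right (f : SmoothFun V.U) (p : MvPolynomial V.EvenCoord ℝ) : fmk f p 0 = 0 :=
  TensorProduct.tmul_zero _ _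

theorem deriv_one (A : V.Coords) : V.deriv A 1 = 0 := by
  have := deriv_mulN (V := V) A (N := 0) Fin.elim0
  simpa [mulN_apply] using this

theorem partialDeriv_one {ι : Type} [Fintype ι] {U : Set (ι → ℝ)} (hU : IsOpen U) (s : ι) :
    partialDeriv hU s 1 = 0 := by
  have := partialDeriv_mul hU s 1 1
  rw [one_mul, mul_one, one_mul] at this
  exact left_eq_add.mp this

theorem deriv_coordFun (A B : V.Coords) :
    V.deriv A (V.coordFun B) = if A = B then 1 else 0 := by
  have hcl : ∀ (h : Odd A.deg), CliffordAlgebra.contractLeft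
      (Q := (0 : QuadraticForm ℝ (V.OddCoord → ℝ)))
      (LinearMap.proj (⟨A, h⟩ : V.OddCoord)) (1 : ExteriorAlgebra ℝ (V.OddCoord → ℝ)) = 0 :=
    fun h => CliffordAlgebra.contractLeft_one _ _
  rcases coord_trichotomy B with h' | h' | h'
  · rw [coordFun_base h']
    rcases coord_trichotomy A with h | h | h
    · rw [deriv_fmk_base h, partialDeriv_coord]
      simp only [Subtype.mk.injEq]
      split_ifs
      · rfl
      · exact fmk_zero_left _ _
    · rw [deriv_fmk_odd h, hcl, fmk_zero_right, if_neg]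
      rintro rfl; rw [h'] at h; exact absurd h (by decide)
    · rw [deriv_fmk_even h, ← MvPolynomial.C_1, MvPolynomial.pderiv_C, fmk_zero_mid, if_neg]
      rintro rfl; exact h.1 h'
  · rw [coordFun_odd h']
    rcases coord_trichotomy A with h | h | h
    · rw [deriv_fmk_base h, partialDeriv_one, fmk_zero_left, if_neg]
      rintro rfl; rw [h] at h'; exact absurd h' (by decide)
    · rw [deriv_fmk_odd h]
      have := CliffordAlgebra.contractLeft_ι (Q := (0 : QuadraticForm ℝ (V.OddCoord → ℝ)))
        (LinearMap.proj (⟨A, h⟩ : V.OddCoord)) (Pi.single (⟨B, h'⟩ : V.OddCoord) 1)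
      refine (congrArg (fmk 1 1) this).trans ?_
      rw [LinearMap.proj_apply, Pi.single_apply]
      simp only [Subtype.mk.injEq]
      split_ifs
      · rw [map_one]; rfl
      · rw [map_zero]; exact fmk_zero_right _ _
    · rw [deriv_fmk_even h, ← MvPolynomial.C_1, MvPolynomial.pderiv_C, fmk_zero_mid, if_neg]
      rintro rfl; exact h.2 h'
  · rw [coordFun_even h']
    rcases coord_trichotomy A with h | h | h
    · rw [deriv_fmk_base h, partialDeriv_one, fmk_zero_left, if_neg]
      rintro rfl; exact h'.1 h
    · rw [deriv_fmk_odd h, hcl, fmk_zero_right, if_neg]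
      rintro rfl; exact h'.2 h
    · rw [deriv_fmk_even h, MvPolynomial.pderiv_X, Pi.single_apply]
      simp only [Subtype.mk.injEq]
      by_cases hAB : A = B
      · rw [if_pos hAB, if_pos hAB.symm]; rfl
      · rw [if_neg hAB, if_neg (Ne.symm hAB)]; exact fmk_zero_mid _ _

theorem parity_coordFun (A : V.Coords) :
    V.parity (V.coordFun A) = ((-1 : ℝ) ^ A.deg) • V.coordFun A := by
  rcases coord_trichotomy A with h | h | h
  · rw [coordFun_base h, parity_fmk, map_one, h, pow_zero, one_smul]
  · rw [coordFun_odd h, parity_fmk, h.neg_one_pow, neg_one_smul]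
    have : CliffordAlgebra.involute (ExteriorAlgebra.ι ℝ (Pi.single (⟨A, h⟩ : V.OddCoord) (1 : ℝ) : V.OddCoord → ℝ)) =
      -ExteriorAlgebra.ι ℝ (Pi.single (⟨A, h⟩ : V.OddCoord) (1 : ℝ) : V.OddCoord → ℝ) := CliffordAlgebra.involute_ι _
    rw [this, mk_neg]
  · rw [coordFun_even h, parity_fmk, map_one, (Nat.not_odd_iff_even.mp h.2).neg_one_pow, one_smul]

theorem parity_pow_coordFun (k : ℕ) (A : V.Coords) :
    (V.parity ^ k) (V.coordFun A) = ((-1 : ℝ) ^ (k * A.deg)) • V.coordFun A := by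
  induction k with
  | zero => simp
  | succ k ih =>
    rw [pow_succ', Module.End.mul_apply, ih, map_smul, parity_coordFun, smul_smul, ← pow_add]
    congr 2
    ring

/-- The value of a function at the origin. -/
def aug (h0 : (0 : V.BaseCoord → ℝ) ∈ V.U) : V.Fun →ₐ[ℝ] ℝ :=
  Algebra.TensorProduct.lift
    (Algebra.TensorProduct.lift (SmoothFun.eval ⟨0, h0⟩)
      (MvPolynomial.aeval fun _ : V.EvenCoord => (0 : ℝ)) fun _ _ => Commute.all _ _)
    (ExteriorAlgebra.algebraMapInv (R := ℝ) (M := V.OddCoord → ℝ)) fun _ _ => Commute.all _ _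

theorem aug_fmk (h0 : (0 : V.BaseCoord → ℝ) ∈ V.U) (f : SmoothFun V.U)
    (p : MvPolynomial V.EvenCoord ℝ) (x : ExteriorAlgebra ℝ (V.OddCoord → ℝ)) :
    aug h0 (fmk f p x) = SmoothFun.eval ⟨0, h0⟩ f * MvPolynomial.aeval (fun _ => (0 : ℝ)) p *
      ExteriorAlgebra.algebraMapInv x := by
  refine (Algebra.TensorProduct.lift_tmul _ _ _ _ _).trans ?_
  rw [Algebra.TensorProduct.lift_tmul]

theorem aug_coordFun (h0 : (0 : V.BaseCoord → ℝ) ∈ V.U) (A : V.Coords) :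
    aug h0 (V.coordFun A) = 0 := by
  rcases coord_trichotomy A with h | h | h
  · rw [coordFun_base h, aug_fmk]
    have : SmoothFun.eval ⟨0, h0⟩ (SmoothFun.coord V.U ⟨A, h⟩) = 0 := rfl
    rw [this, zero_mul, zero_mul]
  · rw [coordFun_odd h, aug_fmk]
    have : ExteriorAlgebra.algebraMapInv
        (ExteriorAlgebra.ι ℝ (Pi.single (⟨A, h⟩ : V.OddCoord) (1 : ℝ) : V.OddCoord → ℝ)) = 0 := by
      simp [ExteriorAlgebra.algebraMapInv]
    rw [this, mul_zero]
  · rw [coordFun_even h, aug_fmk, MvPolynomial.aeval_X, mul_zero, zero_mul]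

/-! ### Creation operators on tensors -/

/-- The factors of `mulAt i A`. -/
def mulFam {N : ℕ} (i : Fin N) (A : V.Coords) (j : Fin N) : V.Fun →ₗ[ℝ] V.Fun :=
  if j < i then V.parity ^ A.deg else if j = i then LinearMap.mulLeft ℝ (V.coordFun A)
  else LinearMap.id

/-- Multiplication of the `i`-th factor with the coordinate `A`. -/
def mulAt {N : ℕ} (i : Fin N) (A : V.Coords) : TensorEnd V N := PiTensorProduct.map (mulFam i A)

theorem mulFam_lt {N : ℕ} {i j : Fin N} (h : j < i) (A : V.Coords) :
    mulFam i A j = V.parity ^ A.deg := if_pos h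

theorem mulFam_self {N : ℕ} (i : Fin N) (A : V.Coords) :
    mulFam i A i = LinearMap.mulLeft ℝ (V.coordFun A) := by
  simp [mulFam]

theorem mulFam_gt {N : ℕ} {i j : Fin N} (h : i < j) (A : V.Coords) :
    mulFam i A j = LinearMap.id := by
  simp [mulFam, h.ne', h.le]

theorem derivAt_mulAt_self {N : ℕ} (i : Fin N) (A B : V.Coords) :
    V.derivAt i A * mulAt i B = (if A = B then 1 else 0) +
      ((-1 : ℝ) ^ (A.deg * B.deg)) • (mulAt i B * V.derivAt i A) := by
  set G : Fin N → (V.Fun →ₗ[ℝ] V.Fun) := fun j => mulFam i B j * derivFam i A j with hG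
  have hself : derivFam i A i * mulFam i B i = (if A = B then LinearMap.id else 0) +
      ((-1 : ℝ) ^ (A.deg * B.deg)) • G i := by
    ext a
    simp only [hG, derivFam_self, mulFam_self, Module.End.mul_apply, LinearMap.mulLeft_apply,
      LinearMap.add_apply, LinearMap.smul_apply]
    rw [deriv_mul, deriv_coordFun, parity_pow_coordFun, smul_mul_assoc]
    split_ifs <;> simp
  have hF : (fun j => derivFam i A j * mulFam i B j) = Function.update G i
      ((if A = B then LinearMap.id else 0) + ((-1 : ℝ) ^ (A.deg * B.deg)) • G i) := by
    funext j
    rcases lt_trichotomy j i with h | h | h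
    · rw [Function.update_of_ne h.ne, hG, derivFam_lt h, mulFam_lt h]
      simp only [derivFam_lt h, mulFam_lt h]
      exact pow_mul_comm _ _ _
    · subst h; rw [Function.update_self, hself]
    · rw [Function.update_of_ne h.ne', hG, derivFam_gt h, mulFam_gt h]
      simp only [derivFam_gt h, mulFam_gt h]
  rw [derivAt_eq, mulAt, ← PiTensorProduct.map_mul, ← PiTensorProduct.map_mul, hF,
    PiTensorProduct.map_update_add, PiTensorProduct.map_update_smul, Function.update_eq_self]
  congr 1
  split_ifs with hAB
  · subst hAB
    -- In the slots before `i` both operators contribute the same power of the parity operator, and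
    -- its square is the identity.
    have : Function.update G i LinearMap.id = fun _ => LinearMap.id := by
      funext j
      rcases lt_trichotomy j i with h | h | h
      · rw [Function.update_of_ne h.ne, hG]
        simp only [derivFam_lt h, mulFam_lt h]
        rw [← pow_add, parity_pow_of_even (Even.add_self _)]
        rfl
      · subst h; rw [Function.update_self]
      · rw [Function.update_of_ne h.ne', hG]
        simp only [derivFam_gt h, mulFam_gt h]
        rfl
    rw [this, PiTensorProduct.map_id]
    rfl
  · have := PiTensorProduct.map_update_smul (R := ℝ) G i 0 (0 : V.Fun →ₗ[ℝ] V.Fun)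
    rwa [zero_smul, zero_smul] at this

theorem derivAt_mulAt_of_ne {N : ℕ} {i j : Fin N} (hij : i ≠ j) (A B : V.Coords) :
    V.derivAt i A * mulAt j B =
      ((-1 : ℝ) ^ (A.deg * B.deg)) • (mulAt j B * V.derivAt i A) := by
  have hpar : (V.parity ^ A.deg) * (V.parity ^ B.deg) = (V.parity ^ B.deg) * (V.parity ^ A.deg) :=
    pow_mul_comm _ _ _
  rw [derivAt_eq, mulAt, ← PiTensorProduct.map_mul, ← PiTensorProduct.map_mul]
  rcases lt_or_gt_of_ne hij with h | h
  · refine tensorMap_eq_smul _ _ i _ ?_ ?_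
    · ext a
      simp only [derivFam_self, mulFam_lt h, Module.End.mul_apply, LinearMap.smul_apply]
      exact deriv_parity_pow A _ a
    · intro l hl
      rcases lt_or_gt_of_ne hl with hl | hl
      · rw [derivFam_lt hl, mulFam_lt (hl.trans h), hpar]
      · rw [derivFam_gt hl]; rfl
  · refine tensorMap_eq_smul _ _ j _ ?_ ?_
    · ext a
      simp only [mulFam_self, derivFam_lt h, Module.End.mul_apply, LinearMap.smul_apply,
        LinearMap.mulLeft_apply]
      rw [parity_pow_mul, parity_pow_coordFun, smul_mul_assoc]
    · intro l hl
      rcases lt_or_gt_of_ne hl with hl | hl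
      · rw [derivFam_lt (hl.trans h), mulFam_lt hl, hpar]
      · rw [mulFam_gt hl]; rfl

/-- The graded canonical commutation relations: derivatives annihilate, coordinates create, `vac` is
killed by all annihilators and `ev` kills everything newly created. Evaluating edge operators on
test tensors thereby becomes a sum over contractions. -/
theorem derivAt_mulAt {N : ℕ} (i j : Fin N) (A B : V.Coords) (y : ⨂[ℝ] _ : Fin N, V.Fun) :
    V.derivAt i A (mulAt j B y) = (if i = j ∧ A = B then (1 : ℝ) else 0) • y +
      ((-1 : ℝ) ^ (A.deg * B.deg)) • mulAt j B (V.derivAt i A y) := by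
  by_cases hij : i = j
  · subst hij
    have := LinearMap.congr_fun (derivAt_mulAt_self i A B) y
    rw [Module.End.mul_apply] at this
    rw [this, LinearMap.add_apply, LinearMap.smul_apply, Module.End.mul_apply]
    congr 1
    by_cases hAB : A = B <;> simp [hAB]
  · have := LinearMap.congr_fun (derivAt_mulAt_of_ne hij A B) y
    rw [Module.End.mul_apply] at this
    rw [this, if_neg (fun h => hij h.1), zero_smul, zero_add]
    rfl

variable (V) in
/-- The tensor `1 ⊗ ⋯ ⊗ 1`. -/
def vac (N : ℕ) : ⨂[ℝ] _ : Fin N, V.Fun := PiTensorProduct.tprod ℝ fun _ => 1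

theorem derivAt_vac {N : ℕ} (i : Fin N) (A : V.Coords) : V.derivAt i A (vac V N) = 0 := by
  rw [vac, derivAt_eq, PiTensorProduct.map_tprod]
  refine MultilinearMap.map_coord_zero _ i ?_
  rw [derivFam_self, deriv_one]

/-- Multiplication followed by evaluation at the origin. -/
def ev (h0 : (0 : V.BaseCoord → ℝ) ∈ V.U) (N : ℕ) : (⨂[ℝ] _ : Fin N, V.Fun) →ₗ[ℝ] ℝ :=
  (aug h0).toLinearMap ∘ₗ PiTensorProduct.lift (mulN V N)

theorem ev_vac (h0 : (0 : V.BaseCoord → ℝ) ∈ V.U) (N : ℕ) : ev h0 N (vac V N) = 1 := by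
  rw [ev, vac, LinearMap.comp_apply, PiTensorProduct.lift.tprod, mulN_apply]
  simp

/-- Every coordinate vanishes at the origin, so the `i`-th factor of the product evaluates to zero.
-/
theorem ev_mulAt (h0 : (0 : V.BaseCoord → ℝ) ∈ V.U) {N : ℕ} (i : Fin N) (A : V.Coords) :
    ev h0 N ∘ₗ mulAt i A = 0 := by
  refine PiTensorProduct.ext ?_
  ext w
  simp only [LinearMap.compMultilinearMap_apply, LinearMap.comp_apply, mulAt,
    PiTensorProduct.map_tprod, ev, PiTensorProduct.lift.tprod, mulN_apply]
  rw [AlgHom.toLinearMap_apply, map_list_prod]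
  refine List.prod_eq_zero ?_
  rw [List.map_ofFn, List.mem_ofFn]
  exact ⟨i, by simp [mulFam_self, aug_coordFun]⟩

end DarbouxChart

/-! ### The pairing of graphs -/

/-- The pairing of two edges. -/
def edgePairing (n : ℕ) {N : ℕ} (p q : Fin N × Fin N) : ℝ :=
  (if p = q then 1 else 0) + (-1) ^ (n + 1) * (if p = q.swap then 1 else 0)

/-- The pairing of two graphs with the same number of edges. -/
def graPairing (n : ℕ) {N : ℕ} : (k : ℕ) → Multidigraph N k → Multidigraph N k → ℝ
  | 0, _, _ => 1
  -- Expansion along the last edge of `Γ`, whose operator acts first. The sign is that of moving it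
  -- past the `l` preceding edges of `L`.
  | k + 1, L, Γ => ∑ l : Fin (k + 1), (-1) ^ (n * l.val) * edgePairing n (L l) (Γ (Fin.last k)) *
      graPairing n k (L ∘ l.succAbove) (Γ ∘ Fin.castSucc)

/-- The constant of proportionality in `sum_graPairing`. -/
def pairingConst (n : ℕ) : ℕ → ℝ
  | 0 => 1
  | k + 1 => (-1) ^ (n * k) * (2 * (k + 1) * pairingConst n k)

theorem pairingConst_ne_zero (n k : ℕ) : pairingConst n k ≠ 0 := by
  induction k with
  | zero => exact one_ne_zero
  | succ k ih =>
    rw [pairingConst]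
    have : (k : ℝ) + 1 ≠ 0 := by positivity
    exact mul_ne_zero (pow_ne_zero _ (by norm_num)) (mul_ne_zero (mul_ne_zero two_ne_zero this) ih)

/-- Functions on graphs with the symmetries of `Gra`. -/
structure IsGraFunction (n : ℕ) {N k : ℕ} {M : Type} [AddCommGroup M] [Module ℝ M]
    (F : Multidigraph N k → M) : Prop where
  perm : ∀ (L : Multidigraph N k) (τ : Equiv.Perm (Fin k)),
    F (L ∘ τ) = ((Equiv.Perm.sign τ : ℤ) ^ n) • F L
  flip : ∀ (L : Multidigraph N k) (e : Fin k), F (L.flip e) = ((-1 : ℤ) ^ (n + 1)) • F L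

theorem IsGraFunction.cons {n N k : ℕ} {M : Type} [AddCommGroup M] [Module ℝ M]
    {F : Multidigraph N (k + 1) → M} (hF : IsGraFunction n F) (q : Fin N × Fin N) :
    IsGraFunction n fun L : Multidigraph N k => F (Fin.cons q L) where
  perm := fun L τ => by
    have h := hF.perm (Fin.cons q L) (Equiv.Perm.decomposeFin.symm (0, τ))
    rw [Equiv.Perm.decomposeFin.symm_sign, if_pos rfl, one_mul] at h
    rw [← h]
    congr 1
    funext e
    induction e using Fin.cases with
    | zero => simp
    | succ e => simp [Equiv.Perm.decomposeFin_symm_apply_succ]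
  flip := fun L e => by
    rw [← hF.flip (Fin.cons q L) e.succ]
    congr 1
    rw [Multidigraph.flip, Multidigraph.flip, Fin.cons_succ, Fin.cons_update]

theorem IsGraFunction.insertNth {n N k : ℕ} {M : Type} [AddCommGroup M] [Module ℝ M]
    {F : Multidigraph N (k + 1) → M} (hF : IsGraFunction n F) (l : Fin (k + 1))
    (q : Fin N × Fin N) (L : Multidigraph N k) :
    F (Fin.insertNth l q L) = ((-1 : ℝ) ^ (n * l.val)) • F (Fin.cons q L) := by
  have h := hF.perm (Fin.cons q L) l.cycleRange
  have h1 : (Fin.cons q L : Multidigraph N (k + 1)) ∘ l.cycleRange = Fin.insertNth l q L := by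
    funext e
    induction e using Fin.succAboveCases l with
    | x => simp [Fin.cycleRange_self]
    | p e => simp [Fin.cycleRange_succAbove]
  rw [h1] at h
  rw [h, Fin.sign_cycleRange, ← Int.cast_smul_eq_zsmul ℝ]
  push_cast
  rw [← pow_mul, mul_comm]

theorem sum_edgePairing {n N k : ℕ} {M : Type} [AddCommGroup M] [Module ℝ M]
    {F : Multidigraph N (k + 1) → M} (hF : IsGraFunction n F) (q : Fin N × Fin N)
    (L : Multidigraph N k) :
    ∑ p, edgePairing n p q • F (Fin.cons p L) = (2 : ℝ) • F (Fin.cons q L) := by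
  have h : F (Fin.cons q.swap L) = ((-1 : ℝ) ^ (n + 1)) • F (Fin.cons q L) := by
    have h1 := hF.flip (Fin.cons q L) 0
    rw [Multidigraph.flip, Fin.cons_zero, Fin.update_cons_zero] at h1
    rw [h1, ← Int.cast_smul_eq_zsmul ℝ]
    push_cast
    rfl
  simp only [edgePairing, add_smul, Finset.sum_add_distrib, mul_smul, ite_smul, one_smul, zero_smul,
    Finset.sum_ite_eq', Finset.mem_univ, if_true, smul_ite, smul_zero]
  rw [h, smul_smul, ← pow_add, Even.neg_one_pow (Even.add_self _), one_smul, two_smul]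

/-- Up to an overall sign, the pairing of `L` with `Γ` adds the characters of the edge permutations
and reversals relating the two graphs. Against a function with the matching symmetry each of the
`2^k k!` group elements contributes the same, so `pairingConst` is `± 2^k k!`. -/
theorem sum_graPairing {n N : ℕ} {M : Type} [AddCommGroup M] [Module ℝ M] (k : ℕ)
    {F : Multidigraph N k → M} (hF : IsGraFunction n F) (Γ : Multidigraph N k) :
    ∑ L, graPairing n k L Γ • F L = pairingConst n k • F Γ := by
  induction k with
  | zero =>
    rw [Finset.univ_unique, Finset.sum_singleton, graPairing, pairingConst,
      Subsingleton.elim Γ default]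
  | succ k ih =>
    simp only [graPairing, Finset.sum_smul]
    rw [Finset.sum_comm]
    have hl : ∀ l : Fin (k + 1), ∑ L : Multidigraph N (k + 1),
        ((-1) ^ (n * l.val) * edgePairing n (L l) (Γ (Fin.last k)) *
          graPairing n k (L ∘ l.succAbove) (Γ ∘ Fin.castSucc)) • F L =
        (2 * pairingConst n k) • F (Fin.cons (Γ (Fin.last k)) (Γ ∘ Fin.castSucc)) := by
      intro l
      refine (Equiv.sum_comp (Fin.insertNthEquiv (fun _ : Fin (k + 1) => Fin N × Fin N) l)
        _).symm.trans ?_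
      refine (Fintype.sum_prod_type_right _).trans ?_
      rw [mul_smul, ← ih (hF.cons _), Finset.smul_sum]
      refine Finset.sum_congr (M := M) rfl fun L _ => ?_
      rw [smul_comm, ← sum_edgePairing hF, Finset.smul_sum]
      refine Finset.sum_congr (M := M) rfl fun p _ => ?_
      have h1 : (Fin.insertNthEquiv (fun _ : Fin (k + 1) => Fin N × Fin N) l (p, L)) ∘ l.succAbove =
          L := by
        funext e
        simp [Fin.insertNthEquiv]
      have h2 : Fin.insertNthEquiv (fun _ : Fin (k + 1) => Fin N × Fin N) l (p, L) l = p := by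
        simp [Fin.insertNthEquiv]
      rw [h1, h2]
      change _ • F (Fin.insertNth l p L) = _
      rw [hF.insertNth, smul_smul, smul_smul]
      congr 1
      have hs : ((-1 : ℝ) ^ (n * l.val)) * (-1) ^ (n * l.val) = 1 := by rw [← mul_pow]; simp
      linear_combination (edgePairing n p (Γ (Fin.last k)) *
        graPairing n k L (Γ ∘ Fin.castSucc)) * hs
    simp only [hl]
    rw [Finset.sum_const, Finset.card_univ, Fintype.card_fin, ← Nat.cast_smul_eq_nsmul ℝ]
    -- The sums above put the contracted edge in front, whereas it is the last edge of `Γ`; moving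
    -- it past `k` edges gives the sign in `pairingConst`.
    have h3 : Γ = Fin.insertNth (Fin.last k) (Γ (Fin.last k)) (Γ ∘ Fin.castSucc) := by
      rw [Fin.insertNth_last']
      exact (Fin.snoc_init_self Γ).symm
    have h4 : F Γ = ((-1 : ℝ) ^ (n * k)) • F (Fin.cons (Γ (Fin.last k)) (Γ ∘ Fin.castSucc)) := by
      have := hF.insertNth (Fin.last k) (Γ (Fin.last k)) (Γ ∘ Fin.castSucc)
      rw [← h3] at this
      exact this
    rw [h4, smul_smul, smul_smul, pairingConst]
    congr 1
    have hs : ((-1 : ℝ) ^ (n * k)) * (-1) ^ (n * k) = 1 := by rw [← mul_pow]; simp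
    push_cast
    linear_combination (-(2 * ((k : ℝ) + 1) * pairingConst n k)) * hs

/-! ### Test tensors on the cotangent chart and Wick contraction -/

namespace DarbouxChart

/-- The chart `T^*[n] ℝ^k`. -/
def cotangentChart (n k : ℕ) : DarbouxChart n where
  m := k
  r := fun _ => 0
  q := 0
  q_odd := fun _ => rfl
  κ := 0
  κ_symm := fun a => a.elim0
  κ_nondeg := by simp
  U := Set.univ
  isOpen_U := isOpen_univ

variable {n K : ℕ}

theorem zero_mem_cotangentChart :
    (0 : (cotangentChart n K).BaseCoord → ℝ) ∈ (cotangentChart n K).U := trivial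

/-- The coordinate `x` on the cotangent chart. -/
def xc (e : Fin K) : (cotangentChart n K).Coords := Coord.x e

/-- The coordinate `p` on the cotangent chart. -/
def pc (e : Fin K) : (cotangentChart n K).Coords := Coord.p e

theorem sum_cotangentChart {M : Type} [AddCommGroup M] (F : (cotangentChart n K).Coords → M) :
    ∑ A, F A = ∑ e : Fin K, F (xc e) + ∑ e : Fin K, F (pc e) := by
  refine (Equiv.sum_comp (Coord.equivSum n K (fun _ => 0) 0).symm F).symm.trans ?_
  rw [Fintype.sum_sum_type, Fintype.sum_sum_type]
  have h : ∀ G : ((Σ _ : Fin ((n - 1) / 2), Fin 0) ⊕ (Σ _ : Fin ((n - 1) / 2), Fin 0)) ⊕ Fin 0 → M,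
      ∑ z, G z = 0 := by
    intro G
    refine Finset.sum_eq_zero ?_
    rintro ((⟨_, z⟩ | ⟨_, z⟩) | z) _ <;> exact z.elim0
  rw [h, add_zero]
  rfl

theorem edgeOp_cotangentChart {N : ℕ} (i j : Fin N) :
    (cotangentChart n K).edgeOp i j = ∑ e : Fin K,
      ((cotangentChart n K).derivAt i (xc e) * (cotangentChart n K).derivAt j (pc e) +
        ((-1 : ℝ) ^ (n + 1)) •
          ((cotangentChart n K).derivAt i (pc e) * (cotangentChart n K).derivAt j (xc e))) := by
  have hif : (if Even n then (-1 : ℝ) else 1) = (-1) ^ (n + 1) := by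
    split_ifs with hn
    · exact (hn.add_one.neg_one_pow).symm
    · exact ((Nat.not_even_iff_odd.mp hn).add_one.neg_one_pow).symm
  have cxx : ∀ e f : Fin K, (cotangentChart n K).coeff (xc e) (xc f) = 0 := fun _ _ => rfl
  have cpp : ∀ e f : Fin K, (cotangentChart n K).coeff (pc e) (pc f) = 0 := fun _ _ => rfl
  have cxp : ∀ e f : Fin K, (cotangentChart n K).coeff (xc e) (pc f) = if e = f then 1 else 0 :=
    fun _ _ => rfl
  have cpx : ∀ e f : Fin K, (cotangentChart n K).coeff (pc e) (xc f) =
    if e = f then (-1) ^ (n + 1) else 0 := fun e f => by rw [← hif]; rfl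
  rw [edgeOp]
  simp only [sum_cotangentChart, cxx, cpp, cxp, cpx, zero_smul, Finset.sum_const_zero, zero_add,
    add_zero, ite_smul, one_smul, Finset.sum_ite_eq, Finset.mem_univ, if_true,
    Finset.sum_add_distrib]
  exact add_comm _ _

/-- The operator creating an edge labelled `e`. -/
def createEdge {N : ℕ} (e : Fin K) (p : Fin N × Fin N) : TensorEnd (cotangentChart n K) N :=
  mulAt p.2 (pc e) * mulAt p.1 (xc e)

theorem neg_one_pow_mul_self (n : ℕ) : (-1 : ℝ) ^ (n * n) = (-1) ^ n := by
  rcases Nat.even_or_odd n with hn | hn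
  · rw [hn.neg_one_pow, (hn.mul_left n).neg_one_pow]
  · rw [hn.neg_one_pow, (hn.mul hn).neg_one_pow]

theorem derivAt_x_createEdge {N : ℕ} (i : Fin N) (e e' : Fin K) (p : Fin N × Fin N)
    (y : ⨂[ℝ] _ : Fin N, (cotangentChart n K).Fun) :
    (cotangentChart n K).derivAt i (xc e') (createEdge e p y) =
      (if i = p.1 ∧ e' = e then (1 : ℝ) else 0) • mulAt p.2 (pc e) y +
        createEdge e p ((cotangentChart n K).derivAt i (xc e') y) := by
  have h1 : (xc e' : (cotangentChart n K).Coords).deg = 0 := rfl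
  have h2 : ¬ (xc e' : (cotangentChart n K).Coords) = pc e := by rintro ⟨⟩
  have h3 : ((xc e' : (cotangentChart n K).Coords) = xc e) ↔ e' = e :=
    ⟨fun h => Coord.x.inj h, fun h => h ▸ rfl⟩
  rw [createEdge, Module.End.mul_apply, Module.End.mul_apply, derivAt_mulAt, derivAt_mulAt, h1]
  simp only [h2, h3, and_false, if_false, zero_smul, zero_add, zero_mul, pow_zero, one_smul,
    map_add, map_smul]

theorem derivAt_p_createEdge {N : ℕ} (i : Fin N) (e e' : Fin K) (p : Fin N × Fin N)
    (y : ⨂[ℝ] _ : Fin N, (cotangentChart n K).Fun) :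
    (cotangentChart n K).derivAt i (pc e') (createEdge e p y) =
      (if i = p.2 ∧ e' = e then (1 : ℝ) else 0) • mulAt p.1 (xc e) y +
        ((-1 : ℝ) ^ n) • createEdge e p ((cotangentChart n K).derivAt i (pc e') y) := by
  have h1 : (pc e' : (cotangentChart n K).Coords).deg = n := rfl
  have h1' : (pc e : (cotangentChart n K).Coords).deg = n := rfl
  have h1'' : (xc e : (cotangentChart n K).Coords).deg = 0 := rfl
  have h2 : ¬ (pc e' : (cotangentChart n K).Coords) = xc e := by rintro ⟨⟩
  have h3 : ((pc e' : (cotangentChart n K).Coords) = pc e) ↔ e' = e :=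
    ⟨fun h => Coord.p.inj h, fun h => h ▸ rfl⟩
  rw [createEdge, Module.End.mul_apply, Module.End.mul_apply, derivAt_mulAt, derivAt_mulAt, h1, h1',
    h1'', neg_one_pow_mul_self]
  simp only [h2, h3, and_false, if_false, zero_smul, zero_add, mul_zero, pow_zero, one_smul]

/-- No edge labelled `e` occurs in `y`. -/
def EdgeFree {N : ℕ} (e : Fin K) (y : ⨂[ℝ] _ : Fin N, (cotangentChart n K).Fun) : Prop :=
  ∀ i, (cotangentChart n K).derivAt i (xc e) y = 0 ∧ (cotangentChart n K).derivAt i (pc e) y = 0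

theorem EdgeFree.createEdge {N : ℕ} {e e' : Fin K} (hne : e' ≠ e) (p : Fin N × Fin N)
    {y : ⨂[ℝ] _ : Fin N, (cotangentChart n K).Fun} (hy : EdgeFree e' y) :
    EdgeFree e' (createEdge e p y) := by
  intro i
  rw [derivAt_x_createEdge, derivAt_p_createEdge, (hy i).1, (hy i).2]
  simp [hne]

/-- As the label `e` occurs nowhere in `y`, the two derivatives of one term of the edge operator
either both hit the created edge or both pass it. Hitting it is possible in parallel or antiparallel
direction, which is `edgePairing`; passing it costs `(-1)^n`. A term with only one hit would need a
second occurrence of `e`. -/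
theorem edgeOp_createEdge {N : ℕ} (e : Fin K) (p q : Fin N × Fin N)
    {y : ⨂[ℝ] _ : Fin N, (cotangentChart n K).Fun} (hy : EdgeFree e y) :
    (cotangentChart n K).edgeOp q.1 q.2 (createEdge e p y) =
      edgePairing n p q • y +
        ((-1 : ℝ) ^ n) • createEdge e p ((cotangentChart n K).edgeOp q.1 q.2 y) := by
  set D := fun (i : Fin N) A => (cotangentChart n K).derivAt i A with hD
  have key : ∀ (i j : Fin N) (e' : Fin K), D i (xc e') (D j (pc e') (createEdge e p y)) =
      (if e' = e then (if p = (i, j) then (1 : ℝ) else 0) • y else 0) +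
        ((-1 : ℝ) ^ n) • createEdge e p (D i (xc e') (D j (pc e') y)) := by
    intro i j e'
    simp only [hD]
    rw [derivAt_p_createEdge, map_add, map_smul, map_smul, derivAt_x_createEdge, derivAt_mulAt]
    have h1 : (xc e' : (cotangentChart n K).Coords).deg = 0 := rfl
    have h3 : ((xc e' : (cotangentChart n K).Coords) = xc e) ↔ e' = e :=
      ⟨fun h => Coord.x.inj h, fun h => h ▸ rfl⟩
    by_cases he : e' = e
    · subst he
      rw [(hy i).1, (hy j).2]
      simp only [and_true, map_zero, smul_zero, add_zero, if_true, smul_smul]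
      congr 1
      obtain ⟨s, t⟩ := p
      simp only [Prod.mk.injEq, eq_comm (a := i), eq_comm (a := j)]
      split_ifs <;> simp_all
    · simp [he]
  have key2 : ∀ (i j : Fin N) (e' : Fin K),
      D i (pc e') (D j (xc e') (createEdge e p y)) =
      (if e' = e then (if p = (j, i) then (1 : ℝ) else 0) • y else 0) +
        ((-1 : ℝ) ^ n) • createEdge e p (D i (pc e') (D j (xc e') y)) := by
    intro i j e'
    -- Since `x` has degree `0`, its derivative commutes with `∂_p` without sign, and this kind of
    -- term reduces to `key` with `i` and `j` exchanged.
    have hc : ∀ z, D i (pc e') (D j (xc e') z) = D j (xc e') (D i (pc e') z) := by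
      intro z
      have := LinearMap.congr_fun (derivAt_comm (V := cotangentChart n K) i j (pc e') (xc e')) z
      rw [show (xc e' : (cotangentChart n K).Coords).deg = 0 from rfl, mul_zero, pow_zero,
        one_smul] at this
      exact this
    rw [hc, hc, key]
  have hk := key q.1 q.2
  have hk2 := key2 q.1 q.2
  simp only [hD] at hk hk2
  rw [edgeOp_cotangentChart, LinearMap.sum_apply, LinearMap.sum_apply, map_sum, Finset.smul_sum]
  have h : ∀ e' : Fin K, ((cotangentChart n K).derivAt q.1 (xc e') *
      (cotangentChart n K).derivAt q.2 (pc e') + ((-1 : ℝ) ^ (n + 1)) •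
        ((cotangentChart n K).derivAt q.1 (pc e') * (cotangentChart n K).derivAt q.2 (xc e')))
          (createEdge e p y) = (if e' = e then edgePairing n p q • y else 0) +
      ((-1 : ℝ) ^ n) • createEdge e p (((cotangentChart n K).derivAt q.1 (xc e') *
      (cotangentChart n K).derivAt q.2 (pc e') + ((-1 : ℝ) ^ (n + 1)) •
        ((cotangentChart n K).derivAt q.1 (pc e') * (cotangentChart n K).derivAt q.2 (xc e'))) y) := by
    intro e'
    simp only [LinearMap.add_apply, LinearMap.smul_apply, Module.End.mul_apply, hk, hk2, map_add,
      map_smul, smul_add, edgePairing]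
    have hsw : (p = (q.2, q.1)) ↔ p = q.swap := Iff.rfl
    simp only [hsw, Prod.mk.eta]
    rw [smul_comm ((-1 : ℝ) ^ n) ((-1 : ℝ) ^ (n + 1))]
    split_ifs <;> module
  simp only [h]
  rw [Finset.sum_add_distrib, Finset.sum_ite_eq' Finset.univ e, if_pos (Finset.mem_univ e)]

/-- The tensor dual to a graph with edges labelled by `c`. -/
def graTensor {N k : ℕ} (c : Fin k → Fin K) (L : Multidigraph N k) :
    ⨂[ℝ] _ : Fin N, (cotangentChart n K).Fun :=
  (List.ofFn fun l => createEdge (c l) (L l)).prod (vac (cotangentChart n K) N)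

theorem graTensor_zero {N : ℕ} (c : Fin 0 → Fin K) (L : Multidigraph N 0) :
    graTensor (n := n) c L = vac (cotangentChart n K) N := by
  simp [graTensor]

theorem graTensor_succ {N k : ℕ} (c : Fin (k + 1) → Fin K) (L : Multidigraph N (k + 1)) :
    graTensor (n := n) c L =
      createEdge (c 0) (L 0) (graTensor (fun l => c l.succ) fun l => L l.succ) := by
  rw [graTensor, List.ofFn_succ, List.prod_cons, Module.End.mul_apply]
  rfl

theorem edgeFree_graTensor {N k : ℕ} (e : Fin K) (c : Fin k → Fin K) (L : Multidigraph N k)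
    (hc : ∀ l, e ≠ c l) : EdgeFree (n := n) e (graTensor c L) := by
  induction k with
  | zero =>
    rw [graTensor_zero]
    exact fun i => ⟨derivAt_vac _ _, derivAt_vac _ _⟩
  | succ k ih =>
    rw [graTensor_succ]
    exact (ih _ _ fun l => hc l.succ).createEdge (hc 0) _

theorem edgeOp_vac {N : ℕ} (i j : Fin N) :
    (cotangentChart n K).edgeOp i j (vac (cotangentChart n K) N) = 0 := by
  rw [edgeOp]
  simp [Module.End.mul_apply, derivAt_vac]

/-- The operator is moved through the created edges one by one, leaving a contraction at each and a
sign `(-1)^n` for each one passed, until `vac` annihilates it. -/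
theorem edgeOp_graTensor {N k : ℕ} (c : Fin (k + 1) → Fin K) (hc : Function.Injective c)
    (L : Multidigraph N (k + 1)) (q : Fin N × Fin N) :
    (cotangentChart n K).edgeOp q.1 q.2 (graTensor c L) = ∑ l : Fin (k + 1),
      ((-1) ^ (n * l.val) * edgePairing n (L l) q) •
        graTensor (c ∘ l.succAbove) (L ∘ l.succAbove) := by
  induction k with
  | zero =>
    rw [graTensor_succ, edgeOp_createEdge _ _ _ (edgeFree_graTensor _ _ _ fun l => l.elim0),
      graTensor_zero, edgeOp_vac, map_zero, smul_zero, add_zero]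
    simp [graTensor_zero]
  | succ k ih =>
    rw [graTensor_succ, edgeOp_createEdge _ _ _ (edgeFree_graTensor _ _ _ fun l hl =>
      absurd (hc hl) (Fin.succ_ne_zero l).symm),
      ih (fun l => c l.succ) (hc.comp (Fin.succ_injective _)), Fin.sum_univ_succ (n := k + 1), map_sum, Finset.smul_sum]
    congr 1
    · simp
      rfl
    · refine Finset.sum_congr rfl fun l _ => ?_
      rw [map_smul, smul_smul, graTensor_succ]
      congr 1
      · rw [Fin.val_succ, mul_add, mul_one, pow_add]
        ring
      · simp only [Function.comp_apply, Fin.succ_succAbove_zero, Fin.succ_succAbove_succ]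
        rfl

theorem edgesOp_castSucc {V : DarbouxChart n} {N k : ℕ} (Γ : Multidigraph N (k + 1)) :
    edgesOp (V := V) Γ = edgesOp (Γ ∘ Fin.castSucc) *
      V.edgeOp (Γ (Fin.last k)).1 (Γ (Fin.last k)).2 := by
  unfold edgesOp
  rw [List.ofFn_succ', List.concat_eq_append, List.prod_append, List.prod_singleton]
  rfl

theorem ev_createEdge {N : ℕ} (e : Fin K) (p : Fin N × Fin N)
    (y : ⨂[ℝ] _ : Fin N, (cotangentChart n K).Fun) :
    ev zero_mem_cotangentChart N (createEdge e p y) = 0 :=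
  LinearMap.congr_fun (ev_mulAt zero_mem_cotangentChart p.2 (pc e)) (mulAt p.1 (xc e) y)

/-- The labels form an arbitrary injection into `Fin K`, because every contraction removes one of
them while the chart stays the same. -/
theorem ev_edgesOp_graTensor {N k : ℕ} (c : Fin k → Fin K) (hc : Function.Injective c)
    (L Γ : Multidigraph N k) :
    ev zero_mem_cotangentChart N (edgesOp Γ (graTensor (n := n) c L)) = graPairing n k L Γ := by
  induction k with
  | zero => rw [edgesOp_zero, graTensor_zero, graPairing]; exact ev_vac _ _
  | succ k ih =>
    rw [edgesOp_castSucc, Module.End.mul_apply, edgeOp_graTensor c hc, map_sum, map_sum, graPairing]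
    refine Finset.sum_congr rfl fun l _ => ?_
    rw [map_smul, map_smul, ih _ (hc.comp Fin.succAbove_right_injective), smul_eq_mul]

/-- With unequal numbers of edges either a created edge survives and is killed by `ev`, or an edge
operator reaches `vac`. -/
theorem ev_edgesOp_graTensor_of_ne {N k k' : ℕ} (h : k' ≠ k) (c : Fin k → Fin K)
    (hc : Function.Injective c) (L : Multidigraph N k) (Γ : Multidigraph N k') :
    ev zero_mem_cotangentChart N (edgesOp Γ (graTensor (n := n) c L)) = 0 := by
  induction k' generalizing k with
  | zero =>
    cases k with
    | zero => exact absurd rfl h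
    | succ k => rw [edgesOp_zero, graTensor_succ]; exact ev_createEdge _ _ _
  | succ k' ih =>
    rw [edgesOp_castSucc, Module.End.mul_apply]
    cases k with
    | zero => rw [graTensor_zero, edgeOp_vac, map_zero, map_zero]
    | succ k =>
      rw [edgeOp_graTensor c hc, map_sum, map_sum]
      refine Finset.sum_eq_zero fun l _ => ?_
      rw [map_smul, map_smul, ih (by omega) _ (hc.comp Fin.succAbove_right_injective), smul_zero]

/-- The coefficient functionals on multilinear maps. -/
def graFunctional {N K : ℕ} (L : Multidigraph N K) : MLMap (cotangentChart n K) N →ₗ[ℝ] ℝ where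
  toFun θ := aug zero_mem_cotangentChart (PiTensorProduct.lift θ (graTensor id L))
  map_add' θ θ' := by rw [map_add, LinearMap.add_apply, map_add]
  map_smul' c θ := by rw [map_smul, LinearMap.smul_apply, map_smul]; rfl

theorem graFunctional_rep {N k : ℕ} (L : Multidigraph N K) (Γ : Multidigraph N k) :
    graFunctional L ((cotangentChart n K).rep Γ) =
      ev zero_mem_cotangentChart N (edgesOp Γ (graTensor (n := n) id L)) := by
  change aug _ (PiTensorProduct.lift _ _) = _
  rw [rep_eq, lift_pre]
  rfl

variable (n) in
/-- Up to a factor, the projection to the graphs with `K` edges. -/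
def edgeProj (a K : ℕ) : Gra (n + 1) (a + 1) →ₗ[ℝ] Gra (n + 1) (a + 1) :=
  ∑ L : Multidigraph (a + 1) K,
    (graFunctional L ∘ₗ graRep (cotangentChart n K) a).smulRight (Gra.mk (n + 1) L)

theorem edgeProj_apply (a K : ℕ) (z : Gra (n + 1) (a + 1)) :
    edgeProj n a K z = ∑ L : Multidigraph (a + 1) K,
      graFunctional L (graRep (cotangentChart n K) a z) • Gra.mk (n + 1) L := by
  rw [edgeProj, LinearMap.sum_apply]
  rfl

theorem isGraFunction_mk (N k : ℕ) :
    IsGraFunction n fun L : Multidigraph N k => Gra.mk (n + 1) L where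
  perm := fun L τ => by
    rw [Gra.mk_perm]
    congr 1
    rw [pow_add, pow_add, pow_one, mul_assoc, ← Units.val_mul, ← sq, Int.units_sq]; simp
  flip := fun L e => Gra.mk_flip _ _ _

theorem edgeProj_mk (a K k : ℕ) (Γ : Multidigraph (a + 1) k) :
    edgeProj n a K (Gra.mk (n + 1) Γ) =
      if k = K then pairingConst n K • Gra.mk (n + 1) Γ else 0 := by
  rw [edgeProj_apply]
  simp only [graRep_mk, graFunctional_rep]
  split_ifs with h
  · subst h
    simp only [ev_edgesOp_graTensor id Function.injective_id]
    exact sum_graPairing k (isGraFunction_mk _ _) Γ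
  · refine Finset.sum_eq_zero fun L _ => ?_
    rw [ev_edgesOp_graTensor_of_ne h id Function.injective_id, zero_smul]

/-- An element of `Gra` involves finitely many graphs, hence boundedly many edges, and is the sum of
its normalised projections. Allowing all large `K` gives the summands of a linear combination a
common range. -/
theorem eq_sum_edgeProj {a : ℕ} (z : Gra (n + 1) (a + 1)) :
    ∃ K₀, ∀ K ≥ K₀, z = ∑ k ∈ Finset.range K, (pairingConst n k)⁻¹ • edgeProj n a k z := by
  obtain ⟨y, rfl⟩ := Submodule.mkQ_surjective (graRel (n + 1) (a + 1)) z
  change ∃ K₀, ∀ K ≥ K₀, Gra.proj (n + 1) (a + 1) y =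
    ∑ k ∈ Finset.range K, (pairingConst n k)⁻¹ • edgeProj n a k (Gra.proj (n + 1) (a + 1) y)
  induction y using Finsupp.induction_linear with
  | zero => exact ⟨0, fun K _ => by simp⟩
  | add y y' h h' =>
    obtain ⟨K, hK⟩ := h
    obtain ⟨K', hK'⟩ := h'
    refine ⟨max K K', fun k hk => ?_⟩
    simp only [map_add, smul_add, Finset.sum_add_distrib]
    rw [← hK k (le_of_max_le_left hk), ← hK' k (le_of_max_le_right hk)]
  | single Γ r =>
    obtain ⟨k, Γ⟩ := Γ
    refine ⟨k + 1, fun K hK => ?_⟩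
    have h1 : Gra.proj (n + 1) (a + 1) (Finsupp.single ⟨k, Γ⟩ r) = r • Gra.mk (n + 1) Γ := by
      rw [← Finsupp.smul_single_one, map_smul]
      rfl
    simp only [h1, map_smul, edgeProj_mk, smul_ite, smul_zero, Finset.sum_ite_eq, Finset.mem_range]
    rw [if_pos (by omega), smul_comm r, smul_smul, inv_mul_cancel₀ (pairingConst_ne_zero n k),
      one_smul]

/-- The representations of `Gra` on functions are jointly faithful. -/
theorem eq_zero_of_graRep {a : ℕ} {z : Gra (n + 1) (a + 1)}
    (h : ∀ V : DarbouxChart n, graRep V a z = 0) : z = 0 := by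
  obtain ⟨K, hK⟩ := eq_sum_edgeProj z
  rw [hK K le_rfl]
  refine Finset.sum_eq_zero fun k _ => ?_
  rw [edgeProj_apply]
  simp [h]

theorem eq_zero_of_inducedMap {γ : GraSeq (n + 1)}
    (h : ∀ V : DarbouxChart n, V.inducedMap (graRep V) γ = 0) : γ = 0 := by
  funext a
  refine eq_zero_of_graRep fun V => ?_
  have h1 := congrFun (h V) a
  rw [inducedMap_apply] at h1
  rw [← susp_susp schoutenParity_schoutenParity n (graRep V a (γ a)), h1, Pi.zero_apply,
    ← suspₗ_apply, map_zero]

end DarbouxChart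

/-! ### The dg Lie algebra of graphs -/

/-- `fGCcomp` as a bilinear map. -/
def fGCcompₗ (d : ℕ) : GraSeq d →ₗ[ℝ] GraSeq d →ₗ[ℝ] GraSeq d :=
  LinearMap.mk₂ ℝ (fGCcomp d)
    (fun f f' g => by
      funext c
      simp only [fGCcomp, Pi.add_apply, map_add, LinearMap.add_apply, Finset.sum_add_distrib,
        smul_add])
    (fun r f g => by
      funext c
      simp only [fGCcomp, Pi.smul_apply, map_smul, LinearMap.smul_apply, Finset.smul_sum,
        smul_comm r])
    (fun f g g' => by
      funext c
      simp only [fGCcomp, Pi.add_apply, map_add, Finset.sum_add_distrib, smul_add])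
    (fun r f g => by
      funext c
      simp only [fGCcomp, Pi.smul_apply, map_smul, Finset.smul_sum, smul_comm r])

theorem Gra.relabel_mem_deg (d : ℕ) {N : ℕ} (σ : Equiv.Perm (Fin N)) {i : ℤ} {z : Gra d N}
    (hz : z ∈ Gra.deg d N i) : Gra.relabel d σ z ∈ Gra.deg d N i := by
  induction hz using Submodule.span_induction with
  | mem z hz =>
    obtain ⟨k, Γ, hk, rfl⟩ := hz
    rw [Gra.relabel_mk]
    exact Submodule.subset_span ⟨k, _, hk, rfl⟩
  | zero => rw [map_zero]; exact Submodule.zero_mem _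
  | add x y _ _ hx hy => rw [map_add]; exact Submodule.add_mem _ hx hy
  | smul c x _ hx => rw [map_smul]; exact Submodule.smul_mem _ _ hx

theorem Gra.compFirst_mem_deg (d : ℕ) {a b c : ℕ} (h : a + b = c) {i j : ℤ}
    {z : Gra d (a + 1)} (hz : z ∈ Gra.deg d (a + 1) i) {z' : Gra d (b + 1)}
    (hz' : z' ∈ Gra.deg d (b + 1) j) : Gra.compFirst d h z z' ∈ Gra.deg d (c + 1) (i + j) := by
  induction hz using Submodule.span_induction with
  | zero => rw [map_zero]; exact Submodule.zero_mem _
  | add x y _ _ hx hy => rw [map_add]; exact Submodule.add_mem _ hx hy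
  | smul c x _ hx => rw [map_smul]; exact Submodule.smul_mem _ _ hx
  | mem z hz =>
    obtain ⟨k, Γ, hk, rfl⟩ := hz
    induction hz' using Submodule.span_induction with
    | zero => rw [map_zero]; exact Submodule.zero_mem _
    | add x y _ _ hx hy => rw [map_add]; exact Submodule.add_mem _ hx hy
    | smul c x _ hx => rw [map_smul]; exact Submodule.smul_mem _ _ hx
    | mem z' hz' =>
      obtain ⟨k', Γ', hk', rfl⟩ := hz'
      rw [Gra.compFirst_mk]
      refine Submodule.sum_mem _ fun G _ => Submodule.subset_span ⟨k + k', _, ?_, rfl⟩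
      rw [← hk, ← hk']
      push_cast; ring

theorem fGCcomp_mem_deg (d : ℕ) {i j : ℤ} {γ γ' : GraSeq d} (hγ : γ ∈ fGC d i)
    (hγ' : γ' ∈ fGC d j) (c : ℕ) : fGCcomp d γ γ' c ∈ Gra.deg d (c + 1) (i + j - d * c) := by
  refine Submodule.sum_mem _ fun ab _ => Submodule.sum_mem _ fun σ _ => zsmul_mem ?_ _
  refine Gra.relabel_mem_deg d σ ?_
  have h := Finset.HasAntidiagonal.mem_antidiagonal.mp ab.2
  have h1 := Gra.compFirst_mem_deg d h (hγ ab.1.1).1 (hγ' ab.1.2).1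
  have h2 : i - d * (ab.1.1 : ℕ) + (j - d * (ab.1.2 : ℕ)) = i + j - d * c := by
    have h' : ((ab.1.1 : ℕ) : ℤ) + (ab.1.2 : ℕ) = c := by exact_mod_cast h
    linear_combination (-(d : ℤ)) * h'
  rwa [h2] at h1

open DarbouxChart

variable {n : ℕ}

/-- Identities between graphs can be tested in the cochain algebras of all charts; no graph
combinatorics is needed for the Lie algebra axioms. -/
theorem fGC_ext {γ γ' : GraSeq (n + 1)}
    (h : ∀ V : DarbouxChart n, V.inducedMap (graRep V) γ = V.inducedMap (graRep V) γ') :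
    γ = γ' := by
  refine sub_eq_zero.mp (eq_zero_of_inducedMap fun V => ?_)
  exact (map_sub (inducedₗ V) _ _).trans (sub_eq_zero.mpr (h V))

/-- The degree is read off from the graphs. The invariance under relabelling is imported: the image
of the bracket is skewsymmetric, and `eq_zero_of_graRep` brings this back to the graphs. -/
theorem fGCbracket_mem {i j : ℤ} {γ γ' : GraSeq (n + 1)} (hγ : γ ∈ fGC (n + 1) i)
    (hγ' : γ' ∈ fGC (n + 1) j) : fGCbracket (n + 1) i j γ γ' ∈ fGC (n + 1) (i + j) := by
  intro c
  constructor
  · refine Submodule.sub_mem _ (fGCcomp_mem_deg _ hγ hγ' c) (zsmul_mem ?_ _)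
    have := fGCcomp_mem_deg _ hγ' hγ c
    rwa [add_comm j i] at this
  · intro σ
    rw [← sub_eq_zero]
    refine eq_zero_of_graRep fun V => ?_
    have h1 := (nrBracket_mem isParityGrading_schoutenDeg (inducedMap_mem (V := V) hγ)
      (inducedMap_mem hγ') c).2 σ
    rw [← inducedMap_bracket hγ hγ', inducedMap_apply, permAct_susp_graRep] at h1
    have hs : ((Equiv.Perm.sign σ : ℤ) ^ n) * (Equiv.Perm.sign σ : ℤ) ^ n = 1 := by
      rcases Int.units_eq_one_or (Equiv.Perm.sign σ) with h | h <;> simp [h, ← mul_pow]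
    have h2 := congrArg (fun z => ((Equiv.Perm.sign σ : ℤ) ^ n) •
      susp n V.schoutenParity z) h1
    simp only [← suspₗ_apply, map_zsmul, smul_smul, hs, one_smul] at h2
    simp only [suspₗ_apply, susp_susp schoutenParity_schoutenParity] at h2
    rw [map_sub, map_zsmul, h2, ← pow_succ, sub_self]

theorem fGCbracket_jacobi {i j k : ℤ} {x y z : GraSeq (n + 1)} (hx : x ∈ fGC (n + 1) i)
    (hy : y ∈ fGC (n + 1) j) (hz : z ∈ fGC (n + 1) k) :
    fGCbracket (n + 1) i (j + k) x (fGCbracket (n + 1) j k y z) =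
      fGCbracket (n + 1) (i + j) k (fGCbracket (n + 1) i j x y) z +
        ((i * j).negOnePow : ℤ) •
          fGCbracket (n + 1) j (i + k) y (fGCbracket (n + 1) i k x z) := by
  refine fGC_ext fun V => ?_
  rw [inducedMap_add, inducedMap_bracket hx (fGCbracket_mem hy hz), inducedMap_bracket hy hz,
    inducedMap_bracket (fGCbracket_mem hx hy) hz, inducedMap_bracket hx hy]
  refine (nrBracket_jacobi isParityGrading_schoutenDeg (inducedMap_mem hx) (inducedMap_mem hy)
    (inducedMap_mem hz)).trans (congrArg _ ?_)
  rw [← inducedMap_bracket hx hz, ← inducedMap_bracket hy (fGCbracket_mem hx hz)]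
  exact (map_zsmul (inducedₗ V) _ _).symm

theorem isDGLieAlgebra_fGC :
    IsDGLieAlgebra (fGC (n + 1)) (fGCbracket (n + 1)) (fGCdelta (n + 1)) :=
  isDGLieAlgebra_of_mul_self (br := fGCbracket (n + 1)) (m := edgeGraph (n + 1))
    (fun _ => fGCcompₗ (n + 1)) (fun _ _ _ _ => rfl)
    (fun _ _ _ hx _ hy => fGCbracket_mem hx hy)
    (fun _ _ _ _ hx _ hy _ hz => fGCbracket_jacobi hx hy hz) (edgeGraph_mem _)
    (fGCbracket_edgeGraph _)

end

theorem mainTheorem3 (n : ℕ) :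
    IsDGLieAlgebra (fGC (n + 1)) (fGCbracket (n + 1)) (fGCdelta (n + 1)) ∧
    (∀ V : DarbouxChart n,
      IsDGLieAlgebra (CE V.schoutenDeg V.schoutenParity) (nrBracket V.schoutenParity) V.deltaS) ∧
    ∃ Rep : ∀ (V : DarbouxChart n) (a : ℕ),
        Gra (n + 1) (a + 1) →ₗ[ℝ] MultilinearMap ℝ (fun _ : Fin (a + 1) => V.Fun) V.Fun,
      (∀ (V : DarbouxChart n) (a k : ℕ) (Γ : Multidigraph (a + 1) k),
        Rep V a (Gra.mk (n + 1) Γ) = V.rep Γ) ∧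
      (∀ V : DarbouxChart n,
        IsDGLieHom (fGC (n + 1)) (fGCbracket (n + 1)) (fGCdelta (n + 1))
          (CE V.schoutenDeg V.schoutenParity) (nrBracket V.schoutenParity) V.deltaS
          (V.inducedMap (Rep V))) ∧
      (∀ (i : ℤ), ∀ γ ∈ fGC (n + 1) i,
        (∀ V : DarbouxChart n, V.inducedMap (Rep V) γ = 0) → γ = 0) := by
  refine ⟨isDGLieAlgebra_fGC, fun V => V.isDGLieAlgebra_CE, fun V => V.graRep,
    fun V a k Γ => DarbouxChart.graRep_mk Γ, fun V => V.isDGLieHom_inducedMap, ?_⟩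
  exact fun _ γ _ h => DarbouxChart.eq_zero_of_inducedMap h
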